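/- Let $(X,d)$ be a metric space, let $\mu$ be a Borel measure on $X$ (a measure on a $\sigma$-algebra containing the Borel sets; "measurable" refers to this $\sigma$-algebra, "Borel" to the Borel $\sigma$-algebra), and let $1\le p<\infty$. **Test curves.** A test curve is a function $\gamma:[0,1]\to X$ of bounded variation which is right-continuous on $[0,1)$, left-continuous at $1$, and has left limits in $X$ at all points of $(0,1)$. Let $TC$ be the set of all test curves, with the metric $d_0(\gamma,\gamma')=\int_0^1\min\{1,d(\gamma(t),\gamma'(t))\}\,dt$ and its Borel $\sigma$-algebra. Let $V(\gamma)$ be the variation of $\gamma$, $V_\gamma(t)$ the variation of $\gamma|_{[0,t]}$, and $\mu_\gamma$ the Lebesgue–Stieltjes measure on $[0,1]$ with $\mu_\gamma(\{0\})=0$ and $\mu_\gamma((r,t])=V_\gamma(t)-V_\gamma(r)$. The reversed curve is $\overleftarrow\gamma(t)=\lim_{s\to(1-t)^-}\gamma(s)$ for $t<1$, $\overleftarrow\gamma(1)=\gamma(0)$. For Borel $g:X\to[0,\infty]$ put $$\int^S_\gamma g=\frac12\Big(\int_{[0,1]}g\circ\gamma\,d\mu_\gamma+\int_{[0,1]}g\circ\overleftarrow\gamma\,d\mu_{\overleftarrow\gamma}\Big),\qquad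 \int^S_\nu g=\int_{TC}\int^S_\gamma g\;d\nu(\gamma)$$ for a Borel measure $\nu$ on $TC$. A test measure is a Borel measure $\nu$ on $TC$ with $\nu(\{\gamma: V(\gamma)=0\})=0$. **Moduli.** For a family $\Gamma$ of test curves of positive variation, the $p$-modulus of $\Gamma$ is $\inf_\rho\int_X\rho^p\,d\mu$ over all Borel $\rho:X\to[0,\infty]$ with $\int^S_\gamma\rho\ge1$ for all $\gamma\in\Gamma$. For a family of test measures, the generalized $p$-modulus is defined in the same way with $\int^S_\nu\rho\ge 1$ for all $\nu$ in the family. **Gradients.** Let $f:X\to\mathbb R$ and let $g:X\to[0,\infty]$ be Borel. * $g$ is a $p$-weak upper S-gradient of $f$ if $|f(\gamma(1))-f(\gamma(0))|\le\int^S_\gamma g$ for all test curves $\gamma$ of positive variation outside a family of $p$-modulus $0$. * For Borel $f$, $g$ is a generalized $p$-weak upper S-gradient of $f$ if $\int_{TC}|f(\gamma(1))-f(\gamma(0))|\,d\nu(\gamma)\le\int^S_\nu g$ for all test measures $\nu$ outside a family of generalized $p$-modulus $0$. * For Borel $f$, $g$ is a $\mu$-upper S-gradient of $f$ if the last inequality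 holds for every test measure $\nu$ that is a probability measure with $\int V\,d\nu<\infty$ and for which there is $C\ge0$ with $\nu(\{\gamma:\gamma(t)\in B\})\le C\mu(B)$ for all $t\in[0,1]$ and all Borel $B\subseteq X$. * A measurable (not necessarily Borel) $g:X\to[0,\infty]$ is a Hajłasz gradient of a measurable $f$ if there is a measurable $\mu$-null set $E$ with $|f(x)-f(y)|\le d(x,y)(g(x)+g(y))$ for all $x,y\in X\setminus E$. **Spaces.** In each case the (semi)norm is $\|f\|_{L^p(\mu)}+\inf_g\|g\|_{L^p(\mu)}$, the infimum being over the gradients of the relevant kind. * $N_{TC}^{1,p}$: measurable $f:X\to\mathbb R$ with $\int|f|^pd\mu<\infty$ having a $p$-weak upper S-gradient in $L^p(\mu)$, modulo the functions of seminorm $0$. * $\mathcal N_{\widehat{TC}}^{1,p}$: Borel $f:X\to\mathbb R$ with $\int|f|^pd\mu<\infty$ having a generalized $p$-weak upper S-gradient in $L^p(\mu)$, modulo the functions of seminorm $0$. * $G^{1,p}$: Borel $f:X\to\mathbb R$ with $\int|f|^pd\mu<\infty$ having a $\mu$-upper S-gradient in $L^p(\mu)$, modulo the functions of seminorm $0$.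 * $M^{1,p}$: the elements of $L^p(\mu)$ (classes modulo equality $\mu$-a.e.) having a Hajłasz gradient in $L^p(\mu)$. **Conditions on $\mu$.** $\mu$ is Borel regular if every $A\subseteq X$ is contained in a Borel set $B$ with $\mu(B)=\mu(A)$ ($\mu$ being extended to all subsets as an outer measure). $\mu$ is doubling if there is $C$ such that $0<\mu(B(x,r))<\infty$ and $\mu(B(x,2r))\le C\mu(B(x,r))$ for all $x\in X$, $r>0$. **Maps.** $A\hookrightarrow B$ means that there is a well-defined injective continuous linear map from $A$ to $B$ and $A\cong B$ that there is a linear homeomorphism from $A$ onto $B$. All maps are the canonical ones: $\mathcal N_{\widehat{TC}}^{1,p}\to N_{TC}^{1,p}$ sends the class of each $f$ to the class of the same $f$; $N_{TC}^{1,p}\to M^{1,p}$ sends the class of each $f$ to its $\mu$-a.e. class; $M^{1,p}\to G^{1,p}$ sends a $\mu$-a.e. class $u$ to the class of a function $f$ belonging to $u$; the class of $f$ in $G^{1,p}$ is the image of $u$ exactly when $f$ belongs to $u$. **Theorem.** 1. $\mathcal N_{\widehat{TC}}^{1,p}\hookrightarrow N_{TC}^{1,p}$; the canonical map $N_{TC}^{1,p}\to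 M^{1,p}$ is well defined, linear and continuous, and its kernel consists of the classes of the functions that are equal to $0$ $\mu$-a.e.; and the composition gives $\mathcal N_{\widehat{TC}}^{1,p}\hookrightarrow M^{1,p}$. 2. If $\mu$ is Borel regular, then $\mathcal N_{\widehat{TC}}^{1,p}\hookrightarrow N_{TC}^{1,p}\hookrightarrow M^{1,p}$. 3. If $\mu$ is $\sigma$-finite and Borel regular, then $\mathcal N_{\widehat{TC}}^{1,p}\cong N_{TC}^{1,p}\cong M^{1,p}\hookrightarrow G^{1,p}$. 4. If $\mu$ is doubling and Borel regular, then $\mathcal N_{\widehat{TC}}^{1,p}\cong N_{TC}^{1,p}\cong M^{1,p}\cong G^{1,p}$. -/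

import Mathlib

open MeasureTheory Set Filter Topology
open scoped NNReal ENNReal unitInterval

noncomputable section

set_option linter.unusedSectionVars false

namespace TCSobolev

/-! ### Test curves -/

/-- A test curve `γ : [0,1] → X`: a function of bounded variation, right-continuous on `[0,1)`,
left-continuous at `1`, and with left limits (in `X`) at all points of `(0,1)`. -/
structure TestCurve (X : Type*) [MetricSpace X] where
  toFun : I → X
  boundedVariation : BoundedVariationOn toFun univ
  right_cont : ∀ t : I, t < 1 → ContinuousWithinAt toFun (Ici t) t
  left_cont_one : ContinuousWithinAt toFun (Iic 1) 1
  left_lim : ∀ t : I, 0 < t → t < 1 → ∃ x, Tendsto toFun (𝓝[<] t) (𝓝 x)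

namespace TestCurve

variable {X : Type*} [MetricSpace X]

instance : CoeFun (TestCurve X) fun _ => I → X := ⟨TestCurve.toFun⟩

theorem right_cont' (γ : TestCurve X) (t : I) : ContinuousWithinAt γ (Ici t) t := by
  rcases lt_or_eq_of_le (unitInterval.le_one' (t := t)) with h | h
  · exact γ.right_cont t h
  · subst h
    have : Ici (1 : I) = {1} := by
      ext s; simp only [mem_Ici, mem_singleton_iff]
      exact ⟨fun hs => le_antisymm unitInterval.le_one' hs, fun hs => hs.ge⟩
    rw [this]; exact continuousWithinAt_singleton

theorem exists_left_lim (γ : TestCurve X) (t : I) : ∃ x, Tendsto γ (𝓝[<] t) (𝓝 x) := by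
  rcases eq_or_lt_of_le (unitInterval.nonneg' (t := t)) with h | h
  · subst h
    refine ⟨γ 0, ?_⟩
    have : Iio (0 : I) = ∅ := by
      ext s; simp
    rw [this]; simp
  rcases lt_or_eq_of_le (unitInterval.le_one' (t := t)) with h1 | h1
  · exact γ.left_lim t h h1
  · subst h1
    exact ⟨γ 1, γ.left_cont_one.mono_left (nhdsWithin_mono _ Iio_subset_Iic_self)⟩

theorem tendsto_leftLim (γ : TestCurve X) (t : I) :
    Tendsto γ (𝓝[<] t) (𝓝 (Function.leftLim γ t)) :=
  tendsto_leftLim_of_tendsto (γ.exists_left_lim t)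

theorem continuousWithinAt_leftLim (γ : TestCurve X) (t : I) :
    ContinuousWithinAt (Function.leftLim γ) (Iic t) t :=
  continuousWithinAt_leftLim_Iic (γ.tendsto_leftLim t)

theorem tendsto_leftLim_right (γ : TestCurve X) (t : I) :
    Tendsto (Function.leftLim γ) (𝓝[>] t) (𝓝 (γ t)) := by
  apply (closed_nhds_basis (γ t)).tendsto_right_iff.2
  rintro s ⟨s_mem, s_closed⟩
  have h1 : ∀ᶠ r in 𝓝[>] t, γ r ∈ s :=
    ((γ.right_cont' t).mono_left (nhdsWithin_mono _ Ioi_subset_Ici_self)) s_mem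
  rcases (Ioi t).eq_empty_or_nonempty with h0 | ⟨b, hb⟩
  · rw [h0]; simp
  obtain ⟨u, hu, hus⟩ := (mem_nhdsGT_iff_exists_Ioo_subset' hb).1 h1
  filter_upwards [Ioo_mem_nhdsGT hu] with c hc
  have : (𝓝[<] c).NeBot := by
    apply nhdsLT_neBot_of_exists_lt; exact ⟨t, hc.1⟩
  apply s_closed.mem_of_tendsto (γ.tendsto_leftLim c)
  filter_upwards [Ioo_mem_nhdsLT hc.1] with d hd using hus ⟨hd.1, hd.2.trans hc.2⟩

/-- The reversed curve `t ↦ γ((1 - t)⁻)`, with the convention `γ(0⁻) = γ(0)`. -/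
def reverse (γ : TestCurve X) : TestCurve X where
  toFun t := Function.leftLim γ (σ t)
  boundedVariation := by
    have h := γ.boundedVariation.leftLim
    have h2 := eVariationOn.comp_le_of_antitoneOn (Function.leftLim γ) (s := univ) (t := univ) σ
      (fun a _ b _ hab => unitInterval.symm_le_symm.2 hab) (fun _ _ => mem_univ _)
    exact ne_top_of_le_ne_top h h2
  right_cont t _ := by
    refine ContinuousWithinAt.comp (t := Iic (σ t)) (γ.continuousWithinAt_leftLim (σ t))
      unitInterval.continuous_symm.continuousWithinAt ?_
    intro s hs; exact unitInterval.symm_le_symm.2 hs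
  left_cont_one := by
    rw [← continuousWithinAt_Iio_iff_Iic, ContinuousWithinAt]
    have h0 : Function.leftLim γ (σ 1) = γ 0 := by
      rw [unitInterval.symm_one]
      exact leftLim_eq_of_isBot fun _ => unitInterval.nonneg'
    rw [h0]
    have h1 := γ.tendsto_leftLim_right 0
    refine h1.comp ?_
    refine tendsto_nhdsWithin_of_tendsto_nhds_of_eventually_within _ ?_ ?_
    · have := unitInterval.continuous_symm.tendsto (1 : I)
      rw [unitInterval.symm_one] at this
      exact this.mono_left nhdsWithin_le_nhds
    · filter_upwards [self_mem_nhdsWithin] with s hs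
      have : σ 1 < σ s := unitInterval.symm_lt_symm.2 hs
      simpa using this
  left_lim t _ _ := by
    refine ⟨γ (σ t), (γ.tendsto_leftLim_right (σ t)).comp ?_⟩
    refine tendsto_nhdsWithin_of_tendsto_nhds_of_eventually_within _ ?_ ?_
    · exact (unitInterval.continuous_symm.tendsto t).mono_left nhdsWithin_le_nhds
    · filter_upwards [self_mem_nhdsWithin] with s hs
      exact unitInterval.symm_lt_symm.2 hs

/-- The (total) variation `V(γ)`. -/
def variation (γ : TestCurve X) : ℝ≥0∞ := eVariationOn γ univ

/-- The variation function `V_γ(t) = V(γ|_[0,t])`, as a nondecreasing right-continuous function. -/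
def variationFunction (γ : TestCurve X) : StieltjesFunction I where
  toFun t := (eVariationOn γ (Icc 0 t)).toReal
  mono' s t hst := by
    refine ENNReal.toReal_mono ?_ (eVariationOn.mono _ (Icc_subset_Icc_right hst))
    exact γ.boundedVariation.mono (subset_univ _)
  right_continuous' t := by
    have h := γ.boundedVariation.continuousWithinAt_variationOnFromTo_Ici (a := 0) (γ.right_cont' t)
    have : (fun t => (eVariationOn γ (Icc 0 t)).toReal) = variationOnFromTo γ univ 0 := by
      ext s
      rw [variationOnFromTo.eq_of_le _ _ unitInterval.nonneg', univ_inter]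
    rw [this]; exact h

/-- The Lebesgue--Stieltjes measure `μ_γ` on `[0,1]`: `μ_γ((r,t]) = V_γ(t) - V_γ(r)`,
`μ_γ({0}) = 0`. -/
def stieltjesMeasure (γ : TestCurve X) : Measure I := γ.variationFunction.measure

/-- The integral `∫_γ g = ∫_[0,1] g ∘ γ dμ_γ`. -/
def lineIntegral (γ : TestCurve X) (g : X → ℝ≥0∞) : ℝ≥0∞ := ∫⁻ t, g (γ t) ∂γ.stieltjesMeasure

/-- The symmetrized integral of `g` along `γ`: the average of the integrals along `γ` and along
its reversal. -/
def symIntegral (γ : TestCurve X) (g : X → ℝ≥0∞) : ℝ≥0∞ :=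
  (γ.lineIntegral g + γ.reverse.lineIntegral g) / 2

/-- The metric of convergence in measure, `∫_0^1 min(1, d(γ(t), γ'(t))) dt`. -/
def measDist (γ γ' : TestCurve X) : ℝ≥0∞ := ∫⁻ t : I, min 1 (edist (γ t) (γ' t))

/-- The topology on the space of test curves defined by the metric `measDist`. -/
instance : TopologicalSpace (TestCurve X) where
  IsOpen U := ∀ γ ∈ U, ∃ ε : ℝ≥0∞, 0 < ε ∧ {γ' | measDist γ γ' < ε} ⊆ U
  isOpen_univ _ _ := ⟨1, one_pos, subset_univ _⟩
  isOpen_inter U V hU hV γ hγ := by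
    obtain ⟨ε, hε, h⟩ := hU γ hγ.1
    obtain ⟨δ, hδ, h'⟩ := hV γ hγ.2
    refine ⟨min ε δ, lt_min hε hδ, fun γ' hγ' => ?_⟩
    have hlt : measDist γ γ' < min ε δ := hγ'
    exact ⟨h (hlt.trans_le (min_le_left _ _)), h' (hlt.trans_le (min_le_right _ _))⟩
  isOpen_sUnion S hS γ hγ := by
    obtain ⟨U, hU, hγU⟩ := hγ
    obtain ⟨ε, hε, h⟩ := hS U hU γ hγU
    exact ⟨ε, hε, h.trans (subset_sUnion_of_mem hU)⟩

/-- The space of test curves carries its Borel `σ`-algebra. -/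
instance : MeasurableSpace (TestCurve X) := borel _

instance : BorelSpace (TestCurve X) := ⟨rfl⟩

theorem isOpen_iff {U : Set (TestCurve X)} :
    IsOpen U ↔ ∀ γ ∈ U, ∃ ε : ℝ≥0∞, 0 < ε ∧ {γ' | measDist γ γ' < ε} ⊆ U := Iff.rfl

theorem symIntegral_zero (γ : TestCurve X) : γ.symIntegral 0 = 0 := by
  simp [symIntegral, lineIntegral]

theorem symIntegral_mono (γ : TestCurve X) {g h : X → ℝ≥0∞} (hgh : ∀ x, g x ≤ h x) :
    γ.symIntegral g ≤ γ.symIntegral h := by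
  unfold symIntegral lineIntegral
  gcongr <;> exact hgh _

theorem symIntegral_add_le (γ : TestCurve X) (g h : X → ℝ≥0∞) :
    γ.symIntegral g + γ.symIntegral h ≤ γ.symIntegral (g + h) := by
  unfold symIntegral
  rw [← ENNReal.add_div, add_add_add_comm]
  gcongr <;> exact le_lintegral_add _ _

theorem symIntegral_smul (γ : TestCurve X) (c : ℝ≥0) (g : X → ℝ≥0∞) :
    γ.symIntegral (c • g) = c * γ.symIntegral g := by
  unfold symIntegral lineIntegral
  simp only [Pi.smul_apply, ENNReal.smul_def, smul_eq_mul]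
  rw [lintegral_const_mul' _ _ ENNReal.coe_ne_top, lintegral_const_mul' _ _ ENNReal.coe_ne_top,
    ← mul_add, mul_div_assoc]

/-- The set of test curves which map a given set into a closed set, is closed. -/
theorem isClosed_mapsTo {J : Set I} {F : Set X} (hF : IsClosed F)
    (hJ : ∀ s ∈ J, ∃ u, s < u ∧ Ico s u ⊆ J) :
    IsClosed {γ : TestCurve X | ∀ s ∈ J, γ s ∈ F} := by
  rw [← isOpen_compl_iff, isOpen_iff]
  intro γ hγ
  simp only [mem_compl_iff, mem_ofPred_eq, not_forall] at hγ
  obtain ⟨s, hsJ, hs⟩ := hγ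
  have hopen : IsOpen Fᶜ := hF.isOpen_compl
  obtain ⟨η, hη, hball⟩ := EMetric.isOpen_iff.1 hopen (γ s) hs
  have hη2 : 0 < η / 2 := ENNReal.half_pos hη.ne'
  obtain ⟨u, hsu, huJ⟩ := hJ s hsJ
  have h1 : ∀ᶠ r in 𝓝[≥] s, edist (γ r) (γ s) < η / 2 :=
    (γ.right_cont' s) (Metric.eball_mem_nhds _ hη2)
  obtain ⟨v, hv, hvs⟩ := (mem_nhdsGE_iff_exists_Ico_subset' hsu).1 h1
  set w := min u v with hw
  have hsw : s < w := lt_min hsu hv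
  have hvol : 0 < volume (Ico s w) := by
    rw [unitInterval.volume_Ico]
    simpa using hsw
  refine ⟨min 1 (η / 2) * volume (Ico s w), ?_, ?_⟩
  · exact ENNReal.mul_pos (lt_min one_pos hη2).ne' hvol.ne'
  · intro γ' hγ'
    simp only [mem_ofPred_eq, mem_compl_iff] at hγ' ⊢
    intro hcon
    refine absurd hγ' (not_lt.2 ?_)
    calc min 1 (η / 2) * volume (Ico s w) = ∫⁻ _ in Ico s w, min 1 (η / 2) := by simp
      _ ≤ ∫⁻ r in Ico s w, min 1 (edist (γ r) (γ' r)) := by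
          refine setLIntegral_mono' measurableSet_Ico fun r hr => min_le_min le_rfl ?_
          by_contra! hlt
          have hr1 : edist (γ r) (γ s) < η / 2 := hvs ⟨hr.1, hr.2.trans_le (min_le_right _ _)⟩
          have hr2 : γ' r ∈ F := hcon r (huJ ⟨hr.1, hr.2.trans_le (min_le_left _ _)⟩)
          refine hball ?_ hr2
          rw [Metric.mem_eball]
          calc edist (γ' r) (γ s) ≤ edist (γ' r) (γ r) + edist (γ r) (γ s) := edist_triangle _ _ _
            _ < η / 2 + η / 2 := ENNReal.add_lt_add (by rwa [edist_comm]) hr1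
            _ = η := ENNReal.add_halves η
      _ ≤ measDist γ γ' := setLIntegral_le_lintegral _ _

theorem measurable_eval_of_lt {t : I} (ht : t < 1) :
    @Measurable (TestCurve X) X _ (borel X) fun γ => γ t := by
  let _ : MeasurableSpace X := borel X
  have _ : BorelSpace X := ⟨rfl⟩
  refine measurable_of_isOpen fun U hU => ?_
  set F : ℕ → Set X := fun n => {x | ((n : ℝ≥0∞) + 1)⁻¹ ≤ Metric.infEDist x Uᶜ} with hF
  have hFc : ∀ n, IsClosed (F n) := fun n => isClosed_le continuous_const Metric.continuous_infEDist
  have hFU : ∀ n, F n ⊆ U := by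
    intro n x hx
    by_contra hxU
    have h0 : ((n : ℝ≥0∞) + 1)⁻¹ ≤ Metric.infEDist x Uᶜ := hx
    rw [Metric.infEDist_zero_of_mem (show x ∈ Uᶜ from hxU)] at h0
    simp at h0
  have hFm : ∀ x ∈ U, ∃ n, F n ∈ 𝓝 x := by
    intro x hx
    have h0 : Metric.infEDist x Uᶜ ≠ 0 := fun h =>
      (Metric.mem_iff_infEDist_zero_of_closed hU.isClosed_compl).2 h hx
    obtain ⟨n, hn⟩ := ENNReal.exists_inv_nat_lt h0
    refine ⟨n, ?_⟩
    have hn' : ((n : ℝ≥0∞) + 1)⁻¹ < Metric.infEDist x Uᶜ :=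
      (ENNReal.inv_le_inv.2 le_self_add).trans_lt hn
    filter_upwards [(Metric.continuous_infEDist (s := Uᶜ)).continuousAt.eventually
      (lt_mem_nhds hn')] with y hy using hy.le
  obtain ⟨D, hDc, hDd⟩ := TopologicalSpace.exists_countable_dense I
  have key : (fun γ : TestCurve X => γ t) ⁻¹' U =
      ⋃ n, ⋃ u ∈ D ∩ Ioi t, {γ : TestCurve X | ∀ s ∈ Ico t u, γ s ∈ F n} := by
    ext γ
    simp only [mem_preimage, mem_iUnion, exists_prop]
    constructor
    · intro hγ
      obtain ⟨n, hn⟩ := hFm _ hγ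
      have h1 : ∀ᶠ r in 𝓝[≥] t, γ r ∈ F n := (γ.right_cont' t) hn
      obtain ⟨v, hv, hvs⟩ := (mem_nhdsGE_iff_exists_Ico_subset' ht).1 h1
      obtain ⟨u, hu, huD⟩ := hDd.exists_mem_open isOpen_Ioo (nonempty_Ioo.2 hv)
      exact ⟨n, u, ⟨hu, huD.1⟩, fun s hs => hvs ⟨hs.1, hs.2.trans huD.2⟩⟩
    · rintro ⟨n, u, hu, h⟩
      exact hFU n (h t ⟨le_rfl, hu.2⟩)
  rw [key]
  refine MeasurableSet.iUnion fun n => MeasurableSet.biUnion (hDc.mono inter_subset_left)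
    fun u hu => (isClosed_mapsTo (hFc n) ?_).measurableSet
  exact fun s hs => ⟨u, hs.2, Ico_subset_Ico_left hs.1⟩

/-- Evaluation at a time `t` is a Borel map. -/
theorem measurable_eval (t : I) :
    @Measurable (TestCurve X) X _ (borel X) fun γ => γ t := by
  let _ : MeasurableSpace X := borel X
  have _ : BorelSpace X := ⟨rfl⟩
  rcases lt_or_eq_of_le (unitInterval.le_one' (t := t)) with h | rfl
  · exact measurable_eval_of_lt h
  have : (𝓝[<] (1 : I)).NeBot := nhdsLT_neBot_of_exists_lt ⟨0, zero_lt_one⟩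
  obtain ⟨u, hu⟩ := exists_seq_tendsto (𝓝[<] (1 : I))
  have hu1 : ∀ᶠ n in atTop, u n < 1 := hu.eventually self_mem_nhdsWithin
  obtain ⟨N, hN⟩ := eventually_atTop.1 hu1
  have hu' : Tendsto (fun n => u (n + N)) atTop (𝓝[<] 1) := hu.comp (tendsto_add_atTop_nat N)
  refine measurable_of_tendsto_metrizable (f := fun n (γ : TestCurve X) => γ (u (n + N)))
    (fun n => measurable_eval_of_lt (hN _ (by omega))) ?_
  rw [tendsto_pi_nhds]
  intro γ
  have h1 : Tendsto γ (𝓝[<] 1) (𝓝 (γ 1)) :=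
    γ.left_cont_one.mono_left (nhdsWithin_mono _ Iio_subset_Iic_self)
  exact h1.comp hu'

end TestCurve

variable {X : Type*} [MetricSpace X] [MeasurableSpace X]

/-! ### Moduli and upper gradients

Throughout, the `σ`-algebra of the measure `μ` contains the Borel sets of `X` (it may be larger),
so "Borel" is expressed by measurability with respect to `borel X`. -/

/-- The `p`-modulus of a family `Γ` of nontrivial test curves. -/
def modulus (p : ℝ≥0) (μ : Measure X) (Γ : Set (TestCurve X)) : ℝ≥0∞ :=
  ⨅ (ρ : X → ℝ≥0∞) (_ : Measurable[borel X] ρ ∧ ∀ γ ∈ Γ, 1 ≤ γ.symIntegral ρ),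
    ∫⁻ x, ρ x ^ (p : ℝ) ∂μ

/-- `g` is a `p`-weak upper S-gradient of `f`: `|f(γ(1)) - f(γ(0))|` is at most the symmetrized
integral of `g` along `γ`, for `p`-modulus almost every nontrivial test curve `γ`. -/
def IsWeakUpperSGradient (p : ℝ≥0) (μ : Measure X) (f : X → ℝ) (g : X → ℝ≥0∞) : Prop :=
  Measurable[borel X] g ∧
    modulus p μ {γ | 0 < γ.variation ∧ ¬ ‖f (γ 1) - f (γ 0)‖ₑ ≤ γ.symIntegral g} = 0

/-- Test measures: Borel measures on the space of test curves for which the set of trivial curves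
is null. -/
def testMeasures (X : Type*) [MetricSpace X] : Set (Measure (TestCurve X)) :=
  {ν | ν {γ | γ.variation = 0} = 0}

/-- The symmetrized integral of `g` along a measure on the space of test curves. -/
def symIntegralMeasure (ν : Measure (TestCurve X)) (g : X → ℝ≥0∞) : ℝ≥0∞ :=
  ∫⁻ γ, γ.symIntegral g ∂ν

/-- The generalized `p`-modulus of a family `Λ` of test measures. -/
def generalizedModulus (p : ℝ≥0) (μ : Measure X) (Λ : Set (Measure (TestCurve X))) : ℝ≥0∞ :=
  ⨅ (ρ : X → ℝ≥0∞) (_ : Measurable[borel X] ρ ∧ ∀ ν ∈ Λ, 1 ≤ symIntegralMeasure ν ρ),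
    ∫⁻ x, ρ x ^ (p : ℝ) ∂μ

/-- `g` is a generalized `p`-weak upper S-gradient of `f`. -/
def IsGeneralizedWeakUpperSGradient (p : ℝ≥0) (μ : Measure X) (f : X → ℝ) (g : X → ℝ≥0∞) : Prop :=
  Measurable[borel X] g ∧
    generalizedModulus p μ {ν | ν ∈ testMeasures X ∧
      ¬ ∫⁻ γ, ‖f (γ 1) - f (γ 0)‖ₑ ∂ν ≤ symIntegralMeasure ν g} = 0

/-- A Borel probability measure `ν` on the space of test curves is `μ`-admissible if its
push-forwards under all evaluation maps are bounded by a common multiple of `μ`, and the variation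
is `ν`-integrable. -/
def IsAdmissible (μ : Measure X) (ν : Measure (TestCurve X)) : Prop :=
  IsProbabilityMeasure ν ∧
    (∃ C : ℝ≥0, ∀ (t : I) (B : Set X), MeasurableSet[borel X] B → ν {γ | γ t ∈ B} ≤ C * μ B) ∧
    ∫⁻ γ, γ.variation ∂ν < ∞

/-- `g` is a `μ`-upper S-gradient of `f`: the upper gradient inequality holds after integration
against every `μ`-admissible test measure. -/
def IsMeasureUpperSGradient (μ : Measure X) (f : X → ℝ) (g : X → ℝ≥0∞) : Prop :=
  Measurable[borel X] g ∧ ∀ ν ∈ testMeasures X, IsAdmissible μ ν →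
    ∫⁻ γ, ‖f (γ 1) - f (γ 0)‖ₑ ∂ν ≤ symIntegralMeasure ν g

/-- `g` is a Hajłasz gradient of `f`. -/
def IsHajlaszGradient (μ : Measure X) (f : X → ℝ) (g : X → ℝ≥0∞) : Prop :=
  Measurable g ∧ ∃ E : Set X, MeasurableSet E ∧ μ E = 0 ∧
    ∀ x ∉ E, ∀ y ∉ E, ‖f y - f x‖ₑ ≤ (g x + g y) * edist x y

/-! ### Linear structure of gradients -/

section Gradients

variable [OpensMeasurableSpace X] {p : ℝ≥0} {μ : Measure X} {f f' : X → ℝ} {g g' : X → ℝ≥0∞}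

theorem measurable_of_borel {α : Type*} [MeasurableSpace α] {u : X → α}
    (hu : Measurable[borel X] u) : Measurable u :=
  hu.mono (OpensMeasurableSpace.borel_le) le_rfl

theorem borel_add (hg : Measurable[borel X] g) (hg' : Measurable[borel X] g') :
    Measurable[borel X] (g + g') := by
  let _ : MeasurableSpace X := borel X
  exact Measurable.add hg hg'

theorem borel_add_real (hf : Measurable[borel X] f) (hf' : Measurable[borel X] f') :
    Measurable[borel X] (f + f') := by
  let _ : MeasurableSpace X := borel X
  exact Measurable.add hf hf'

theorem borel_smul (hg : Measurable[borel X] g) (c : ℝ≥0) : Measurable[borel X] (c • g) := by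
  let _ : MeasurableSpace X := borel X
  exact Measurable.const_smul hg c

theorem modulus_mono {Γ Γ' : Set (TestCurve X)} (h : Γ ⊆ Γ') : modulus p μ Γ ≤ modulus p μ Γ' :=
  le_iInf₂ fun ρ hρ => iInf₂_le ρ ⟨hρ.1, fun γ hγ => hρ.2 γ (h hγ)⟩

theorem lintegral_sup_rpow_le {ρ ρ' : X → ℝ≥0∞} (hρ : Measurable[borel X] ρ) :
    ∫⁻ x, (ρ ⊔ ρ') x ^ (p : ℝ) ∂μ ≤ ∫⁻ x, ρ x ^ (p : ℝ) ∂μ + ∫⁻ x, ρ' x ^ (p : ℝ) ∂μ := by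
  rw [← lintegral_add_left ((measurable_of_borel hρ).pow_const _)]
  refine lintegral_mono fun x => ?_
  rcases le_total (ρ x) (ρ' x) with h | h
  · simp [sup_eq_right.2 h]
  · simp [sup_eq_left.2 h]

theorem borel_sup (hg : Measurable[borel X] g) (hg' : Measurable[borel X] g') :
    Measurable[borel X] (g ⊔ g') := by
  let _ : MeasurableSpace X := borel X
  exact Measurable.sup hg hg'

theorem modulus_union_le (Γ Γ' : Set (TestCurve X)) :
    modulus p μ (Γ ∪ Γ') ≤ modulus p μ Γ + modulus p μ Γ' := by
  unfold modulus
  refine ENNReal.le_iInf₂_add_iInf₂ fun ρ hρ ρ' hρ' => ?_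
  refine (iInf₂_le (ρ ⊔ ρ') ⟨borel_sup hρ.1 hρ'.1, ?_⟩).trans (lintegral_sup_rpow_le hρ.1)
  rintro γ (hγ | hγ)
  · exact (hρ.2 γ hγ).trans (γ.symIntegral_mono fun x => le_sup_left)
  · exact (hρ'.2 γ hγ).trans (γ.symIntegral_mono fun x => le_sup_right)

theorem generalizedModulus_mono {Γ Γ' : Set (Measure (TestCurve X))} (h : Γ ⊆ Γ') :
    generalizedModulus p μ Γ ≤ generalizedModulus p μ Γ' :=
  le_iInf₂ fun ρ hρ => iInf₂_le ρ ⟨hρ.1, fun γ hγ => hρ.2 γ (h hγ)⟩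

theorem symIntegralMeasure_mono (ν : Measure (TestCurve X)) (h : ∀ x, g x ≤ g' x) :
    symIntegralMeasure ν g ≤ symIntegralMeasure ν g' :=
  lintegral_mono fun γ => γ.symIntegral_mono h

theorem symIntegralMeasure_add_le (ν : Measure (TestCurve X)) (g g' : X → ℝ≥0∞) :
    symIntegralMeasure ν g + symIntegralMeasure ν g' ≤ symIntegralMeasure ν (g + g') :=
  (le_lintegral_add _ _).trans (lintegral_mono fun γ => γ.symIntegral_add_le g g')

theorem symIntegralMeasure_smul (ν : Measure (TestCurve X)) (c : ℝ≥0) (g : X → ℝ≥0∞) :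
    symIntegralMeasure ν (c • g) = c * symIntegralMeasure ν g := by
  unfold symIntegralMeasure
  simp only [TestCurve.symIntegral_smul]
  exact lintegral_const_mul' _ _ ENNReal.coe_ne_top

theorem generalizedModulus_union_le (Γ Γ' : Set (Measure (TestCurve X))) :
    generalizedModulus p μ (Γ ∪ Γ') ≤ generalizedModulus p μ Γ + generalizedModulus p μ Γ' := by
  unfold generalizedModulus
  refine ENNReal.le_iInf₂_add_iInf₂ fun ρ hρ ρ' hρ' => ?_
  refine (iInf₂_le (ρ ⊔ ρ') ⟨borel_sup hρ.1 hρ'.1, ?_⟩).trans (lintegral_sup_rpow_le hρ.1)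
  rintro γ (hγ | hγ)
  · exact (hρ.2 γ hγ).trans (symIntegralMeasure_mono γ fun x => le_sup_left)
  · exact (hρ'.2 γ hγ).trans (symIntegralMeasure_mono γ fun x => le_sup_right)

theorem modulus_empty (hp : 1 ≤ p) : modulus p μ ∅ = 0 := by
  refine le_antisymm ((iInf₂_le 0 ⟨@measurable_const _ _ _ (borel X) _, by simp⟩).trans ?_) bot_le
  have : (0 : ℝ) < p := lt_of_lt_of_le one_pos (by exact_mod_cast hp)
  simp [ENNReal.zero_rpow_of_pos this]

theorem generalizedModulus_empty (hp : 1 ≤ p) : generalizedModulus p μ ∅ = 0 := by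
  refine le_antisymm ((iInf₂_le 0 ⟨@measurable_const _ _ _ (borel X) _, by simp⟩).trans ?_) bot_le
  have : (0 : ℝ) < p := lt_of_lt_of_le one_pos (by exact_mod_cast hp)
  simp [ENNReal.zero_rpow_of_pos this]

theorem enorm_sub_add_le (a b a' b' : ℝ) : ‖(a + a') - (b + b')‖ₑ ≤ ‖a - b‖ₑ + ‖a' - b'‖ₑ := by
  rw [add_sub_add_comm]; exact enorm_add_le _ _

theorem enorm_smul_sub (c a b : ℝ) : ‖c * a - c * b‖ₑ = ‖c‖₊ * ‖a - b‖ₑ := by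
  rw [← mul_sub, enorm_mul]; rfl

theorem IsWeakUpperSGradient.zero (hp : 1 ≤ p) : IsWeakUpperSGradient p μ (0 : X → ℝ) 0 := by
  refine ⟨@measurable_const _ _ _ (borel X) _, ?_⟩
  simp [modulus_empty hp]

theorem IsWeakUpperSGradient.add (h : IsWeakUpperSGradient p μ f g)
    (h' : IsWeakUpperSGradient p μ f' g') : IsWeakUpperSGradient p μ (f + f') (g + g') := by
  refine ⟨borel_add h.1 h'.1, le_antisymm ?_ bot_le⟩
  refine (modulus_mono ?_).trans ((modulus_union_le _ _).trans ((add_le_add h.2.le h'.2.le).trans (by simp)))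
  rintro γ ⟨hv, hγ⟩
  by_contra hcon
  simp only [mem_union, mem_ofPred_eq, hv, true_and, not_or, not_not] at hcon
  exact hγ ((enorm_sub_add_le _ _ _ _).trans
    ((add_le_add hcon.1 hcon.2).trans (γ.symIntegral_add_le g g')))

theorem IsWeakUpperSGradient.smul (h : IsWeakUpperSGradient p μ f g) (c : ℝ) :
    IsWeakUpperSGradient p μ (c • f) (‖c‖₊ • g) := by
  refine ⟨borel_smul h.1 _, le_antisymm ((modulus_mono ?_).trans h.2.le) bot_le⟩
  rintro γ ⟨hv, hγ⟩
  refine ⟨hv, fun hcon => hγ ?_⟩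
  simp only [Pi.smul_apply, smul_eq_mul]
  rw [enorm_smul_sub, γ.symIntegral_smul]
  gcongr

theorem measurable_enorm_eval (hf : Measurable[borel X] f) :
    Measurable fun γ : TestCurve X => ‖f (γ 1) - f (γ 0)‖ₑ := by
  let _ : MeasurableSpace X := borel X
  exact ((hf.comp (TestCurve.measurable_eval 1)).sub (hf.comp (TestCurve.measurable_eval 0))).enorm

theorem lintegral_enorm_add_le (hf : Measurable[borel X] f) (f' : X → ℝ)
    (ν : Measure (TestCurve X)) :
    ∫⁻ γ, ‖(f + f') (γ 1) - (f + f') (γ 0)‖ₑ ∂ν ≤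
      ∫⁻ γ, ‖f (γ 1) - f (γ 0)‖ₑ ∂ν + ∫⁻ γ, ‖f' (γ 1) - f' (γ 0)‖ₑ ∂ν := by
  rw [← lintegral_add_left (measurable_enorm_eval hf)]
  exact lintegral_mono fun γ => enorm_sub_add_le _ _ _ _

theorem lintegral_enorm_smul (c : ℝ) (f : X → ℝ) (ν : Measure (TestCurve X)) :
    ∫⁻ γ, ‖(c • f) (γ 1) - (c • f) (γ 0)‖ₑ ∂ν = ‖c‖₊ * ∫⁻ γ, ‖f (γ 1) - f (γ 0)‖ₑ ∂ν := by
  simp only [Pi.smul_apply, smul_eq_mul, enorm_smul_sub]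
  exact lintegral_const_mul' _ _ ENNReal.coe_ne_top

theorem IsGeneralizedWeakUpperSGradient.zero (hp : 1 ≤ p) :
    IsGeneralizedWeakUpperSGradient p μ (0 : X → ℝ) 0 := by
  refine ⟨@measurable_const _ _ _ (borel X) _, ?_⟩
  simp [generalizedModulus_empty hp]

theorem IsGeneralizedWeakUpperSGradient.add (hf : Measurable[borel X] f)
    (h : IsGeneralizedWeakUpperSGradient p μ f g)
    (h' : IsGeneralizedWeakUpperSGradient p μ f' g') :
    IsGeneralizedWeakUpperSGradient p μ (f + f') (g + g') := by
  refine ⟨borel_add h.1 h'.1, le_antisymm ?_ bot_le⟩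
  refine (generalizedModulus_mono ?_).trans
    ((generalizedModulus_union_le _ _).trans ((add_le_add h.2.le h'.2.le).trans (by simp)))
  rintro ν ⟨hv, hν⟩
  by_contra hcon
  simp only [mem_union, mem_ofPred_eq, hv, true_and, not_or, not_not] at hcon
  exact hν ((lintegral_enorm_add_le hf f' ν).trans
    ((add_le_add hcon.1 hcon.2).trans (symIntegralMeasure_add_le ν g g')))

theorem IsGeneralizedWeakUpperSGradient.smul (h : IsGeneralizedWeakUpperSGradient p μ f g)
    (c : ℝ) : IsGeneralizedWeakUpperSGradient p μ (c • f) (‖c‖₊ • g) := by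
  refine ⟨borel_smul h.1 _, le_antisymm ((generalizedModulus_mono ?_).trans h.2.le) bot_le⟩
  rintro ν ⟨hv, hν⟩
  refine ⟨hv, fun hcon => hν ?_⟩
  rw [lintegral_enorm_smul, symIntegralMeasure_smul]
  gcongr

theorem IsMeasureUpperSGradient.zero : IsMeasureUpperSGradient μ (0 : X → ℝ) 0 :=
  ⟨@measurable_const _ _ _ (borel X) _, by simp⟩

theorem IsMeasureUpperSGradient.add (hf : Measurable[borel X] f)
    (h : IsMeasureUpperSGradient μ f g) (h' : IsMeasureUpperSGradient μ f' g') :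
    IsMeasureUpperSGradient μ (f + f') (g + g') :=
  ⟨borel_add h.1 h'.1, fun ν hν hν' => (lintegral_enorm_add_le hf f' ν).trans
    ((add_le_add (h.2 ν hν hν') (h'.2 ν hν hν')).trans (symIntegralMeasure_add_le ν g g'))⟩

theorem IsMeasureUpperSGradient.smul (h : IsMeasureUpperSGradient μ f g) (c : ℝ) :
    IsMeasureUpperSGradient μ (c • f) (‖c‖₊ • g) := by
  refine ⟨borel_smul h.1 _, fun ν hν hν' => ?_⟩
  rw [lintegral_enorm_smul, symIntegralMeasure_smul]
  gcongr
  exact h.2 ν hν hν'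

theorem IsHajlaszGradient.congr (h : IsHajlaszGradient μ f g) (hff' : f =ᵐ[μ] f') :
    IsHajlaszGradient μ f' g := by
  obtain ⟨hg, E, hE, hE0, hxy⟩ := h
  refine ⟨hg, E ∪ toMeasurable μ {x | f x ≠ f' x}, hE.union (measurableSet_toMeasurable _ _), ?_, ?_⟩
  · refine measure_union_null hE0 ?_
    rw [measure_toMeasurable]; exact hff'
  · intro x hx y hy
    simp only [mem_union, not_or] at hx hy
    have hx' : f x = f' x := by
      by_contra hne; exact hx.2 (subset_toMeasurable _ _ hne)
    have hy' : f y = f' y := by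
      by_contra hne; exact hy.2 (subset_toMeasurable _ _ hne)
    rw [← hx', ← hy']
    exact hxy x hx.1 y hy.1

theorem IsHajlaszGradient.zero : IsHajlaszGradient μ (0 : X → ℝ) 0 :=
  ⟨measurable_const, ∅, MeasurableSet.empty, measure_empty, by simp⟩

theorem IsHajlaszGradient.add (h : IsHajlaszGradient μ f g) (h' : IsHajlaszGradient μ f' g') :
    IsHajlaszGradient μ (f + f') (g + g') := by
  obtain ⟨hg, E, hE, hE0, hxy⟩ := h
  obtain ⟨hg', E', hE', hE0', hxy'⟩ := h'
  refine ⟨hg.add hg', E ∪ E', hE.union hE', measure_union_null hE0 hE0', ?_⟩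
  intro x hx y hy
  simp only [mem_union, not_or] at hx hy
  calc ‖(f + f') y - (f + f') x‖ₑ ≤ _ := enorm_sub_add_le _ _ _ _
    _ ≤ (g x + g y) * edist x y + (g' x + g' y) * edist x y :=
        add_le_add (hxy x hx.1 y hy.1) (hxy' x hx.2 y hy.2)
    _ = ((g + g') x + (g + g') y) * edist x y := by
        simp only [Pi.add_apply]; ring

theorem IsHajlaszGradient.smul (h : IsHajlaszGradient μ f g) (c : ℝ) :
    IsHajlaszGradient μ (c • f) (‖c‖₊ • g) := by
  obtain ⟨hg, E, hE, hE0, hxy⟩ := h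
  refine ⟨hg.const_smul _, E, hE, hE0, fun x hx y hy => ?_⟩
  simp only [Pi.smul_apply, smul_eq_mul, ENNReal.smul_def]
  rw [enorm_smul_sub, ← mul_add, mul_assoc]
  gcongr
  exact hxy x hx y hy

end Gradients

/-! ### The four function spaces -/

section Norms

/-- The infimum of the `L^p(μ)` norms of the functions `g` satisfying `G`. -/
def gradNorm (p : ℝ≥0) (μ : Measure X) (G : (X → ℝ≥0∞) → Prop) : ℝ≥0∞ :=
  ⨅ (g : X → ℝ≥0∞) (_ : G g), eLpNorm g p μ

variable {p : ℝ≥0} {μ : Measure X} {G G' G'' : (X → ℝ≥0∞) → Prop}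

theorem gradNorm_zero (h : G 0) : gradNorm p μ G = 0 :=
  le_antisymm ((iInf₂_le 0 h).trans (by simp)) bot_le

theorem gradNorm_ne_top (h : ∃ g, G g ∧ eLpNorm g p μ < ∞) : gradNorm p μ G ≠ ∞ := by
  obtain ⟨g, hg, hg'⟩ := h
  exact ((iInf₂_le g hg).trans_lt hg').ne

theorem eLpNorm_grad_add_le (hp : 1 ≤ p) {g g' : X → ℝ≥0∞} (hg : Measurable g)
    (hg' : Measurable g') : eLpNorm (g + g') p μ ≤ eLpNorm g p μ + eLpNorm g' p μ :=
  eLpNorm_add_le hg.aestronglyMeasurable hg'.aestronglyMeasurable (by exact_mod_cast hp)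

theorem eLpNorm_grad_smul_le (c : ℝ) (g : X → ℝ≥0∞) :
    eLpNorm (‖c‖₊ • g) p μ ≤ ‖c‖ₑ * eLpNorm g p μ :=
  eLpNorm_le_nnreal_smul_eLpNorm_of_ae_le_mul'
    (Eventually.of_forall fun x => by simp [ENNReal.smul_def]) _

theorem gradNorm_add_le (hp : 1 ≤ p) (hG : ∀ g, G g → Measurable g)
    (hG' : ∀ g, G' g → Measurable g) (h : ∀ g g', G g → G' g' → G'' (g + g')) :
    gradNorm p μ G'' ≤ gradNorm p μ G + gradNorm p μ G' :=
  ENNReal.le_iInf₂_add_iInf₂ fun g hg g' hg' =>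
    (iInf₂_le (g + g') (h g g' hg hg')).trans (eLpNorm_grad_add_le hp (hG g hg) (hG' g' hg'))

theorem gradNorm_smul_le {c : ℝ} (hc : c ≠ 0) (h : ∀ g, G g → G' (‖c‖₊ • g)) :
    gradNorm p μ G' ≤ ‖c‖ₑ * gradNorm p μ G := by
  unfold gradNorm
  have h0 : ‖c‖ₑ ≠ 0 := by simpa using hc
  rw [ENNReal.mul_iInf_of_ne h0 enorm_ne_top]
  refine le_iInf fun g => ?_
  rw [ENNReal.mul_iInf_of_ne h0 enorm_ne_top]
  exact le_iInf fun hg => (iInf₂_le _ (h g hg)).trans (eLpNorm_grad_smul_le c g)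

theorem seminormCore {V : Type*} [AddCommGroup V] [Module ℝ V] [Norm V] (E : V → ℝ≥0∞)
    (hE : ∀ v, ‖v‖ = (E v).toReal) (fin : ∀ v, E v ≠ ∞) (zero : E 0 = 0)
    (add : ∀ u v, E (u + v) ≤ E u + E v)
    (smul : ∀ (c : ℝ) (v : V), c ≠ 0 → E (c • v) ≤ ‖c‖ₑ * E v) :
    SeminormedSpace.Core ℝ V where
  norm_nonneg v := by rw [hE]; exact ENNReal.toReal_nonneg
  norm_smul c v := by
    rw [hE, hE]
    rcases eq_or_ne c 0 with rfl | hc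
    · simp [zero]
    have h1 := smul c v hc
    have h2 := smul c⁻¹ (c • v) (inv_ne_zero hc)
    rw [inv_smul_smul₀ hc] at h2
    have h3 : E (c • v) = ‖c‖ₑ * E v := by
      refine le_antisymm h1 ?_
      calc ‖c‖ₑ * E v ≤ ‖c‖ₑ * (‖c⁻¹‖ₑ * E (c • v)) := by gcongr
        _ = E (c • v) := by
          rw [← mul_assoc, ← enorm_mul, mul_inv_cancel₀ hc]; simp
    rw [h3, ENNReal.toReal_mul]
    simp
  norm_triangle u v := by
    rw [hE, hE, hE, ← ENNReal.toReal_add (fin u) (fin v)]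
    exact ENNReal.toReal_mono (ENNReal.add_ne_top.2 ⟨fin u, fin v⟩) (add u v)

end Norms

section Spaces

variable [OpensMeasurableSpace X] (p : ℝ≥0) [hp : Fact (1 ≤ p)] (μ : Measure X)

/-! #### The `TC`-Newtonian space -/

/-- The functions `f : X → ℝ` in `L^p(μ)` which have a `p`-weak upper S-gradient in `L^p(μ)`. -/
def newtonianSubmodule : Submodule ℝ (X → ℝ) where
  carrier := {f | Measurable f ∧ eLpNorm f p μ < ∞ ∧
    ∃ g, IsWeakUpperSGradient p μ f g ∧ eLpNorm g p μ < ∞}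
  zero_mem' := ⟨measurable_const, by simp, 0, IsWeakUpperSGradient.zero hp.out, by simp⟩
  add_mem' := by
    rintro f f' ⟨hf, hfp, g, hg, hgp⟩ ⟨hf', hfp', g', hg', hgp'⟩
    refine ⟨hf.add hf', ?_, g + g', hg.add hg', ?_⟩
    · exact ((MemLp.add ⟨hf.aestronglyMeasurable, hfp⟩ ⟨hf'.aestronglyMeasurable, hfp'⟩ :
        MemLp (f + f') p μ)).2
    · exact (eLpNorm_grad_add_le hp.out (measurable_of_borel hg.1)
        (measurable_of_borel hg'.1)).trans_lt (ENNReal.add_lt_top.2 ⟨hgp, hgp'⟩)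
  smul_mem' := by
    rintro c f ⟨hf, hfp, g, hg, hgp⟩
    exact ⟨hf.const_smul c, ((MemLp.const_smul ⟨hf.aestronglyMeasurable, hfp⟩ c) :
      MemLp (c • f) p μ).2, _, hg.smul c,
      (eLpNorm_grad_smul_le c g).trans_lt (ENNReal.mul_lt_top enorm_lt_top hgp)⟩

/-- The space `newtonianSubmodule`, with the seminorm
`‖f‖ = ‖f‖_{L^p} + inf {‖g‖_{L^p} | g a p-weak upper S-gradient of f}`. -/
def PreNewtonian : Type _ := newtonianSubmodule p μ

namespace PreNewtonian

instance : AddCommGroup (PreNewtonian p μ) := inferInstanceAs (AddCommGroup (newtonianSubmodule p μ))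

instance : Module ℝ (PreNewtonian p μ) := inferInstanceAs (Module ℝ (newtonianSubmodule p μ))

variable {p μ}

/-- The underlying function. -/
def fn (f : PreNewtonian p μ) : X → ℝ := f.1

instance : Norm (PreNewtonian p μ) where
  norm f := (eLpNorm f.fn p μ + gradNorm p μ (IsWeakUpperSGradient p μ f.fn)).toReal

theorem core : SeminormedSpace.Core ℝ (PreNewtonian p μ) := by
  refine seminormCore
    (fun f => eLpNorm f.fn p μ + gradNorm p μ (IsWeakUpperSGradient p μ f.fn))
    (fun _ => rfl) (fun f => ENNReal.add_ne_top.2 ⟨f.2.2.1.ne, gradNorm_ne_top f.2.2.2⟩)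
    ?_ (fun f f' => ?_) fun c f hc => ?_
  · change eLpNorm (0 : X → ℝ) p μ + gradNorm p μ (IsWeakUpperSGradient p μ 0) = 0
    rw [gradNorm_zero (IsWeakUpperSGradient.zero hp.out)]; simp
  · change eLpNorm (f.fn + f'.fn) p μ + gradNorm p μ (IsWeakUpperSGradient p μ (f.fn + f'.fn)) ≤ _
    rw [add_add_add_comm]
    exact add_le_add (eLpNorm_add_le f.2.1.aestronglyMeasurable f'.2.1.aestronglyMeasurable
      (by exact_mod_cast hp.out)) (gradNorm_add_le hp.out (fun g hg => measurable_of_borel hg.1)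
      (fun g hg => measurable_of_borel hg.1) fun g g' hg hg' => hg.add hg')
  · change eLpNorm (c • f.fn) p μ + gradNorm p μ (IsWeakUpperSGradient p μ (c • f.fn)) ≤ _
    rw [mul_add]
    exact add_le_add eLpNorm_const_smul_le (gradNorm_smul_le hc fun g hg => hg.smul c)

instance : SeminormedAddCommGroup (PreNewtonian p μ) := SeminormedAddCommGroup.ofCore core

instance : NormedSpace ℝ (PreNewtonian p μ) where
  norm_smul_le c f := (core.norm_smul c f).le

end PreNewtonian

/-- The `TC`-Newtonian space `N^{1,p}_{TC}`: the quotient of `PreNewtonian p μ` by the relation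
`‖f - f'‖ = 0`. -/
abbrev Newtonian : Type _ := SeparationQuotient (PreNewtonian p μ)

/-! #### The hat-`TC`-Newtonian space -/

/-- The Borel functions `f : X → ℝ` in `L^p(μ)` which have a generalized `p`-weak upper S-gradient
in `L^p(μ)`. -/
def hatNewtonianSubmodule : Submodule ℝ (X → ℝ) where
  carrier := {f | Measurable[borel X] f ∧ eLpNorm f p μ < ∞ ∧
    ∃ g, IsGeneralizedWeakUpperSGradient p μ f g ∧ eLpNorm g p μ < ∞}
  zero_mem' := ⟨@measurable_const _ _ _ (borel X) _, by simp, 0,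
    IsGeneralizedWeakUpperSGradient.zero hp.out, by simp⟩
  add_mem' := by
    rintro f f' ⟨hf, hfp, g, hg, hgp⟩ ⟨hf', hfp', g', hg', hgp'⟩
    refine ⟨borel_add_real hf hf', ?_, g + g', hg.add hf hg', ?_⟩
    · exact ((MemLp.add ⟨(measurable_of_borel hf).aestronglyMeasurable, hfp⟩
        ⟨(measurable_of_borel hf').aestronglyMeasurable, hfp'⟩ : MemLp (f + f') p μ)).2
    · exact (eLpNorm_grad_add_le hp.out (measurable_of_borel hg.1)
        (measurable_of_borel hg'.1)).trans_lt (ENNReal.add_lt_top.2 ⟨hgp, hgp'⟩)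
  smul_mem' := by
    rintro c f ⟨hf, hfp, g, hg, hgp⟩
    refine ⟨?_, ((MemLp.const_smul ⟨(measurable_of_borel hf).aestronglyMeasurable, hfp⟩ c) :
      MemLp (c • f) p μ).2, _, hg.smul c,
      (eLpNorm_grad_smul_le c g).trans_lt (ENNReal.mul_lt_top enorm_lt_top hgp)⟩
    let _ : MeasurableSpace X := borel X
    exact Measurable.const_smul hf c

/-- The space `hatNewtonianSubmodule`, with the seminorm
`‖f‖ = ‖f‖_{L^p} + inf {‖g‖_{L^p} | g a generalized p-weak upper S-gradient of f}`. -/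
def PreHatNewtonian : Type _ := hatNewtonianSubmodule p μ

namespace PreHatNewtonian

instance : AddCommGroup (PreHatNewtonian p μ) :=
  inferInstanceAs (AddCommGroup (hatNewtonianSubmodule p μ))

instance : Module ℝ (PreHatNewtonian p μ) := inferInstanceAs (Module ℝ (hatNewtonianSubmodule p μ))

variable {p μ}

/-- The underlying function. -/
def fn (f : PreHatNewtonian p μ) : X → ℝ := f.1

instance : Norm (PreHatNewtonian p μ) where
  norm f := (eLpNorm f.fn p μ + gradNorm p μ (IsGeneralizedWeakUpperSGradient p μ f.fn)).toReal

theorem core : SeminormedSpace.Core ℝ (PreHatNewtonian p μ) := by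
  refine seminormCore
    (fun f => eLpNorm f.fn p μ + gradNorm p μ (IsGeneralizedWeakUpperSGradient p μ f.fn))
    (fun _ => rfl) (fun f => ENNReal.add_ne_top.2 ⟨f.2.2.1.ne, gradNorm_ne_top f.2.2.2⟩)
    ?_ (fun f f' => ?_) fun c f hc => ?_
  · change eLpNorm (0 : X → ℝ) p μ + gradNorm p μ (IsGeneralizedWeakUpperSGradient p μ 0) = 0
    rw [gradNorm_zero (IsGeneralizedWeakUpperSGradient.zero hp.out)]; simp
  · change eLpNorm (f.fn + f'.fn) p μ +
      gradNorm p μ (IsGeneralizedWeakUpperSGradient p μ (f.fn + f'.fn)) ≤ _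
    rw [add_add_add_comm]
    exact add_le_add (eLpNorm_add_le (measurable_of_borel f.2.1).aestronglyMeasurable
      (measurable_of_borel f'.2.1).aestronglyMeasurable (by exact_mod_cast hp.out))
      (gradNorm_add_le hp.out (fun g hg => measurable_of_borel hg.1)
      (fun g hg => measurable_of_borel hg.1) fun g g' hg hg' => hg.add f.2.1 hg')
  · change eLpNorm (c • f.fn) p μ +
      gradNorm p μ (IsGeneralizedWeakUpperSGradient p μ (c • f.fn)) ≤ _
    rw [mul_add]
    exact add_le_add eLpNorm_const_smul_le (gradNorm_smul_le hc fun g hg => hg.smul c)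

instance : SeminormedAddCommGroup (PreHatNewtonian p μ) := SeminormedAddCommGroup.ofCore core

instance : NormedSpace ℝ (PreHatNewtonian p μ) where
  norm_smul_le c f := (core.norm_smul c f).le

end PreHatNewtonian

/-- The hat-`TC`-Newtonian space: the quotient of `PreHatNewtonian p μ` by the relation
`‖f - f'‖ = 0`. -/
abbrev HatNewtonian : Type _ := SeparationQuotient (PreHatNewtonian p μ)

/-! #### The Gigli-like space -/

/-- The Borel functions `f : X → ℝ` in `L^p(μ)` which have a `μ`-upper S-gradient in `L^p(μ)`. -/
def gigliSubmodule : Submodule ℝ (X → ℝ) where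
  carrier := {f | Measurable[borel X] f ∧ eLpNorm f p μ < ∞ ∧
    ∃ g, IsMeasureUpperSGradient μ f g ∧ eLpNorm g p μ < ∞}
  zero_mem' := ⟨@measurable_const _ _ _ (borel X) _, by simp, 0,
    IsMeasureUpperSGradient.zero, by simp⟩
  add_mem' := by
    rintro f f' ⟨hf, hfp, g, hg, hgp⟩ ⟨hf', hfp', g', hg', hgp'⟩
    refine ⟨borel_add_real hf hf', ?_, g + g', hg.add hf hg', ?_⟩
    · exact ((MemLp.add ⟨(measurable_of_borel hf).aestronglyMeasurable, hfp⟩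
        ⟨(measurable_of_borel hf').aestronglyMeasurable, hfp'⟩ : MemLp (f + f') p μ)).2
    · exact (eLpNorm_grad_add_le hp.out (measurable_of_borel hg.1)
        (measurable_of_borel hg'.1)).trans_lt (ENNReal.add_lt_top.2 ⟨hgp, hgp'⟩)
  smul_mem' := by
    rintro c f ⟨hf, hfp, g, hg, hgp⟩
    refine ⟨?_, ((MemLp.const_smul ⟨(measurable_of_borel hf).aestronglyMeasurable, hfp⟩ c) :
      MemLp (c • f) p μ).2, _, hg.smul c,
      (eLpNorm_grad_smul_le c g).trans_lt (ENNReal.mul_lt_top enorm_lt_top hgp)⟩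
    let _ : MeasurableSpace X := borel X
    exact Measurable.const_smul hf c

/-- The space `gigliSubmodule`, with the seminorm
`‖f‖ = ‖f‖_{L^p} + inf {‖g‖_{L^p} | g a μ-upper S-gradient of f}`. -/
def PreGigli : Type _ := gigliSubmodule p μ

namespace PreGigli

instance : AddCommGroup (PreGigli p μ) := inferInstanceAs (AddCommGroup (gigliSubmodule p μ))

instance : Module ℝ (PreGigli p μ) := inferInstanceAs (Module ℝ (gigliSubmodule p μ))

variable {p μ}

/-- The underlying function. -/
def fn (f : PreGigli p μ) : X → ℝ := f.1

instance : Norm (PreGigli p μ) where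
  norm f := (eLpNorm f.fn p μ + gradNorm p μ (IsMeasureUpperSGradient μ f.fn)).toReal

theorem core : SeminormedSpace.Core ℝ (PreGigli p μ) := by
  refine seminormCore
    (fun f => eLpNorm f.fn p μ + gradNorm p μ (IsMeasureUpperSGradient μ f.fn))
    (fun _ => rfl) (fun f => ENNReal.add_ne_top.2 ⟨f.2.2.1.ne, gradNorm_ne_top f.2.2.2⟩)
    ?_ (fun f f' => ?_) fun c f hc => ?_
  · change eLpNorm (0 : X → ℝ) p μ + gradNorm p μ (IsMeasureUpperSGradient μ 0) = 0
    rw [gradNorm_zero IsMeasureUpperSGradient.zero]; simp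
  · change eLpNorm (f.fn + f'.fn) p μ +
      gradNorm p μ (IsMeasureUpperSGradient μ (f.fn + f'.fn)) ≤ _
    rw [add_add_add_comm]
    exact add_le_add (eLpNorm_add_le (measurable_of_borel f.2.1).aestronglyMeasurable
      (measurable_of_borel f'.2.1).aestronglyMeasurable (by exact_mod_cast hp.out))
      (gradNorm_add_le hp.out (fun g hg => measurable_of_borel hg.1)
      (fun g hg => measurable_of_borel hg.1) fun g g' hg hg' => hg.add f.2.1 hg')
  · change eLpNorm (c • f.fn) p μ + gradNorm p μ (IsMeasureUpperSGradient μ (c • f.fn)) ≤ _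
    rw [mul_add]
    exact add_le_add eLpNorm_const_smul_le (gradNorm_smul_le hc fun g hg => hg.smul c)

instance : SeminormedAddCommGroup (PreGigli p μ) := SeminormedAddCommGroup.ofCore core

instance : NormedSpace ℝ (PreGigli p μ) where
  norm_smul_le c f := (core.norm_smul c f).le

end PreGigli

/-- The Gigli-like space `G^{1,p}`: the quotient of `PreGigli p μ` by the relation
`‖f - f'‖ = 0`. -/
abbrev Gigli : Type _ := SeparationQuotient (PreGigli p μ)

/-! #### The Hajłasz--Sobolev space -/

/-- The elements of `L^p(μ)` which have a Hajłasz gradient in `L^p(μ)`. -/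
def hajlaszSubmodule : Submodule ℝ (Lp ℝ p μ) where
  carrier := {f | ∃ g, IsHajlaszGradient μ f g ∧ eLpNorm g p μ < ∞}
  zero_mem' := ⟨0, IsHajlaszGradient.zero.congr (Lp.coeFn_zero _ _ _).symm, by simp⟩
  add_mem' := by
    rintro f f' ⟨g, hg, hgp⟩ ⟨g', hg', hgp'⟩
    exact ⟨g + g', (hg.add hg').congr (Lp.coeFn_add _ _).symm,
      (eLpNorm_grad_add_le hp.out hg.1 hg'.1).trans_lt (ENNReal.add_lt_top.2 ⟨hgp, hgp'⟩)⟩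
  smul_mem' := by
    rintro c f ⟨g, hg, hgp⟩
    exact ⟨_, (hg.smul c).congr (Lp.coeFn_smul _ _).symm,
      (eLpNorm_grad_smul_le c g).trans_lt (ENNReal.mul_lt_top enorm_lt_top hgp)⟩

/-- The Hajłasz--Sobolev space `M^{1,p}`, with the norm
`‖f‖ = ‖f‖_{L^p} + inf {‖g‖_{L^p} | g a Hajłasz gradient of f}`. -/
def HajlaszSobolev : Type _ := hajlaszSubmodule p μ

namespace HajlaszSobolev

instance : AddCommGroup (HajlaszSobolev p μ) := inferInstanceAs (AddCommGroup (hajlaszSubmodule p μ))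

instance : Module ℝ (HajlaszSobolev p μ) := inferInstanceAs (Module ℝ (hajlaszSubmodule p μ))

variable {p μ}

/-- The underlying element of `L^p(μ)`. -/
def toLp (f : HajlaszSobolev p μ) : Lp ℝ p μ := f.1

instance : Norm (HajlaszSobolev p μ) where
  norm f := (eLpNorm f.toLp p μ + gradNorm p μ (IsHajlaszGradient μ f.toLp)).toReal

theorem enorm_ne_top' (f : HajlaszSobolev p μ) :
    eLpNorm f.toLp p μ + gradNorm p μ (IsHajlaszGradient μ f.toLp) ≠ ∞ :=
  ENNReal.add_ne_top.2 ⟨Lp.eLpNorm_ne_top f.toLp, gradNorm_ne_top f.2⟩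

theorem core : NormedSpace.Core ℝ (HajlaszSobolev p μ) := by
  have hc : SeminormedSpace.Core ℝ (HajlaszSobolev p μ) := by
    refine seminormCore
      (fun f => eLpNorm f.toLp p μ + gradNorm p μ (IsHajlaszGradient μ f.toLp))
      (fun _ => rfl) enorm_ne_top' ?_ (fun f f' => ?_) fun c f hc => ?_
    · change eLpNorm (0 : Lp ℝ p μ) p μ + gradNorm p μ (IsHajlaszGradient μ (0 : Lp ℝ p μ)) = 0
      rw [gradNorm_zero (IsHajlaszGradient.zero.congr (Lp.coeFn_zero _ _ _).symm),
        eLpNorm_congr_ae (Lp.coeFn_zero _ _ _)]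
      simp
    · change eLpNorm (f.toLp + f'.toLp : Lp ℝ p μ) p μ +
        gradNorm p μ (IsHajlaszGradient μ (f.toLp + f'.toLp : Lp ℝ p μ)) ≤ _
      rw [add_add_add_comm, eLpNorm_congr_ae (Lp.coeFn_add _ _)]
      exact add_le_add (eLpNorm_add_le (Lp.aestronglyMeasurable _) (Lp.aestronglyMeasurable _)
        (by exact_mod_cast hp.out)) (gradNorm_add_le hp.out (fun g hg => hg.1)
        (fun g hg => hg.1) fun g g' hg hg' => (hg.add hg').congr (Lp.coeFn_add _ _).symm)
    · change eLpNorm (c • f.toLp : Lp ℝ p μ) p μ +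
        gradNorm p μ (IsHajlaszGradient μ (c • f.toLp : Lp ℝ p μ)) ≤ _
      rw [mul_add, eLpNorm_congr_ae (Lp.coeFn_smul _ _)]
      exact add_le_add eLpNorm_const_smul_le
        (gradNorm_smul_le hc fun g hg => (hg.smul c).congr (Lp.coeFn_smul _ _).symm)
  refine { hc with norm_eq_zero_iff := fun f => ⟨fun h => ?_, fun h => ?_⟩ }
  · have h0 : eLpNorm f.toLp p μ + gradNorm p μ (IsHajlaszGradient μ f.toLp) = 0 := by
      have h' : (eLpNorm f.toLp p μ + gradNorm p μ (IsHajlaszGradient μ f.toLp)).toReal = 0 := h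
      exact ((ENNReal.toReal_eq_zero_iff _).1 h').resolve_right f.enorm_ne_top'
    have h1 : eLpNorm f.toLp p μ = 0 := (add_eq_zero.1 h0).1
    have hp0 : (p : ℝ≥0∞) ≠ 0 := by
      have : (0 : ℝ≥0) < p := lt_of_lt_of_le one_pos hp.out
      exact_mod_cast this.ne'
    have h2 := (eLpNorm_eq_zero_iff (Lp.aestronglyMeasurable f.toLp) hp0).1 h1
    exact Subtype.ext ((Lp.eq_zero_iff_ae_eq_zero).2 h2)
  · rw [h]
    simpa using hc.norm_smul 0 (0 : HajlaszSobolev p μ)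

instance : NormedAddCommGroup (HajlaszSobolev p μ) := NormedAddCommGroup.ofCore core

instance : NormedSpace ℝ (HajlaszSobolev p μ) := NormedSpace.ofCore core

end HajlaszSobolev

/-! ### The canonical maps between the spaces -/

variable {p μ}

/-- The class in the `TC`-Newtonian space of a function. -/
def Newtonian.mk (f : PreNewtonian p μ) : Newtonian p μ := SeparationQuotient.mk f

/-- The class in the hat-`TC`-Newtonian space of a function. -/
def HatNewtonian.mk (f : PreHatNewtonian p μ) : HatNewtonian p μ := SeparationQuotient.mk f

/-- The class in the Gigli-like space of a function. -/
def Gigli.mk (f : PreGigli p μ) : Gigli p μ := SeparationQuotient.mk f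

/-- `T` sends the class of every function `f` to the class of the same function `f`. -/
def IsCanonicalHatN (T : HatNewtonian p μ → Newtonian p μ) : Prop :=
  ∀ f : PreHatNewtonian p μ, ∃ f' : PreNewtonian p μ,
    f'.fn = f.fn ∧ T (HatNewtonian.mk f) = Newtonian.mk f'

/-- `T` sends the class of every function `f` to the `μ`-a.e. equality class of `f`. -/
def IsCanonicalNM (T : Newtonian p μ → HajlaszSobolev p μ) : Prop :=
  ∀ f : PreNewtonian p μ, (T (Newtonian.mk f)).toLp =ᵐ[μ] f.fn

/-- `T` sends every `μ`-a.e. equality class `u` to the class of a function `f` belonging to `u`;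
here `f` may be any such function in the Gigli-like pre-space. -/
def IsCanonicalMG (T : HajlaszSobolev p μ → Gigli p μ) : Prop :=
  ∀ (u : HajlaszSobolev p μ) (f : PreGigli p μ), T u = Gigli.mk f ↔ u.toLp =ᵐ[μ] f.fn

end Spaces

/-! ### Conditions on the measure -/

/-- `μ` is Borel regular: every set is contained in a Borel set of the same (outer) measure. -/
def IsBorelRegular (μ : Measure X) : Prop :=
  ∀ A : Set X, ∃ B : Set X, MeasurableSet[borel X] B ∧ A ⊆ B ∧ μ B = μ A

/-- `μ` is doubling: balls have positive and finite measure, and the measure of a ball of doubled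
radius is bounded by a constant multiple of the measure of the ball. -/
def IsDoubling (μ : Measure X) : Prop :=
  ∃ C : ℝ≥0, ∀ (x : X) (r : ℝ), 0 < r → 0 < μ (Metric.ball x r) ∧ μ (Metric.ball x r) < ∞ ∧
    μ (Metric.ball x (2 * r)) ≤ C * μ (Metric.ball x r)

end TCSobolev

end

open TCSobolev

noncomputable section

set_option linter.unusedSectionVars false

namespace TCSobolev

/-! ### Variation measures, reversal and one-sided limits of test curves -/

section Curves

namespace TestCurve

section Variation

variable {X : Type*} [MetricSpace X] (γ : TestCurve X)

/-! Two constructions link curves with the Hajłasz inequality. A curve that jumps once from `x` to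
`y` has symmetrized integral `(g x + g y) d(x,y) / 2` (`symIntegral_jump`), so an upper gradient
inequality tested on such curves is a Hajłasz inequality. Conversely, a Borel function with a Borel
Hajłasz gradient `g` valid at all pairs can be changed on `{g = ∞}` so that `8 g` is an upper
gradient along every nontrivial test curve (`exists_borel_forall_enorm_sub_le`).

For the converse, let `f` first be Lipschitz. Parametrize `f ∘ γ` by the variation of `γ` and fill
the jumps linearly. The resulting Lipschitz function on an interval has increments at most `(H u + H
v)(v - u)`, where `H` is the sum of `g` over the two one-sided limits of `γ`. Comparing its averages
over short intervals at both ends bounds the total increment by `2 ∫ H`, which is four times the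
symmetrized integral. For general `f`, extend the restrictions to `{g ≤ k}` to Lipschitz functions,
which have Hajłasz gradient `2 g`. Along a curve with finite integral these extensions converge at
both endpoints, because such a curve has tails of arbitrarily small integral that start at points
where `g` is finite.

Exceptional families cost nothing. A family of modulus zero carries an `L^p` function `ρ` with
infinite integral along each member, and adding `ε ρ` to a weak gradient makes it valid on all
nontrivial curves. Hence weak, generalized weak and everywhere valid gradients define the same
infimum, with Dirac measures giving the passage from generalized weak to weak. The same tail
argument shows that a Newtonian function vanishing off a Borel null set has seminorm zero. Such a
set exists for Borel functions, and for all functions if `μ` is Borel regular; σ-finiteness together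
with Borel regularity gives Borel representatives, and so surjectivity.

Classes in `G^{1,p}` are a.e. classes, because admissible measures have endpoint distributions
dominated by `μ`. In the doubling case, if the Hajłasz inequality failed on a set of pairs of
positive product measure, normalizing a bounded part of this set and pushing it forward by jumps
would give an admissible measure violating the upper gradient inequality. An intermediate point then
upgrades almost all pairs to all pairs off a null set. -/

theorem leftLim_zero {α : Type*} [TopologicalSpace α] [T2Space α] (f : I → α) :
    Function.leftLim f 0 = f 0 :=
  leftLim_eq_of_isBot fun _ => unitInterval.nonneg'

theorem neBot_nhdsLT {t : I} (ht : 0 < t) : (𝓝[<] t).NeBot :=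
  nhdsLT_neBot_of_exists_lt ⟨0, ht⟩

theorem leftLim_one : Function.leftLim γ 1 = γ 1 := by
  have := neBot_nhdsLT (zero_lt_one (α := I))
  exact tendsto_nhds_unique (γ.tendsto_leftLim 1)
    (γ.left_cont_one.mono_left (nhdsWithin_mono _ Iio_subset_Iic_self))

theorem reverse_apply (t : I) : γ.reverse t = Function.leftLim γ (σ t) := rfl

theorem reverse_zero : γ.reverse 0 = γ 1 := by
  rw [reverse_apply, unitInterval.symm_zero, leftLim_one]

theorem reverse_one : γ.reverse 1 = γ 0 := by
  rw [reverse_apply, unitInterval.symm_one, leftLim_zero]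

/-- Reversal exchanges the two one-sided limits, so the left limits of the reversed curve are the
right limits, that is the values, of `γ`. At the endpoint the convention that the left limit at `0`
is the value at `0` is what makes this consistent. -/
theorem leftLim_reverse_symm (t : I) : Function.leftLim γ.reverse (σ t) = γ t := by
  rcases eq_or_lt_of_le (unitInterval.le_one' (t := t)) with rfl | ht
  · rw [unitInterval.symm_one, leftLim_zero, reverse_zero]
  have h0 : 0 < σ t := by simpa using unitInterval.symm_lt_symm.2 ht
  have := neBot_nhdsLT h0
  refine tendsto_nhds_unique (γ.reverse.tendsto_leftLim (σ t)) ?_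
  refine (γ.tendsto_leftLim_right t).comp ?_
  refine tendsto_nhdsWithin_of_tendsto_nhds_of_eventually_within _ ?_ ?_
  · have := unitInterval.continuous_symm.tendsto (σ t)
    rw [unitInterval.symm_symm] at this
    exact this.mono_left nhdsWithin_le_nhds
  · filter_upwards [self_mem_nhdsWithin] with s hs
    have := unitInterval.symm_lt_symm.2 hs
    rwa [unitInterval.symm_symm] at this

theorem reverse_reverse_apply (t : I) : γ.reverse.reverse t = γ t := by
  rw [reverse_apply, leftLim_reverse_symm]

theorem ext' {γ γ' : TestCurve X} (h : ∀ t, γ t = γ' t) : γ = γ' := by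
  cases γ; cases γ'
  simp only [mk.injEq]
  exact funext h

theorem reverse_reverse : γ.reverse.reverse = γ := ext' γ.reverse_reverse_apply

theorem variationFunction_apply (t : I) :
    γ.variationFunction t = (eVariationOn γ (Icc 0 t)).toReal := rfl

theorem variationFunction_zero : γ.variationFunction 0 = 0 := by
  rw [variationFunction_apply]; simp

theorem eVariationOn_Icc_eq {s t : I} (hst : s ≤ t) :
    eVariationOn γ (Icc s t) = ENNReal.ofReal (γ.variationFunction t - γ.variationFunction s) := by
  have h := eVariationOn.Icc_add_Icc γ (s := univ) (unitInterval.nonneg' (t := s)) hst (mem_univ s)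
  simp only [univ_inter] at h
  have hf : ∀ a b : I, eVariationOn γ (Icc a b) ≠ ∞ := fun a b =>
    γ.boundedVariation.mono (subset_univ _)
  rw [variationFunction_apply, variationFunction_apply, ← h,
    ENNReal.toReal_add (hf _ _) (hf _ _), add_sub_cancel_left, ENNReal.ofReal_toReal (hf _ _)]

theorem stieltjesMeasure_Ioc {s t : I} (hst : s ≤ t) :
    γ.stieltjesMeasure (Ioc s t) = eVariationOn γ (Icc s t) := by
  rw [eVariationOn_Icc_eq γ hst]; exact StieltjesFunction.measure_Ioc _ _ _

theorem stieltjesMeasure_singleton_zero : γ.stieltjesMeasure {0} = 0 := by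
  refine (StieltjesFunction.measure_singleton _ _).trans ?_
  rw [leftLim_zero]; simp

theorem measure_Iic_eq_Ioc {m : Measure I} (h0 : m {0} = 0) (t : I) : m (Iic t) = m (Ioc 0 t) := by
  refine le_antisymm ?_ (measure_mono fun s hs => hs.2)
  refine (measure_mono (t := {0} ∪ Ioc 0 t) fun s hs => ?_).trans
    ((measure_union_le _ _).trans (by rw [h0, zero_add]))
  rcases eq_or_lt_of_le (unitInterval.nonneg' (t := s)) with h | h
  · exact Or.inl h.symm
  · exact Or.inr ⟨h, hs⟩

theorem Ioi_eq_Ioc_one (t : I) : Ioi t = Ioc t 1 := by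
  ext s; exact ⟨fun h => ⟨h, unitInterval.le_one'⟩, fun h => h.1⟩

theorem stieltjesMeasure_Iic (t : I) :
    γ.stieltjesMeasure (Iic t) = ENNReal.ofReal (γ.variationFunction t) := by
  rw [measure_Iic_eq_Ioc γ.stieltjesMeasure_singleton_zero,
    stieltjesMeasure_Ioc γ unitInterval.nonneg', eVariationOn_Icc_eq γ unitInterval.nonneg',
    variationFunction_zero, sub_zero]

theorem stieltjesMeasure_univ : γ.stieltjesMeasure univ = γ.variation := by
  have h : (univ : Set I) = Iic 1 := by ext s; simp [unitInterval.le_one']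
  have h' : (univ : Set I) = Icc 0 1 := by
    ext s; simp [unitInterval.le_one']
  rw [variation, h, measure_Iic_eq_Ioc γ.stieltjesMeasure_singleton_zero,
    stieltjesMeasure_Ioc γ unitInterval.nonneg', ← h, h']

theorem variation_ne_top : γ.variation ≠ ∞ := γ.boundedVariation

instance : IsFiniteMeasure γ.stieltjesMeasure :=
  ⟨by rw [stieltjesMeasure_univ]; exact γ.variation_ne_top.lt_top⟩

theorem edist_le_variation (s t : I) : edist (γ s) (γ t) ≤ γ.variation :=
  eVariationOn.edist_le _ (mem_univ _) (mem_univ _)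

theorem variation_pos_of_ne {s t : I} (h : γ s ≠ γ t) : 0 < γ.variation :=
  (edist_pos.2 h).trans_le (γ.edist_le_variation s t)

/-- A finite measure without mass at `0` which bounds the increments of `γ` and has at most the
total mass of `μ_γ`, is equal to `μ_γ`. -/
theorem stieltjesMeasure_eq_of_edist_le {m : Measure I} [IsFiniteMeasure m]
    (h : ∀ a b, a ≤ b → edist (γ a) (γ b) ≤ m (Ioc a b)) (h0 : m {0} = 0)
    (hV : m univ ≤ γ.variation) : γ.stieltjesMeasure = m := by
  set F : I → ℝ := fun t => (m (Iic t)).toReal with hF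
  have hm : ∀ a b, a ≤ b → m (Ioc a b) = ENNReal.ofReal (F b - F a) := by
    intro a b hab
    rw [← Iic_sdiff_Iic, measure_sdiff (Iic_subset_Iic.2 hab) nullMeasurableSet_Iic
      (measure_ne_top _ _), hF, ENNReal.ofReal_sub _ ENNReal.toReal_nonneg,
      ENNReal.ofReal_toReal (measure_ne_top _ _), ENNReal.ofReal_toReal (measure_ne_top _ _)]
  have hmono : Monotone F := fun a b hab =>
    ENNReal.toReal_mono (measure_ne_top _ _) (measure_mono (Iic_subset_Iic.2 hab))
  have hed : ∀ a b, edist (γ a) (γ b) ≤ edist (F a) (F b) := by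
    intro a b
    wlog hab : a ≤ b generalizing a b
    · rw [edist_comm, edist_comm (F a)]; exact this b a (le_of_not_ge hab)
    refine (h a b hab).trans ?_
    rw [hm a b hab, edist_comm, edist_dist, Real.dist_eq]
    exact ENNReal.ofReal_le_ofReal (le_abs_self _)
  have key : ∀ a b, a ≤ b → γ.stieltjesMeasure (Ioc a b) ≤ m (Ioc a b) := by
    intro a b hab
    rw [stieltjesMeasure_Ioc γ hab, hm a b hab]
    have h1 : eVariationOn γ (Icc a b) ≤ eVariationOn F (Icc a b) :=
      iSup_mono fun p => Finset.sum_le_sum fun i _ => hed _ _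
    refine h1.trans ?_
    have h2 := (MonotoneOn.eVariationOn_eq (hmono.monotoneOn univ) (mem_univ a) (mem_univ b)).le
    simpa using h2
  -- `μ_γ ≤ m` holds on `Iic t` and on its complement, while the total mass of `m` is not larger.
  -- Finiteness then forces equality on both pieces.
  refine Measure.ext_of_Iic _ _ fun t => ?_
  have hc : ∀ n : Measure I, n univ = n (Iic t) + n (Ioi t) := fun n => by
    rw [← compl_Iic, measure_add_measure_compl measurableSet_Iic]
  have h1 : γ.stieltjesMeasure (Iic t) ≤ m (Iic t) := by
    rw [measure_Iic_eq_Ioc γ.stieltjesMeasure_singleton_zero, measure_Iic_eq_Ioc h0]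
    exact key _ _ unitInterval.nonneg'
  have h2 : γ.stieltjesMeasure (Ioi t) ≤ m (Ioi t) := by
    rw [Ioi_eq_Ioc_one]; exact key _ _ unitInterval.le_one'
  rw [← stieltjesMeasure_univ, hc m, hc γ.stieltjesMeasure] at hV
  refine le_antisymm h1 ?_
  have h3 := hV.trans (add_le_add_right h2 _)
  exact (ENNReal.add_le_add_iff_right (measure_ne_top m _)).1 h3

theorem dist_le {s t : I} (hst : s ≤ t) :
    dist (γ s) (γ t) ≤ γ.variationFunction t - γ.variationFunction s := by
  have h : edist (γ s) (γ t) ≤ eVariationOn γ (Icc s t) :=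
    eVariationOn.edist_le _ (left_mem_Icc.2 hst) (right_mem_Icc.2 hst)
  rw [eVariationOn_Icc_eq γ hst, edist_dist] at h
  exact (ENNReal.ofReal_le_ofReal_iff (sub_nonneg.2 (γ.variationFunction.mono hst))).1 h

theorem dist_leftLim_le {s t : I} (hst : s < t) :
    dist (γ s) (Function.leftLim γ t) ≤
      Function.leftLim γ.variationFunction t - γ.variationFunction s := by
  have : (𝓝[<] t).NeBot := nhdsLT_neBot_of_exists_lt ⟨s, hst⟩
  refine le_of_tendsto_of_tendsto (tendsto_const_nhds.dist (γ.tendsto_leftLim t))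
    ((γ.variationFunction.mono.tendsto_leftLim t).sub_const _) ?_
  filter_upwards [Ioo_mem_nhdsLT hst] with r hr using γ.dist_le hr.1.le

theorem dist_leftLim_self_le (t : I) :
    dist (Function.leftLim γ t) (γ t) ≤
      γ.variationFunction t - Function.leftLim γ.variationFunction t := by
  rcases eq_or_lt_of_le (unitInterval.nonneg' (t := t)) with rfl | ht
  · rw [leftLim_zero, leftLim_zero]; simp
  have := neBot_nhdsLT ht
  refine le_of_tendsto_of_tendsto ((γ.tendsto_leftLim t).dist tendsto_const_nhds)
    (tendsto_const_nhds.sub (γ.variationFunction.mono.tendsto_leftLim t)) ?_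
  filter_upwards [self_mem_nhdsWithin] with r hr using γ.dist_le (le_of_lt hr)

theorem dist_leftLim_leftLim_le {s t : I} (hst : s ≤ t) :
    dist (Function.leftLim γ s) (Function.leftLim γ t) ≤
      Function.leftLim γ.variationFunction t - Function.leftLim γ.variationFunction s := by
  rcases eq_or_lt_of_le hst with rfl | hst
  · simp
  rcases eq_or_lt_of_le (unitInterval.nonneg' (t := s)) with rfl | hs
  · rw [leftLim_zero, leftLim_zero]
    exact γ.dist_leftLim_le hst
  have := neBot_nhdsLT hs
  refine le_of_tendsto_of_tendsto ((γ.tendsto_leftLim s).dist tendsto_const_nhds)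
    (tendsto_const_nhds.sub (γ.variationFunction.mono.tendsto_leftLim s)) ?_
  filter_upwards [self_mem_nhdsWithin] with r hr using γ.dist_leftLim_le (lt_trans hr hst)

theorem variation_reverse_le : γ.reverse.variation ≤ γ.variation :=
  (eVariationOn.comp_le_of_antitoneOn (Function.leftLim γ) (s := univ) (t := univ) σ
      (fun _ _ _ _ hab => unitInterval.symm_le_symm.2 hab) (fun _ _ => mem_univ _)).trans
    (eVariationOn.eVariationOn_leftLim_le isOpen_univ)

theorem variation_reverse : γ.reverse.variation = γ.variation :=
  le_antisymm γ.variation_reverse_le <| by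
    conv_lhs => rw [← γ.reverse_reverse]
    exact γ.reverse.variation_reverse_le

/-- Left-continuity at `1` makes the variation over `[y,1]` tend to `0`, so the variation function
has no jump there. Since reversal sends `1` to `0`, this gives the reversed measure its missing atom
at `0`. -/
theorem stieltjesMeasure_singleton_one : γ.stieltjesMeasure {1} = 0 := by
  refine (StieltjesFunction.measure_singleton _ _).trans ?_
  have h1 : Function.leftLim γ.variationFunction 1 = γ.variationFunction 1 := by
    refine le_antisymm (γ.variationFunction.mono.leftLim_le le_rfl) ?_
    have hb : ∀ a b : I, eVariationOn γ (Icc a b) ≠ ∞ := fun a b =>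
      γ.boundedVariation.mono (subset_univ _)
    have := neBot_nhdsLT (zero_lt_one (α := I))
    have h2 := (γ.boundedVariation.tendsto_eVariationOn_Icc_zero_left
      (x := (1 : I)) (by simpa using γ.left_cont_one))
    simp only [univ_inter] at h2
    have h3 : Tendsto (fun y : I => γ.variationFunction y + (eVariationOn γ (Icc y 1)).toReal)
        (𝓝[<] 1) (𝓝 (Function.leftLim γ.variationFunction 1 + 0)) := by
      refine (γ.variationFunction.mono.tendsto_leftLim 1).add ?_
      have := (ENNReal.tendsto_toReal ENNReal.zero_ne_top).comp h2
      exact this.mono_left (nhdsWithin_mono _ (subset_univ _))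
    rw [add_zero] at h3
    refine ge_of_tendsto h3 (Eventually.of_forall fun y => ?_)
    rw [eVariationOn_Icc_eq γ unitInterval.le_one', ENNReal.toReal_ofReal
      (sub_nonneg.2 (γ.variationFunction.mono unitInterval.le_one'))]
    linarith
  simp [h1]

theorem measurable_symm : Measurable (σ : I → I) := unitInterval.continuous_symm.measurable

/-- By the comparison criterion it is enough that the reflected measure bounds the increments of the
reversed curve; the total masses agree because reversal preserves the variation. -/
theorem stieltjesMeasure_reverse :
    γ.reverse.stieltjesMeasure = γ.stieltjesMeasure.map σ := by
  have : IsFiniteMeasure (γ.stieltjesMeasure.map σ) :=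
    Measure.isFiniteMeasure_map γ.stieltjesMeasure σ
  refine stieltjesMeasure_eq_of_edist_le _ (fun a b hab => ?_) ?_ ?_
  · rw [Measure.map_apply measurable_symm measurableSet_Ioc]
    -- Reflection turns left-open intervals into right-open ones. Their mass is a difference of left
    -- limits of `V_γ`, and this bounds the distance between left limits of `γ`.
    have h : σ ⁻¹' Ioc a b = Ico (σ b) (σ a) := by
      ext s
      simp only [mem_preimage, mem_Ioc, mem_Ico]
      have h1 := unitInterval.symm_le_symm (i := s) (j := σ b)
      have h2 := unitInterval.symm_lt_symm (i := σ a) (j := s)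
      rw [unitInterval.symm_symm] at h1 h2
      rw [← h1, h2, and_comm]
    rw [h]
    have h2 : γ.stieltjesMeasure (Ico (σ b) (σ a)) = _ := StieltjesFunction.measure_Ico _ _ _
    rw [h2, edist_comm, edist_dist]
    exact ENNReal.ofReal_le_ofReal (γ.dist_leftLim_leftLim_le (unitInterval.symm_le_symm.2 hab))
  · rw [Measure.map_apply measurable_symm (measurableSet_singleton _)]
    have : σ ⁻¹' {0} = {1} := by ext s; simp
    rw [this, stieltjesMeasure_singleton_one]
  · rw [Measure.map_apply measurable_symm MeasurableSet.univ, preimage_univ,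
      stieltjesMeasure_univ, variation_reverse]

/-- By right-continuity the preimage of an open set is a right neighbourhood of each of its points.
-/
theorem measurable_borel : @Measurable I X _ (borel X) γ := by
  let _ : MeasurableSpace X := borel X
  have _ : BorelSpace X := ⟨rfl⟩
  refine measurable_of_isOpen fun U hU => MeasurableSet.of_mem_nhdsGT fun t ht => ?_
  exact ((γ.right_cont' t).mono_left (nhdsWithin_mono _ Ioi_subset_Ici_self)) (hU.mem_nhds ht)

theorem measurable_leftLim : @Measurable I X _ (borel X) (Function.leftLim γ) := by
  let _ : MeasurableSpace X := borel X
  have h : Function.leftLim γ = γ.reverse ∘ σ := by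
    ext t; rw [Function.comp_apply, reverse_apply, unitInterval.symm_symm]
  rw [h]
  exact Measurable.comp γ.reverse.measurable_borel measurable_symm

/-- The sum of the values of `g` at the two one-sided limits of `γ`. -/
def twoSided (g : X → ℝ≥0∞) (t : I) : ℝ≥0∞ := g (γ t) + g (Function.leftLim γ t)

theorem measurable_twoSided {g : X → ℝ≥0∞} (hg : Measurable[borel X] g) :
    Measurable (γ.twoSided g) := by
  let _ : MeasurableSpace X := borel X
  exact (hg.comp γ.measurable_borel).add (hg.comp γ.measurable_leftLim)

/-- Transporting the reversed integral back by the reflection writes both halves against the single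
measure `μ_γ`, with `g` evaluated at the right and the left limit respectively. -/
theorem symIntegral_eq {g : X → ℝ≥0∞} (hg : Measurable[borel X] g) :
    γ.symIntegral g = (∫⁻ t, γ.twoSided g t ∂γ.stieltjesMeasure) / 2 := by
  have h1 : Measurable fun t => g (γ t) := by
    let _ : MeasurableSpace X := borel X
    exact hg.comp γ.measurable_borel
  have h2 : Measurable fun t => g (γ.reverse t) := by
    let _ : MeasurableSpace X := borel X
    exact hg.comp γ.reverse.measurable_borel
  unfold symIntegral lineIntegral twoSided
  rw [lintegral_add_left h1, stieltjesMeasure_reverse, lintegral_map h2 measurable_symm]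
  simp only [reverse_apply, unitInterval.symm_symm]

theorem symIntegral_reverse (g : X → ℝ≥0∞) : γ.reverse.symIntegral g = γ.symIntegral g := by
  unfold symIntegral
  rw [reverse_reverse, add_comm]

end Variation

/-! ### Stopped curves and curves with a single jump -/

section Examples

variable {X : Type*} [MetricSpace X]

/-- The curve which rests at `γ s` up to the time `s` and then follows `γ`. -/
def stopped (γ : TestCurve X) (s : I) : TestCurve X where
  toFun t := γ (max s t)
  boundedVariation := ne_top_of_le_ne_top γ.boundedVariation
    (eVariationOn.comp_le_of_monotoneOn γ (s := univ) (t := univ) (fun t => max s t)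
      (fun _ _ _ _ hab => max_le_max le_rfl hab) fun _ _ => mem_univ _)
  right_cont t _ := ContinuousWithinAt.comp (t := Ici (max s t)) (γ.right_cont' _)
    (by fun_prop) fun _ hr => max_le_max_left s hr
  left_cont_one := by
    refine ContinuousWithinAt.comp (g := γ) (t := Iic 1) ?_ (by fun_prop)
      fun _ _ => unitInterval.le_one'
    rw [max_eq_right unitInterval.le_one']
    exact γ.left_cont_one
  left_lim t _ _ := by
    rcases le_or_gt t s with h | h
    · refine ⟨γ s, tendsto_const_nhds.congr' ?_⟩
      filter_upwards [self_mem_nhdsWithin] with r hr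
      rw [max_eq_left (le_trans (le_of_lt hr) h)]
    · refine ⟨Function.leftLim γ t, (γ.tendsto_leftLim t).congr' ?_⟩
      filter_upwards [Ioo_mem_nhdsLT h] with r hr
      rw [max_eq_right hr.1.le]

theorem stopped_apply (γ : TestCurve X) (s t : I) : γ.stopped s t = γ (max s t) := by
  rw [stopped]

theorem stopped_zero (γ : TestCurve X) (s : I) : γ.stopped s 0 = γ s := by
  rw [stopped_apply, max_eq_left unitInterval.nonneg']

theorem stopped_one (γ : TestCurve X) (s : I) : γ.stopped s 1 = γ 1 := by
  rw [stopped_apply, max_eq_right unitInterval.le_one']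

theorem leftLim_stopped (γ : TestCurve X) {s t : I} (h : s < t) :
    Function.leftLim (γ.stopped s) t = Function.leftLim γ t := by
  have : (𝓝[<] t).NeBot := nhdsLT_neBot_of_exists_lt ⟨s, h⟩
  refine tendsto_nhds_unique ((γ.stopped s).tendsto_leftLim t)
    ((γ.tendsto_leftLim t).congr' ?_)
  filter_upwards [Ioo_mem_nhdsLT h] with r hr
  rw [stopped_apply, max_eq_right hr.1.le]

/-- Increments of the stopped curve only see the part of `γ` after `s`, and the mass of `(s,1]` is
the variation of `γ` over `[s,1]`, where both curves agree. An atom of `μ_γ` at `s` is discarded,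
because the stopped curve starts at the value after the jump. -/
theorem stieltjesMeasure_stopped (γ : TestCurve X) (s : I) :
    (γ.stopped s).stieltjesMeasure = γ.stieltjesMeasure.restrict (Ioi s) := by
  refine stieltjesMeasure_eq_of_edist_le _ (fun a b hab => ?_) ?_ ?_
  · rw [Measure.restrict_apply measurableSet_Ioc, stopped_apply, stopped_apply]
    refine (eVariationOn.edist_le γ (s := Icc (max s a) (max s b)) ?_ ?_).trans ?_
    · exact ⟨le_rfl, max_le_max le_rfl hab⟩
    · exact ⟨max_le_max le_rfl hab, le_rfl⟩
    · rw [← stieltjesMeasure_Ioc _ (max_le_max le_rfl hab)]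
      refine measure_mono fun r hr => ?_
      simp only [mem_Ioc, max_lt_iff, le_max_iff] at hr
      exact ⟨⟨hr.1.2, hr.2.resolve_left (not_le.2 hr.1.1)⟩, hr.1.1⟩
  · exact le_antisymm ((Measure.restrict_apply_le _ _).trans
      γ.stieltjesMeasure_singleton_zero.le) bot_le
  · rw [Measure.restrict_apply_univ, Ioi_eq_Ioc_one, stieltjesMeasure_Ioc _ unitInterval.le_one',
      variation]
    rw [eVariationOn.congr (g := γ.stopped s)]
    · exact eVariationOn.mono _ (subset_univ _)
    · intro t ht
      rw [stopped_apply, max_eq_right ht.1]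

theorem symIntegral_stopped (γ : TestCurve X) (s : I) {g : X → ℝ≥0∞}
    (hg : Measurable[borel X] g) :
    (γ.stopped s).symIntegral g = (∫⁻ t in Ioi s, γ.twoSided g t ∂γ.stieltjesMeasure) / 2 := by
  rw [symIntegral_eq _ hg, stieltjesMeasure_stopped]
  congr 1
  refine setLIntegral_congr_fun measurableSet_Ioi fun t ht => ?_
  rw [twoSided, twoSided, leftLim_stopped γ ht, stopped_apply, max_eq_right (le_of_lt ht)]

theorem symIntegral_stopped_le (γ : TestCurve X) (s : I) {g : X → ℝ≥0∞}
    (hg : Measurable[borel X] g) : (γ.stopped s).symIntegral g ≤ γ.symIntegral g := by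
  rw [symIntegral_stopped γ s hg, symIntegral_eq γ hg]
  gcongr
  exact Measure.restrict_le_self

/-- The midpoint of the unit interval. -/
def half : I := ⟨1 / 2, by norm_num, by norm_num⟩

theorem half_pos : (0 : I) < half := by
  rw [← Subtype.coe_lt_coe]; norm_num [half]

theorem half_lt_one : half < (1 : I) := by
  rw [← Subtype.coe_lt_coe]; norm_num [half]

open Classical in
/-- The curve which jumps from `x` to `y` at the time `1/2`. -/
def jump (x y : X) : TestCurve X where
  toFun t := if t < half then x else y
  boundedVariation := by
    -- The jump factors as a Lipschitz map on `{0, 1}` after a monotone real step function, which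
    -- reduces bounded variation to the monotone case.
    set c : ℝ → X := fun r => if r < 1 then x else y
    set w : I → ℝ := fun t => if t < half then 0 else 1
    have hw : Monotone w := by
      intro a b hab
      by_cases hb : b < half
      · simp [w, hb, hab.trans_lt hb]
      · simp only [w, hb, if_false]; split_ifs <;> norm_num
    have hc : LipschitzOnWith (nndist x y) c {0, 1} := by
      rintro a (rfl | rfl) b (rfl | rfl) <;>
        simp [c, edist_comm]
    have hcw : (fun t : I => if t < half then x else y) = c ∘ w := by
      ext t; by_cases h : t < half <;> simp [c, w, h]
    rw [hcw]
    refine ne_top_of_le_ne_top ?_ (hc.comp_eVariationOn_le (s := univ) fun t _ => ?_)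
    · refine ENNReal.mul_ne_top ENNReal.coe_ne_top ?_
      have h := (MonotoneOn.eVariationOn_eq (hw.monotoneOn univ) (mem_univ 0) (mem_univ 1)).le
      have h' : (univ : Set I) = univ ∩ Icc 0 1 := by
        ext s; simp [unitInterval.le_one']
      rw [h']
      exact ne_top_of_le_ne_top ENNReal.ofReal_ne_top h
    · by_cases h : t < half <;> simp [w, h]
  right_cont t _ := by
    by_cases h : t < half
    · refine (continuousAt_const (y := x)).continuousWithinAt.congr_of_eventuallyEq ?_ (by simp [h])
      filter_upwards [mem_nhdsWithin_of_mem_nhds (Iio_mem_nhds h)] with r hr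
      exact if_pos hr
    · refine (continuousAt_const (y := y)).continuousWithinAt.congr_of_eventuallyEq ?_ (by simp [h])
      filter_upwards [self_mem_nhdsWithin] with r hr
      exact if_neg (not_lt.2 (le_trans (not_lt.1 h) hr))
  left_cont_one := by
    refine (continuousAt_const (y := y)).continuousWithinAt.congr_of_eventuallyEq ?_
      (if_neg (not_lt.2 half_lt_one.le))
    filter_upwards [mem_nhdsWithin_of_mem_nhds (Ioi_mem_nhds half_lt_one)] with r hr
    exact if_neg (not_lt.2 (le_of_lt hr))
  left_lim t _ _ := by
    by_cases h : t ≤ half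
    · refine ⟨x, tendsto_const_nhds.congr' ?_⟩
      filter_upwards [self_mem_nhdsWithin] with r hr
      exact (if_pos (lt_of_lt_of_le hr h)).symm
    · refine ⟨y, tendsto_const_nhds.congr' ?_⟩
      filter_upwards [Ioo_mem_nhdsLT (not_le.1 h)] with r hr
      exact (if_neg (not_lt.2 hr.1.le)).symm

theorem jump_of_lt (x y : X) {t : I} (h : t < half) : jump x y t = x := if_pos h

theorem jump_of_le (x y : X) {t : I} (h : half ≤ t) : jump x y t = y := if_neg (not_lt.2 h)

theorem jump_zero (x y : X) : jump x y 0 = x := jump_of_lt x y half_pos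

theorem jump_one (x y : X) : jump x y 1 = y := jump_of_le x y half_lt_one.le

theorem leftLim_jump_half (x y : X) : Function.leftLim (jump x y) half = x := by
  have := neBot_nhdsLT half_pos
  refine tendsto_nhds_unique ((jump x y).tendsto_leftLim half) (tendsto_const_nhds.congr' ?_)
  filter_upwards [self_mem_nhdsWithin] with r hr using (jump_of_lt x y hr).symm

theorem stieltjesMeasure_jump (x y : X) :
    (jump x y).stieltjesMeasure = nndist x y • Measure.dirac half := by
  refine stieltjesMeasure_eq_of_edist_le _ (fun a b hab => ?_) ?_ ?_
  · by_cases ha : a < half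
    · by_cases hb : b < half
      · rw [jump_of_lt _ _ ha, jump_of_lt _ _ hb]; simp
      · rw [jump_of_lt _ _ ha, jump_of_le _ _ (not_lt.1 hb)]
        simp [ENNReal.smul_def, ha, not_lt.1 hb]
    · rw [jump_of_le _ _ (not_lt.1 ha), jump_of_le _ _ ((not_lt.1 ha).trans hab)]; simp
  · simp [half_pos.ne]
  · have h := (jump x y).edist_le_variation 0 1
    rw [jump_zero, jump_one] at h
    simpa [ENNReal.smul_def] using h

/-- `μ_γ` is an atom of mass `d(x,y)` at the jump time, where the one-sided limits are `x` and `y`.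
This is where symmetrization matters: both endpoints enter with equal weight. -/
theorem symIntegral_jump (x y : X) {g : X → ℝ≥0∞} (hg : Measurable[borel X] g) :
    (jump x y).symIntegral g = (g x + g y) * edist x y / 2 := by
  rw [symIntegral_eq _ hg, stieltjesMeasure_jump, lintegral_smul_measure, lintegral_dirac,
    twoSided, leftLim_jump_half, jump_of_le _ _ le_rfl, edist_nndist, ENNReal.smul_def, smul_eq_mul,
    mul_comm, add_comm]

theorem variation_jump (x y : X) : (jump x y).variation = edist x y := by
  rw [← stieltjesMeasure_univ, stieltjesMeasure_jump]
  simp [ENNReal.smul_def]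

theorem measDist_jump_le (x y x' y' : X) :
    measDist (jump x y) (jump x' y') ≤ edist (x, y) (x', y') := by
  unfold measDist
  calc ∫⁻ t : I, min 1 (edist (jump x y t) (jump x' y' t))
      ≤ ∫⁻ _ : I, edist (x, y) (x', y') := by
        refine lintegral_mono fun t => (min_le_right _ _).trans ?_
        by_cases h : t < half
        · rw [jump_of_lt _ _ h, jump_of_lt _ _ h]; exact le_max_left _ _
        · rw [jump_of_le _ _ (not_lt.1 h), jump_of_le _ _ (not_lt.1 h)]; exact le_max_right _ _
    _ = edist (x, y) (x', y') := by simp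

/-- Used to push measures on pairs of points forward to Borel measures on the space of test curves.
-/
theorem continuous_jump : Continuous fun z : X × X => jump z.1 z.2 := by
  refine continuous_def.2 fun U hU => EMetric.isOpen_iff.2 fun z hz => ?_
  obtain ⟨ε, hε, h⟩ := isOpen_iff.1 hU _ hz
  refine ⟨ε, hε, fun z' hz' => h ?_⟩
  refine (measDist_jump_le _ _ _ _).trans_lt ?_
  rw [edist_comm]; exact hz'

end Examples

/-! ### Tails of a curve with small integral -/

section Tail

variable {X : Type*} [MetricSpace X]

/-- There are times `s` in a set of full measure for which the integral of an integrable function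
over `(s,1]` is arbitrarily small. -/
theorem exists_setLIntegral_Ioi_lt (γ : TestCurve X) (hγ : 0 < γ.variation) {G : I → ℝ≥0∞}
    (hG : ∫⁻ t, G t ∂γ.stieltjesMeasure ≠ ∞) {P : I → Prop}
    (hP : ∀ᵐ t ∂γ.stieltjesMeasure, P t) {ε : ℝ≥0∞} (hε : 0 < ε) :
    ∃ s, P s ∧ ∫⁻ t in Ioi s, G t ∂γ.stieltjesMeasure < ε := by
  by_contra! hcon
  set m := γ.stieltjesMeasure
  set N : Set I := {s | ∫⁻ t in Ioi s, G t ∂m < ε} with hN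
  have hN0 : m N = 0 := measure_mono_null (fun s hs hs' => not_lt.2 (hcon s hs') hs) hP
  have hup : ∀ s ∈ N, ∀ r, s ≤ r → r ∈ N := fun s hs r hsr =>
    (lintegral_mono_set (Ioi_subset_Ioi hsr)).trans_lt hs
  have h_int : ∀ A, A ⊆ N → ∫⁻ t in A, G t ∂m = 0 := fun A hA =>
    setLIntegral_measure_zero _ _ (measure_mono_null hA hN0)
  have hne : N.Nonempty := by
    refine ⟨1, ?_⟩
    change ∫⁻ t in Ioi 1, G t ∂m < ε
    rw [show Ioi (1 : I) = ∅ by ext s; simp [unitInterval.le_one']]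
    simpa using hε
  set a := sInf N
  have hIoi : Ioi a ⊆ N := by
    intro r hr
    obtain ⟨s, hs, hsr⟩ := exists_lt_of_csInf_lt hne hr
    exact hup s hs r hsr.le
  have haN : a ∈ N := by
    change ∫⁻ t in Ioi a, G t ∂m < ε
    rw [h_int _ hIoi]; exact hε
  have hIci : Ici a ⊆ N := fun r hr => hup a haN r hr
  -- An infimum at `0` would make all of `[0,1]` null, contradicting positive variation. Otherwise
  -- the tails from times increasing to `a` converge to the integral over `[a,1]`, which is zero, so
  -- some time before `a` already has a small tail.
  rcases eq_or_lt_of_le (unitInterval.nonneg' (t := a)) with h0 | h0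
  · have : m univ = 0 := measure_mono_null (fun r _ => hIci (h0 ▸ unitInterval.nonneg')) hN0
    rw [stieltjesMeasure_univ] at this
    exact hγ.ne' this
  obtain ⟨u, hu, hua, hulim⟩ := exists_seq_strictMono_tendsto' (α := I) h0
  have hlim : Tendsto (fun n => ∫⁻ t in Ioi (u n), G t ∂m) atTop (𝓝 (∫⁻ t in Ici a, G t ∂m)) := by
    have hI : Ici a = ⋂ n, Ioi (u n) := by
      ext r
      simp only [mem_Ici, mem_iInter, mem_Ioi]
      exact ⟨fun h n => (hua n).2.trans_le h, fun h => le_of_tendsto' hulim fun n => (h n).le⟩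
    have : ∀ A, MeasurableSet A → ∫⁻ t in A, G t ∂m = m.withDensity G A := fun A hA =>
      (withDensity_apply _ hA).symm
    simp only [this _ measurableSet_Ioi, this _ measurableSet_Ici]
    rw [hI]
    refine tendsto_measure_iInter_atTop (fun n => measurableSet_Ioi.nullMeasurableSet)
      (fun i j hij => Ioi_subset_Ioi (hu.monotone hij)) ⟨0, ?_⟩
    rw [← this _ measurableSet_Ioi]
    exact ne_top_of_le_ne_top hG (setLIntegral_le_lintegral _ _)
  rw [h_int _ hIci] at hlim
  obtain ⟨n, hn⟩ := (hlim.eventually (gt_mem_nhds hε)).exists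
  exact not_le.2 (hua n).2 (csInf_le (OrderBot.bddBelow N) hn)

end Tail

end TestCurve

end Curves

/-! ### The upper gradient inequality along all curves -/

section UpperGradientInequality

/-- A Lipschitz function on the line whose increments are bounded by the sum of the end values of
`H` times the length, has total increment at most `2 ∫ H`. -/
theorem enorm_sub_le_two_mul_lintegral {V : ℝ} (hV : 0 ≤ V) {F : ℝ → ℝ} {K : ℝ≥0}
    (hF : LipschitzWith K F) {H : ℝ → ℝ≥0∞} (hH : Measurable H)
    (h : ∀ u v, 0 ≤ u → u ≤ v → v ≤ V →
      ‖F v - F u‖ₑ ≤ (H u + H v) * ENNReal.ofReal (v - u)) :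
    ‖F V - F 0‖ₑ ≤ 2 * ∫⁻ v in Ioc 0 V, H v := by
  rcases eq_or_lt_of_le hV with rfl | hV
  · simp
  set A := ∫⁻ v in Ioc 0 V, H v
  have h_int : ∀ a b, IntervalIntegrable F volume a b := fun a b =>
    hF.continuous.intervalIntegrable a b
  have hshift : ∀ d, 0 < d → ∫⁻ v in Ioc 0 (V - d), H (v + d) ≤ A := by
    intro d hd
    calc ∫⁻ v in Ioc 0 (V - d), H (v + d)
        = ∫⁻ v, (Ioc 0 (V - d)).indicator (fun v => H (v + d)) v := by
          rw [lintegral_indicator measurableSet_Ioc]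
      _ ≤ ∫⁻ v, (Ioc 0 V).indicator H (v + d) := by
          refine lintegral_mono fun v => ?_
          by_cases hv : v ∈ Ioc 0 (V - d)
          · rw [indicator_of_mem hv, indicator_of_mem]
            exact ⟨by linarith [hv.1], by linarith [hv.2]⟩
          · rw [indicator_of_notMem hv]; exact bot_le
      _ = ∫⁻ v, (Ioc 0 V).indicator H v := lintegral_add_right_eq_self _ d
      _ = A := lintegral_indicator measurableSet_Ioc _
  -- No differentiation is needed: the integral of `F (v + d) - F v` telescopes to the difference of
  -- the integrals of `F` over the end intervals of length `d`. The Lipschitz bound replaces these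
  -- by `d * F V` and `d * F 0`, each with error at most `K d²`.
  have key : ∀ d, 0 < d → d < V → ‖F V - F 0‖ₑ ≤ 2 * A + ENNReal.ofReal (2 * K * d) := by
    intro d hd hdV
    have e1 : ∫ v in (0 : ℝ)..(V - d), (F (v + d) - F v) =
        (∫ v in (V - d)..V, F v) - ∫ v in (0 : ℝ)..d, F v := by
      have hc : Continuous fun v => F (v + d) := hF.continuous.comp (by fun_prop)
      rw [intervalIntegral.integral_sub (hc.intervalIntegrable _ _) (h_int _ _),
        intervalIntegral.integral_comp_add_right, zero_add, sub_add_cancel]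
      have h1 := intervalIntegral.integral_add_adjacent_intervals (h_int 0 d) (h_int d V)
      have h2 := intervalIntegral.integral_add_adjacent_intervals (h_int 0 (V - d)) (h_int (V - d) V)
      linarith
    have e2 : ‖∫ v in (0 : ℝ)..(V - d), (F (v + d) - F v)‖ₑ ≤ ENNReal.ofReal d * (2 * A) := by
      rw [intervalIntegral.integral_of_le (by linarith)]
      calc ‖∫ v in Ioc 0 (V - d), (F (v + d) - F v)‖ₑ
          ≤ ∫⁻ v in Ioc 0 (V - d), ‖F (v + d) - F v‖ₑ := enorm_integral_le_lintegral_enorm _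
        _ ≤ ∫⁻ v in Ioc 0 (V - d), ENNReal.ofReal d * (H v + H (v + d)) := by
            refine setLIntegral_mono' measurableSet_Ioc fun v hv => ?_
            have := h v (v + d) hv.1.le (by linarith) (by linarith [hv.2])
            rwa [add_sub_cancel_left, mul_comm] at this
        _ = ENNReal.ofReal d * ((∫⁻ v in Ioc 0 (V - d), H v) +
              ∫⁻ v in Ioc 0 (V - d), H (v + d)) := by
            rw [lintegral_const_mul' _ _ ENNReal.ofReal_ne_top, lintegral_add_left hH]
        _ ≤ ENNReal.ofReal d * (2 * A) := by
            rw [two_mul]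
            gcongr
            · refine lintegral_mono_set (Ioc_subset_Ioc_right ?_)
              linarith
            · exact hshift d hd
    have e3 : ∀ a c, c ∈ Icc a (a + d) → |(∫ v in a..(a + d), F v) - d * F c| ≤ K * d * d := by
      intro a c hc
      have h1 : (∫ v in a..(a + d), F v) - d * F c = ∫ v in a..(a + d), (F v - F c) := by
        rw [intervalIntegral.integral_sub (h_int _ _) intervalIntegrable_const]
        simp
      rw [h1]
      rw [← Real.norm_eq_abs]
      refine (intervalIntegral.norm_integral_le_of_norm_le_const (C := K * d) fun v hv => ?_).trans ?_
      · rw [uIoc_of_le (by linarith)] at hv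
        have h2 := hF.dist_le_mul v c
        rw [Real.dist_eq, Real.dist_eq] at h2
        refine h2.trans ?_
        gcongr
        rw [abs_le]; constructor <;> linarith [hv.1, hv.2, hc.1, hc.2]
      · rw [add_sub_cancel_left, abs_of_pos hd]
    have e4 : d * |F V - F 0| ≤
        |∫ v in (0 : ℝ)..(V - d), (F (v + d) - F v)| + d * (2 * K * d) := by
      have h1 := e3 (V - d) V ⟨by linarith, by linarith⟩
      have h2 := e3 0 0 ⟨le_rfl, by linarith⟩
      rw [sub_add_cancel] at h1
      rw [zero_add] at h2
      rw [e1, ← abs_of_pos hd, ← abs_mul, abs_of_pos hd]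
      rw [abs_le] at h1 h2
      have h3 := abs_le.1 (le_refl |(∫ v in (V - d)..V, F v) - ∫ v in (0 : ℝ)..d, F v|)
      rw [abs_le]
      constructor <;> nlinarith [h1.1, h1.2, h2.1, h2.2, h3.1, h3.2]
    have hd0 : ENNReal.ofReal d ≠ 0 := by simpa using hd
    rw [← ENNReal.mul_le_mul_iff_right hd0 ENNReal.ofReal_ne_top, mul_add]
    calc ENNReal.ofReal d * ‖F V - F 0‖ₑ = ENNReal.ofReal (d * |F V - F 0|) := by
          rw [ENNReal.ofReal_mul hd.le, Real.enorm_eq_ofReal_abs]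
      _ ≤ ENNReal.ofReal (|∫ v in (0 : ℝ)..(V - d), (F (v + d) - F v)| + d * (2 * K * d)) :=
          ENNReal.ofReal_le_ofReal e4
      _ = ‖∫ v in (0 : ℝ)..(V - d), (F (v + d) - F v)‖ₑ +
            ENNReal.ofReal d * ENNReal.ofReal (2 * K * d) := by
          rw [ENNReal.ofReal_add (abs_nonneg _) (by positivity), ENNReal.ofReal_mul hd.le,
            Real.enorm_eq_ofReal_abs]
      _ ≤ _ := by gcongr
  have hlim : Tendsto (fun d : ℝ => 2 * A + ENNReal.ofReal (2 * K * d)) (𝓝[>] 0) (𝓝 (2 * A)) := by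
    have h1 : Tendsto (fun d : ℝ => ENNReal.ofReal (2 * K * d)) (𝓝 0) (𝓝 0) := by
      have : Continuous fun d : ℝ => ENNReal.ofReal (2 * K * d) :=
        ENNReal.continuous_ofReal.comp (by fun_prop)
      simpa using this.tendsto 0
    simpa using (tendsto_const_nhds (x := 2 * A)).add (h1.mono_left nhdsWithin_le_nhds)
  refine ge_of_tendsto hlim ?_
  filter_upwards [Ioo_mem_nhdsGT hV] with d hd using key d hd.1 hd.2

/-! ### Parametrization by variation, with linear interpolation over jumps -/

namespace TestCurve

variable {X : Type*} [MetricSpace X] (γ : TestCurve X)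

/-- The generalized inverse of the variation function. -/
def quantile (v : ℝ) : I := sInf {t | min v (γ.variationFunction 1) ≤ γ.variationFunction t}

/-- Right-continuity of the variation function means that the infimum defining the quantile is
attained. -/
theorem quantile_le_iff {v : ℝ} (hv : v ≤ γ.variationFunction 1) (t : I) :
    γ.quantile v ≤ t ↔ v ≤ γ.variationFunction t := by
  have hS : γ.quantile v = sInf {t | v ≤ γ.variationFunction t} := by
    rw [quantile, min_eq_left hv]
  have hne : {t | v ≤ γ.variationFunction t}.Nonempty := ⟨1, hv⟩
  refine ⟨fun h => ?_, fun h => by rw [hS]; exact csInf_le (OrderBot.bddBelow _) h⟩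
  refine le_trans ?_ (γ.variationFunction.mono h)
  by_contra! hlt
  have h1 : ∀ᶠ r in 𝓝[≥] γ.quantile v, γ.variationFunction r < v :=
    (γ.variationFunction.right_continuous _).eventually (gt_mem_nhds hlt)
  have hq : γ.quantile v < 1 :=
    lt_of_not_ge fun h1 => not_lt.2 hv (lt_of_le_of_lt (γ.variationFunction.mono h1) hlt)
  obtain ⟨u, hu, hus⟩ := (mem_nhdsGE_iff_exists_Ico_subset' hq).1 h1
  obtain ⟨t', ht', htu⟩ := exists_lt_of_csInf_lt hne (hS ▸ hu : sInf _ < u)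
  have hle : γ.quantile v ≤ t' := by rw [hS]; exact csInf_le (OrderBot.bddBelow _) ht'
  exact not_lt.2 ht' (show γ.variationFunction t' < v from hus ⟨hle, htu⟩)

theorem le_variationFunction_quantile {v : ℝ} (hv : v ≤ γ.variationFunction 1) :
    v ≤ γ.variationFunction (γ.quantile v) := (γ.quantile_le_iff hv _).1 le_rfl

/-- Together with `le_variationFunction_quantile` this places `v` in the interval over which `V_γ`
jumps at its quantile, possibly a single point. Interpolation over jumps takes place in this
interval. -/
theorem leftLim_variationFunction_quantile_le {v : ℝ} (h0 : 0 ≤ v)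
    (hv : v ≤ γ.variationFunction 1) :
    Function.leftLim γ.variationFunction (γ.quantile v) ≤ v := by
  rcases eq_or_lt_of_le (unitInterval.nonneg' (t := γ.quantile v)) with h | h
  · rw [← h, leftLim_zero, variationFunction_zero]; exact h0
  have := neBot_nhdsLT h
  refine le_of_tendsto (γ.variationFunction.mono.tendsto_leftLim _) ?_
  filter_upwards [self_mem_nhdsWithin] with r hr
  by_contra! hlt
  exact not_le.2 hr ((γ.quantile_le_iff hv r).2 hlt.le)

/-- The truncation of `v` at `V_γ(1)` keeps `1` in every defining set, so monotonicity holds on the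
whole line. -/
theorem monotone_quantile : Monotone γ.quantile := fun _ v huv =>
  csInf_le_csInf (OrderBot.bddBelow _) ⟨1, show min v _ ≤ _ from min_le_right _ _⟩
    fun _ ht => (min_le_min_right _ huv).trans ht

theorem measurable_quantile : Measurable γ.quantile := γ.monotone_quantile.measurable

theorem variationFunction_nonneg (t : I) : 0 ≤ γ.variationFunction t := ENNReal.toReal_nonneg

/-- The quantile transform: on `(0, V(γ)]` the quantile is at most `t` exactly up to level `V_γ(t)`.
It turns integrals against `μ_γ` into Lebesgue integrals. -/
theorem map_quantile :
    (volume.restrict (Ioc 0 (γ.variationFunction 1))).map γ.quantile = γ.stieltjesMeasure := by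
  symm
  refine Measure.ext_of_Iic _ _ fun t => ?_
  rw [Measure.map_apply γ.measurable_quantile measurableSet_Iic,
    Measure.restrict_apply (γ.measurable_quantile measurableSet_Iic), stieltjesMeasure_Iic]
  have : γ.quantile ⁻¹' Iic t ∩ Ioc 0 (γ.variationFunction 1) =
      Ioc 0 (γ.variationFunction t) := by
    ext v
    simp only [mem_inter_iff, mem_preimage, mem_Iic, mem_Ioc]
    constructor
    · rintro ⟨h1, h2, h3⟩
      exact ⟨h2, (γ.quantile_le_iff h3 t).1 h1⟩
    · rintro ⟨h1, h2⟩
      have h3 := h2.trans (γ.variationFunction.mono (unitInterval.le_one' (t := t)))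
      exact ⟨(γ.quantile_le_iff h3 t).2 h2, h1, h3⟩
  rw [this, Real.volume_Ioc, sub_zero]

/-- The mean slope of `f ∘ γ` with respect to the variation of `γ` over the jump at time `t`. -/
def jumpSlope (f : X → ℝ) (t : I) : ℝ :=
  (f (γ t) - f (Function.leftLim γ t)) /
    (γ.variationFunction t - Function.leftLim γ.variationFunction t)

/-- The function `f` along `γ`, parametrized by the variation of `γ`, and interpolated linearly
over the jumps of `γ`. -/
def interpolation (f : X → ℝ) (v : ℝ) : ℝ :=
  f (Function.leftLim γ (γ.quantile v)) +
    (v - Function.leftLim γ.variationFunction (γ.quantile v)) * γ.jumpSlope f (γ.quantile v)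

variable {f : X → ℝ} {g : X → ℝ≥0∞}

/-- The Hajłasz inequality between the two one-sided limits, divided by the jump of `V_γ`, which is
at least their distance. If `V_γ` does not jump, the quotient by zero is zero. -/
theorem enorm_jumpSlope_le (h : ∀ x y, ‖f y - f x‖ₑ ≤ (g x + g y) * edist x y) (t : I) :
    ‖γ.jumpSlope f t‖ₑ ≤ γ.twoSided g t := by
  rcases eq_or_ne (γ.variationFunction t - Function.leftLim γ.variationFunction t) 0 with h0 | h0
  · rw [jumpSlope, h0]; simp
  have h1 : 0 ≤ γ.variationFunction t - Function.leftLim γ.variationFunction t :=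
    sub_nonneg.2 (γ.variationFunction.mono.leftLim_le le_rfl)
  have h2 : ‖γ.jumpSlope f t‖ₑ * ENNReal.ofReal
      (γ.variationFunction t - Function.leftLim γ.variationFunction t) ≤ γ.twoSided g t *
      ENNReal.ofReal (γ.variationFunction t - Function.leftLim γ.variationFunction t) := by
    rw [← Real.enorm_of_nonneg h1, ← enorm_mul, jumpSlope, div_mul_cancel₀ _ h0,
      Real.enorm_of_nonneg h1]
    refine (h _ _).trans ?_
    rw [edist_dist, twoSided, add_comm (g _)]
    gcongr
    exact γ.dist_leftLim_self_le t
  refine (ENNReal.mul_le_mul_iff_left ?_ ENNReal.ofReal_ne_top).1 h2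
  simpa using lt_of_le_of_ne h1 h0.symm

/-- The segment over a jump ends at the value after the jump. Without a jump of `V_γ` the one-sided
limits coincide, so the slope zero is harmless. -/
theorem leftLim_add_mul_jumpSlope (f : X → ℝ) (t : I) :
    f (Function.leftLim γ t) +
      (γ.variationFunction t - Function.leftLim γ.variationFunction t) * γ.jumpSlope f t =
      f (γ t) := by
  rcases eq_or_ne (γ.variationFunction t - Function.leftLim γ.variationFunction t) 0 with h0 | h0
  · have h := γ.dist_leftLim_self_le t
    rw [h0] at h ⊢
    rw [dist_le_zero.1 h]; ring
  · rw [jumpSlope, mul_div_cancel₀ _ h0]; ring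

/-- With distinct quantiles `s < t`, the increment splits into the rest of the jump at `s`, the
passage from `γ(s)` to `γ(t⁻)`, and the beginning of the jump at `t`. The corresponding lengths add
up to `v - u`. The slope bounds control the outer terms and the Hajłasz inequality the middle one,
all with the same two-sided sums. -/
theorem enorm_interpolation_sub_le
    (h : ∀ x y, ‖f y - f x‖ₑ ≤ (g x + g y) * edist x y) {u v : ℝ} (hu : 0 ≤ u) (huv : u ≤ v)
    (hv : v ≤ γ.variationFunction 1) :
    ‖γ.interpolation f v - γ.interpolation f u‖ₑ ≤
      (γ.twoSided g (γ.quantile u) + γ.twoSided g (γ.quantile v)) * ENNReal.ofReal (v - u) := by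
  have hslope := γ.enorm_jumpSlope_le h
  have hle := γ.monotone_quantile huv
  have hvl := γ.leftLim_variationFunction_quantile_le (hu.trans huv) hv
  have hur := γ.le_variationFunction_quantile (huv.trans hv)
  unfold interpolation
  generalize γ.quantile v = t at *
  generalize γ.quantile u = s at *
  rcases eq_or_lt_of_le hle with rfl | hst
  · have : f (Function.leftLim γ s) +
        (v - Function.leftLim γ.variationFunction s) * γ.jumpSlope f s -
        (f (Function.leftLim γ s) +
          (u - Function.leftLim γ.variationFunction s) * γ.jumpSlope f s) =
        γ.jumpSlope f s * (v - u) := by ring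
    rw [this, enorm_mul, Real.enorm_of_nonneg (sub_nonneg.2 huv)]
    gcongr
    exact (hslope s).trans le_self_add
  have hmid : γ.variationFunction s ≤ Function.leftLim γ.variationFunction t :=
    γ.variationFunction.mono.le_leftLim hst
  have : f (Function.leftLim γ t) +
        (v - Function.leftLim γ.variationFunction t) * γ.jumpSlope f t -
        (f (Function.leftLim γ s) +
          (u - Function.leftLim γ.variationFunction s) * γ.jumpSlope f s) =
      (v - Function.leftLim γ.variationFunction t) * γ.jumpSlope f t +
        (f (Function.leftLim γ t) - f (γ s)) +
        (γ.variationFunction s - u) * γ.jumpSlope f s := by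
    rw [← γ.leftLim_add_mul_jumpSlope f s]; ring
  rw [this]
  set a := ENNReal.ofReal (v - Function.leftLim γ.variationFunction t)
  set b := ENNReal.ofReal (Function.leftLim γ.variationFunction t - γ.variationFunction s)
  set c := ENNReal.ofReal (γ.variationFunction s - u)
  have habc : ENNReal.ofReal (v - u) = a + b + c := by
    rw [← ENNReal.ofReal_add (by linarith) (by linarith),
      ← ENNReal.ofReal_add (by linarith) (by linarith)]
    congr 1; ring
  rw [habc]
  calc _ ≤ ‖(v - Function.leftLim γ.variationFunction t) * γ.jumpSlope f t‖ₑ +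
        ‖f (Function.leftLim γ t) - f (γ s)‖ₑ +
        ‖(γ.variationFunction s - u) * γ.jumpSlope f s‖ₑ :=
        (enorm_add_le _ _).trans (add_le_add_left (enorm_add_le _ _) _)
    _ ≤ (γ.twoSided g s + γ.twoSided g t) * a + (γ.twoSided g s + γ.twoSided g t) * b +
        (γ.twoSided g s + γ.twoSided g t) * c := by
        gcongr
        · rw [enorm_mul, Real.enorm_of_nonneg (sub_nonneg.2 hvl), mul_comm]
          gcongr
          exact (hslope t).trans le_add_self
        · refine (h _ _).trans ?_
          rw [edist_dist, twoSided, twoSided]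
          gcongr
          · exact le_self_add
          · exact le_add_self
          · exact ENNReal.ofReal_le_ofReal (γ.dist_leftLim_le hst)
        · rw [enorm_mul, Real.enorm_of_nonneg (sub_nonneg.2 hur), mul_comm]
          gcongr
          exact (hslope s).trans le_self_add
    _ = _ := by ring

theorem interpolation_zero (f : X → ℝ) : γ.interpolation f 0 = f (γ 0) := by
  have h : γ.quantile 0 = 0 :=
    le_antisymm ((γ.quantile_le_iff (γ.variationFunction_nonneg 1) 0).2
      (γ.variationFunction_nonneg 0)) unitInterval.nonneg'
  rw [interpolation, h, leftLim_zero, leftLim_zero, variationFunction_zero]; ring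

theorem interpolation_variationFunction_one (f : X → ℝ) :
    γ.interpolation f (γ.variationFunction 1) = f (γ 1) := by
  set t := γ.quantile (γ.variationFunction 1) with ht
  have h : γ.variationFunction t = γ.variationFunction 1 :=
    le_antisymm (γ.variationFunction.mono unitInterval.le_one')
      (γ.le_variationFunction_quantile le_rfl)
  rw [interpolation, ← ht, ← h, γ.leftLim_add_mul_jumpSlope f]
  have h' := γ.dist_le (unitInterval.le_one' (t := t))
  rw [h, sub_self] at h'
  rw [dist_le_zero.1 h']

/-- For a Lipschitz function, four times a pointwise Hajłasz gradient satisfies the upper gradient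
inequality along every test curve. -/
theorem enorm_sub_le_of_lipschitzWith {K : ℝ≥0} (hf : LipschitzWith K f)
    (hg : Measurable[borel X] g) (h : ∀ x y, ‖f y - f x‖ₑ ≤ (g x + g y) * edist x y) :
    ‖f (γ 1) - f (γ 0)‖ₑ ≤ 4 * γ.symIntegral g := by
  set V := γ.variationFunction 1 with hV
  have hV0 : 0 ≤ V := γ.variationFunction_nonneg 1
  -- The preceding estimate with the constant gradient `K`: each two-sided sum is `2 K`, and there
  -- are two of them.
  have hlip : LipschitzOnWith (4 * K) (γ.interpolation f) (Icc 0 V) := by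
    have hK : ∀ x y, ‖f y - f x‖ₑ ≤ ((K : ℝ≥0∞) + K) * edist x y := by
      intro x y
      rw [← edist_eq_enorm_sub, edist_comm]
      exact (hf x y).trans (by gcongr; exact le_self_add)
    intro u hu v hv
    wlog huv : u ≤ v generalizing u v
    · rw [edist_comm, edist_comm u]; exact this hv hu (le_of_not_ge huv)
    have := γ.enorm_interpolation_sub_le hK hu.1 huv hv.2
    rw [edist_comm, edist_eq_enorm_sub]
    refine this.trans (le_of_eq ?_)
    rw [edist_comm, edist_dist, Real.dist_eq, abs_of_nonneg (sub_nonneg.2 huv), twoSided, twoSided]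
    push_cast
    ring
  obtain ⟨F, hF, hFeq⟩ := hlip.extend_real
  have hH : Measurable fun v => γ.twoSided g (γ.quantile v) :=
    (γ.measurable_twoSided hg).comp γ.measurable_quantile
  have := enorm_sub_le_two_mul_lintegral hV0 hF hH fun u v hu huv hv => by
    rw [← hFeq ⟨hu.trans huv, hv⟩, ← hFeq ⟨hu, huv.trans hv⟩]
    exact γ.enorm_interpolation_sub_le h hu huv hv
  rw [← hFeq ⟨hV0, le_rfl⟩, ← hFeq ⟨le_rfl, hV0⟩, interpolation_zero,
    interpolation_variationFunction_one] at this
  refine this.trans (le_of_eq ?_)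
  -- The four is the two of the increment estimate times the two that undoes the averaging in the
  -- symmetrized integral.
  rw [symIntegral_eq γ hg, ← map_quantile, lintegral_map (γ.measurable_twoSided hg)
    γ.measurable_quantile, show (4 : ℝ≥0∞) = 2 * 2 by norm_num, mul_assoc,
    ENNReal.mul_div_cancel (by norm_num) (by norm_num)]

theorem ae_twoSided_lt_top (hg : Measurable[borel X] g) (hγ : γ.symIntegral g ≠ ∞) :
    ∀ᵐ t ∂γ.stieltjesMeasure, γ.twoSided g t < ∞ := by
  refine ae_lt_top (γ.measurable_twoSided hg) fun h => hγ ?_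
  rw [symIntegral_eq γ hg, h]
  exact ENNReal.top_div_of_ne_top (by norm_num)

theorem lintegral_twoSided_ne_top (hg : Measurable[borel X] g) (hγ : γ.symIntegral g ≠ ∞) :
    ∫⁻ t, γ.twoSided g t ∂γ.stieltjesMeasure ≠ ∞ := fun h => hγ <| by
  rw [symIntegral_eq γ hg, h]
  exact ENNReal.top_div_of_ne_top (by norm_num)

/-- A `μ_γ`-almost sure property holds at times `s` from which on the curve has an arbitrarily small
symmetrized integral. -/
theorem exists_symIntegral_stopped_lt (hV : 0 < γ.variation) (hg : Measurable[borel X] g)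
    (hγ : γ.symIntegral g ≠ ∞) {P : I → Prop} (hP : ∀ᵐ t ∂γ.stieltjesMeasure, P t) {ε : ℝ≥0∞}
    (hε : 0 < ε) : ∃ s, P s ∧ (γ.stopped s).symIntegral g < ε := by
  obtain ⟨s, hs, hsε⟩ := γ.exists_setLIntegral_Ioi_lt hV (γ.lintegral_twoSided_ne_top hg hγ) hP hε
  refine ⟨s, hs, ?_⟩
  rw [symIntegral_stopped γ s hg]
  exact (ENNReal.div_le_of_le_mul (le_mul_of_one_le_right bot_le (by norm_num))).trans_lt hsε

end TestCurve

/-- A Borel function with a pointwise Hajłasz gradient can be modified where the gradient is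
infinite in such a way that eight times this gradient is an upper gradient along all test curves. -/
theorem exists_borel_forall_enorm_sub_le {X : Type*} [MetricSpace X] {f : X → ℝ} {g : X → ℝ≥0∞}
    (hg : Measurable[borel X] g) (h : ∀ x y, ‖f y - f x‖ₑ ≤ (g x + g y) * edist x y) :
    ∃ f' : X → ℝ, Measurable[borel X] f' ∧ (∀ x, g x < ∞ → f' x = f x) ∧
      ∀ γ : TestCurve X, 0 < γ.variation → ‖f' (γ 1) - f' (γ 0)‖ₑ ≤ 8 * γ.symIntegral g := by
  let _ : MeasurableSpace X := borel X
  have _ : BorelSpace X := ⟨rfl⟩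
  have hlip : ∀ k : ℕ, LipschitzOnWith (2 * k) f {x | g x ≤ k} := by
    intro k x hx y hy
    rw [edist_comm, edist_eq_enorm_sub]
    refine (h x y).trans ?_
    push_cast
    rw [two_mul]
    gcongr
    · exact hx
    · exact hy
  choose F hF hFeq using fun k => (hlip k).extend_real
  -- If a point lies outside `{g ≤ k}`, then `2 g` there already exceeds the Lipschitz constant `2
  -- k` of the extension. The eight below is this factor two times the four of the Lipschitz case.
  have hFg : ∀ k x y, ‖F k y - F k x‖ₑ ≤ ((2 • g) x + (2 • g) y) * edist x y := by
    intro k x y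
    by_cases hx : g x ≤ k
    · by_cases hy : g y ≤ k
      · rw [← hFeq k hx, ← hFeq k hy]
        refine (h x y).trans ?_
        gcongr <;> simp only [Pi.smul_apply, two_nsmul] <;> exact le_self_add
      · rw [← edist_eq_enorm_sub, edist_comm]
        refine (hF k x y).trans ?_
        gcongr
        refine le_trans ?_ le_add_self
        simp only [Pi.smul_apply, nsmul_eq_mul]
        push_cast
        gcongr
        exact (not_le.1 hy).le
    · rw [← edist_eq_enorm_sub, edist_comm]
      refine (hF k x y).trans ?_
      gcongr
      refine le_trans ?_ le_self_add
      simp only [Pi.smul_apply, nsmul_eq_mul]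
      push_cast
      gcongr
      exact (not_le.1 hx).le
  have hg2 : Measurable (2 • g) := hg.const_smul 2
  have hsym : ∀ γ : TestCurve X, γ.symIntegral (2 • g) = 2 * γ.symIntegral g := by
    intro γ
    have := γ.symIntegral_smul 2 g
    have h2 : (2 : ℝ≥0) • g = 2 • g := by
      ext x; simp [ENNReal.smul_def]
    rw [h2] at this
    simpa using this
  have hFS : ∀ k (γ : TestCurve X), ‖F k (γ 1) - F k (γ 0)‖ₑ ≤ 8 * γ.symIntegral g := by
    intro k γ
    refine (γ.enorm_sub_le_of_lipschitzWith (hF k) hg2 (hFg k)).trans (le_of_eq ?_)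
    rw [hsym, ← mul_assoc]; norm_num
  have hev : ∀ x, g x < ∞ → ∀ᶠ k in atTop, F k x = f x := by
    intro x hx
    obtain ⟨n, hn⟩ := ENNReal.exists_nat_gt hx.ne
    filter_upwards [eventually_ge_atTop n] with k hk
    exact (hFeq k (hn.le.trans (by exact_mod_cast hk))).symm
  -- At a time `s` with `g (γ s)` finite, the extensions eventually all equal `f (γ s)`. Any two
  -- late ones thus differ at the endpoint by at most `8 + 8` times the integral over the tail from
  -- `s`.
  have hconv : ∀ γ : TestCurve X, 0 < γ.variation → γ.symIntegral g ≠ ∞ →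
      ∃ l, Tendsto (fun k => F k (γ 1)) atTop (𝓝 l) := by
    intro γ hV hγ
    refine cauchySeq_tendsto_of_complete (EMetric.cauchySeq_iff.2 fun ε hε => ?_)
    have hε' : 0 < ε / 16 := ENNReal.div_pos hε.ne' (by norm_num)
    obtain ⟨s, hs, hsε⟩ := γ.exists_symIntegral_stopped_lt hV hg hγ
      (γ.ae_twoSided_lt_top hg hγ) hε'
    have hgs : g (γ s) < ∞ := lt_of_le_of_lt le_self_add hs
    obtain ⟨n, hn⟩ := eventually_atTop.1 (hev _ hgs)
    refine ⟨n, fun j hj k hk => ?_⟩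
    have hS := fun k => hFS k (γ.stopped s)
    simp only [TestCurve.stopped_one, TestCurve.stopped_zero] at hS
    have h1 : edist (F j (γ 1)) (f (γ s)) ≤ 8 * (γ.stopped s).symIntegral g := by
      rw [← hn j hj, edist_eq_enorm_sub]; exact hS j
    have h2 : edist (f (γ s)) (F k (γ 1)) ≤ 8 * (γ.stopped s).symIntegral g := by
      rw [← hn k hk, edist_comm, edist_eq_enorm_sub]; exact hS k
    calc edist (F j (γ 1)) (F k (γ 1)) ≤ _ := edist_triangle _ (f (γ s)) _
      _ ≤ 16 * (γ.stopped s).symIntegral g := by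
          refine (add_le_add h1 h2).trans (le_of_eq ?_)
          rw [← add_mul]; norm_num
      _ < ε := by
          rw [mul_comm]
          exact (ENNReal.lt_div_iff_mul_lt (by norm_num) (by norm_num)).1 hsε
  -- The upper limit is Borel, and its default value where the sequence is unbounded plays no role:
  -- it is evaluated only where the extensions converge, the initial endpoint being reached by
  -- reversal.
  refine ⟨fun x => limsup (fun k => F k x) atTop,
    Measurable.limsup fun k => (hF k).continuous.measurable, fun x hx => ?_, fun γ hV => ?_⟩
  · exact (tendsto_const_nhds.congr' ((hev x hx).mono fun _ hk => hk.symm)).limsup_eq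
  · rcases eq_or_ne (γ.symIntegral g) ∞ with hγ | hγ
    · rw [hγ]; simp
    obtain ⟨a, ha⟩ := hconv γ hV hγ
    obtain ⟨b, hb⟩ := hconv γ.reverse (by rwa [TestCurve.variation_reverse])
      (by rwa [TestCurve.symIntegral_reverse])
    rw [TestCurve.reverse_one] at hb
    beta_reduce
    rw [ha.limsup_eq, hb.limsup_eq]
    exact le_of_tendsto' (ha.sub hb).enorm fun k => hFS k γ

end UpperGradientInequality

/-! ### Comparison of the notions of gradient -/

section Gradients

variable {X : Type*} [MetricSpace X]

/-- `g` is an upper S-gradient of `f`: the upper gradient inequality holds along every nontrivial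
test curve. -/
def IsUpperSGradient (f : X → ℝ) (g : X → ℝ≥0∞) : Prop :=
  Measurable[borel X] g ∧ ∀ γ : TestCurve X, 0 < γ.variation →
    ‖f (γ 1) - f (γ 0)‖ₑ ≤ γ.symIntegral g

/-- Left-continuity at `1` means that distinct curves already differ at some time before `1`, and
right-continuity keeps them apart on an interval of positive length. -/
theorem TestCurve.eq_of_measDist_eq_zero {γ γ' : TestCurve X}
    (h : ∀ ε : ℝ≥0∞, 0 < ε → TestCurve.measDist γ γ' < ε) : γ = γ' := by
  by_contra hne
  have hlt : ∃ t, t < 1 ∧ γ t ≠ γ' t := by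
    by_contra! hcon
    refine hne (TestCurve.ext' fun t => ?_)
    rcases lt_or_eq_of_le (unitInterval.le_one' (t := t)) with ht | rfl
    · exact hcon t ht
    have := TestCurve.neBot_nhdsLT (zero_lt_one (α := I))
    rw [← γ.leftLim_one, ← γ'.leftLim_one]
    refine tendsto_nhds_unique (γ.tendsto_leftLim 1) ((γ'.tendsto_leftLim 1).congr' ?_)
    filter_upwards [self_mem_nhdsWithin] with r hr using (hcon r hr).symm
  obtain ⟨t, ht, hγt⟩ := hlt
  have hη : 0 < edist (γ t) (γ' t) / 2 := ENNReal.half_pos (edist_pos.2 hγt).ne'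
  have h1 : ∀ᶠ r in 𝓝[≥] t, edist (γ t) (γ' t) / 2 < edist (γ r) (γ' r) :=
    ((γ.right_cont' t).edist (γ'.right_cont' t)).eventually
      (lt_mem_nhds (ENNReal.half_lt_self (edist_pos.2 hγt).ne' (edist_ne_top _ _)))
  obtain ⟨u, hu, hus⟩ := (mem_nhdsGE_iff_exists_Ico_subset' ht).1 h1
  have hvol : 0 < volume (Ico t u) := by
    rw [unitInterval.volume_Ico]; simpa using hu
  refine absurd (h (min 1 (edist (γ t) (γ' t) / 2) * volume (Ico t u))
    (ENNReal.mul_pos (lt_min one_pos hη).ne' hvol.ne')) (not_lt.2 ?_)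
  calc min 1 (edist (γ t) (γ' t) / 2) * volume (Ico t u)
      = ∫⁻ _ in Ico t u, min 1 (edist (γ t) (γ' t) / 2) := by simp
    _ ≤ ∫⁻ r in Ico t u, min 1 (edist (γ r) (γ' r)) :=
        setLIntegral_mono' measurableSet_Ico fun r hr => min_le_min le_rfl (le_of_lt (hus hr))
    _ ≤ TestCurve.measDist γ γ' := setLIntegral_le_lintegral _ _

/-- Makes evaluation of Dirac measures valid for arbitrary integrands and sets, so test measures at
single curves need no measurability of curve functionals. -/
instance : MeasurableSingletonClass (TestCurve X) := ⟨fun γ => by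
  refine IsClosed.measurableSet (isOpen_compl_iff.1 (TestCurve.isOpen_iff.2 fun γ' hγ' => ?_))
  by_contra! hcon
  refine hγ' (TestCurve.eq_of_measDist_eq_zero fun ε hε => ?_)
  obtain ⟨γ₂, h, h'⟩ := not_subset.1 (hcon ε hε)
  rw [notMem_compl_iff, mem_singleton_iff] at h'
  rw [← h']; exact h⟩

variable [MeasurableSpace X] [OpensMeasurableSpace X] {p : ℝ≥0} {μ : Measure X} {f : X → ℝ} {g : X → ℝ≥0∞}

theorem IsUpperSGradient.isWeak (hp : 1 ≤ p) (h : IsUpperSGradient f g) :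
    IsWeakUpperSGradient p μ f g := by
  refine ⟨h.1, ?_⟩
  have : {γ : TestCurve X | 0 < γ.variation ∧ ¬ ‖f (γ 1) - f (γ 0)‖ₑ ≤ γ.symIntegral g} = ∅ :=
    eq_empty_of_forall_notMem fun γ hγ => hγ.2 (h.2 γ hγ.1)
  rw [this, modulus_empty hp]

theorem IsUpperSGradient.lintegral_le (h : IsUpperSGradient f g) {ν : Measure (TestCurve X)}
    (hν : ν ∈ testMeasures X) :
    ∫⁻ γ, ‖f (γ 1) - f (γ 0)‖ₑ ∂ν ≤ symIntegralMeasure ν g := by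
  have hae : ∀ᵐ γ ∂ν, ¬ γ.variation = 0 := by
    rw [ae_iff]; simp only [not_not]; exact hν
  exact lintegral_mono_ae (hae.mono fun γ hγ => h.2 γ (pos_iff_ne_zero.2 hγ))

theorem IsUpperSGradient.isGeneralizedWeak (hp : 1 ≤ p) (h : IsUpperSGradient f g) :
    IsGeneralizedWeakUpperSGradient p μ f g := by
  refine ⟨h.1, ?_⟩
  have : {ν | ν ∈ testMeasures X ∧
      ¬ ∫⁻ γ, ‖f (γ 1) - f (γ 0)‖ₑ ∂ν ≤ symIntegralMeasure ν g} = ∅ :=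
    eq_empty_of_forall_notMem fun ν hν => hν.2 (h.lintegral_le hν.1)
  rw [this, generalizedModulus_empty hp]

theorem IsUpperSGradient.isMeasure (h : IsUpperSGradient f g) : IsMeasureUpperSGradient μ f g :=
  ⟨h.1, fun _ hν _ => h.lintegral_le hν⟩

theorem gradNorm_mono {G G' : (X → ℝ≥0∞) → Prop} (h : ∀ g, G g → G' g) :
    gradNorm p μ G' ≤ gradNorm p μ G := le_iInf₂ fun g hg => iInf₂_le g (h g hg)

/-- Generalized weak upper S-gradients are weak upper S-gradients, by testing with Dirac
measures. -/
theorem IsGeneralizedWeakUpperSGradient.isWeak (h : IsGeneralizedWeakUpperSGradient p μ f g) :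
    IsWeakUpperSGradient p μ f g := by
  refine ⟨h.1, le_antisymm (le_trans ?_ h.2.le) bot_le⟩
  refine le_iInf₂ fun ρ hρ => iInf₂_le ρ ⟨hρ.1, fun γ hγ => ?_⟩
  have := hρ.2 (Measure.dirac γ) ⟨?_, ?_⟩
  · rwa [symIntegralMeasure, lintegral_dirac] at this
  · have hγ0 : γ ∉ {γ : TestCurve X | γ.variation = 0} := hγ.1.ne'
    simpa [testMeasures] using hγ0
  · rw [symIntegralMeasure, lintegral_dirac, lintegral_dirac]
    exact hγ.2

theorem eLpNorm_lt_top_iff_lintegral (hp : 1 ≤ p) (g : X → ℝ≥0∞) :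
    eLpNorm g p μ < ∞ ↔ ∫⁻ x, g x ^ (p : ℝ) ∂μ < ∞ := by
  have hp0 : (p : ℝ≥0∞) ≠ 0 := by
    have := lt_of_lt_of_le one_pos hp
    exact_mod_cast this.ne'
  rw [eLpNorm_lt_top_iff_lintegral_rpow_enorm_lt_top hp0 ENNReal.coe_ne_top]
  simp

/-- A family of curves of modulus zero admits an `L^p` function with infinite integrals along all
curves of the family. -/
theorem exists_symIntegral_eq_top_of_modulus_eq_zero (hp : 1 ≤ p) {Γ : Set (TestCurve X)}
    (h : modulus p μ Γ = 0) :
    ∃ ρ : X → ℝ≥0∞, Measurable[borel X] ρ ∧ eLpNorm ρ p μ < ∞ ∧ ∀ γ ∈ Γ, γ.symIntegral ρ = ∞ := by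
  have hp0 : (0 : ℝ) < p := lt_of_lt_of_le one_pos (by exact_mod_cast hp)
  obtain ⟨δ, hδ, hδs⟩ := ENNReal.exists_pos_sum_of_countable' one_ne_zero ℕ
  -- Zero modulus allows `k ρ_k` to have summable `p`-th power integrals. Their supremum stays in
  -- `L^p`, since its `p`-th power is at most the sum of the `p`-th powers, and its integral along
  -- each curve of the family is at least every `k`.
  have hex : ∀ k : ℕ, ∃ ρ : X → ℝ≥0∞, (Measurable[borel X] ρ ∧ ∀ γ ∈ Γ, 1 ≤ γ.symIntegral ρ) ∧
      ((k : ℝ≥0) : ℝ≥0∞) ^ (p : ℝ) * ∫⁻ x, ρ x ^ (p : ℝ) ∂μ ≤ δ k := by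
    intro k
    have hk : ((k : ℝ≥0) : ℝ≥0∞) ^ (p : ℝ) ≠ ∞ :=
      ENNReal.rpow_ne_top_of_nonneg hp0.le ENNReal.coe_ne_top
    have hlt : modulus p μ Γ < δ k / ((k : ℝ≥0) : ℝ≥0∞) ^ (p : ℝ) := by
      rw [h]; exact ENNReal.div_pos (hδ k).ne' hk
    unfold modulus at hlt
    simp only [iInf_lt_iff] at hlt
    obtain ⟨ρ, hρ, hlt⟩ := hlt
    refine ⟨ρ, hρ, ?_⟩
    rw [mul_comm]
    exact ENNReal.mul_le_of_le_div hlt.le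
  choose ρ hρ hle using hex
  have hborel : ∀ k : ℕ, Measurable[borel X] ((k : ℝ≥0) • ρ k) := fun k => borel_smul (hρ k).1 _
  refine ⟨fun x => ⨆ k : ℕ, ((k : ℝ≥0) • ρ k) x, ?_, ?_, fun γ hγ => ?_⟩
  · let _ : MeasurableSpace X := borel X
    exact Measurable.iSup hborel
  · rw [eLpNorm_lt_top_iff_lintegral hp]
    calc ∫⁻ x, (⨆ k : ℕ, ((k : ℝ≥0) • ρ k) x) ^ (p : ℝ) ∂μ
        ≤ ∫⁻ x, ∑' k : ℕ, (((k : ℝ≥0) • ρ k) x) ^ (p : ℝ) ∂μ := by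
          refine lintegral_mono fun x => ?_
          rw [← ENNReal.le_rpow_inv_iff hp0]
          refine iSup_le fun k => ?_
          rw [ENNReal.le_rpow_inv_iff hp0]
          exact ENNReal.le_tsum (f := fun k : ℕ => (((k : ℝ≥0) • ρ k) x) ^ (p : ℝ)) k
      _ = ∑' k : ℕ, ∫⁻ x, (((k : ℝ≥0) • ρ k) x) ^ (p : ℝ) ∂μ :=
          lintegral_tsum fun k => ((measurable_of_borel (hborel k)).pow_const _).aemeasurable
      _ ≤ ∑' k, δ k := by
          refine ENNReal.tsum_le_tsum fun k => le_trans (le_of_eq ?_) (hle k)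
          rw [← lintegral_const_mul' _ _
            (ENNReal.rpow_ne_top_of_nonneg hp0.le ENNReal.coe_ne_top)]
          refine lintegral_congr fun x => ?_
          rw [Pi.smul_apply, ENNReal.smul_def, smul_eq_mul, ENNReal.mul_rpow_of_nonneg _ _ hp0.le]
      _ < ∞ := hδs.trans ENNReal.one_lt_top
  · refine ENNReal.eq_top_of_forall_nnreal_le fun r => ?_
    obtain ⟨k, hk⟩ := exists_nat_ge r
    calc (r : ℝ≥0∞) ≤ ((k : ℝ≥0) : ℝ≥0∞) * 1 := by rw [mul_one]; exact_mod_cast hk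
      _ ≤ (k : ℝ≥0) * γ.symIntegral (ρ k) := by gcongr; exact (hρ k).2 γ hγ
      _ = γ.symIntegral ((k : ℝ≥0) • ρ k) := (γ.symIntegral_smul _ _).symm
      _ ≤ _ := γ.symIntegral_mono fun x => le_iSup (fun k : ℕ => ((k : ℝ≥0) • ρ k) x) k

/-- Replaces the exceptional family by a single `L^p` function whose integral is infinite on it.
Unlike the modulus, finiteness of this integral passes directly to stopped and reversed curves. -/
theorem IsWeakUpperSGradient.exists_forall_le (hp : 1 ≤ p) (h : IsWeakUpperSGradient p μ f g) :
    ∃ ρ : X → ℝ≥0∞, Measurable[borel X] ρ ∧ eLpNorm ρ p μ < ∞ ∧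
      ∀ γ : TestCurve X, 0 < γ.variation → γ.symIntegral ρ ≠ ∞ →
        ‖f (γ 1) - f (γ 0)‖ₑ ≤ γ.symIntegral g := by
  obtain ⟨ρ, hρ, hρp, htop⟩ := exists_symIntegral_eq_top_of_modulus_eq_zero hp h.2
  refine ⟨ρ, hρ, hρp, fun γ hV hγ => ?_⟩
  by_contra hcon
  exact hγ (htop γ ⟨hV, hcon⟩)

theorem measurable_indicator_top {E : Set X} (hE : MeasurableSet[borel X] E) :
    Measurable[borel X] (E.indicator fun _ => (∞ : ℝ≥0∞)) := by
  let _ : MeasurableSpace X := borel X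
  exact measurable_const.indicator hE

theorem eLpNorm_indicator_top {E : Set X} (hE : μ E = 0) :
    eLpNorm (E.indicator fun _ => (∞ : ℝ≥0∞)) p μ = 0 := by
  have h0 : (E.indicator fun _ => (∞ : ℝ≥0∞)) =ᵐ[μ] (0 : X → ℝ≥0∞) := by
    have : ∀ᵐ x ∂μ, x ∉ E := measure_eq_zero_iff_ae_notMem.1 hE
    filter_upwards [this] with x hx using indicator_of_notMem hx _
  rw [eLpNorm_congr_ae h0]; simp

/-- If the upper gradient inequality with `g` holds on the curves with finite integral of `ρ`, then
the upper S-gradients come arbitrarily close to `g` in norm. -/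
theorem gradNorm_isUpperSGradient_le (hp : 1 ≤ p) {ρ : X → ℝ≥0∞} (hg : Measurable[borel X] g)
    (hρ : Measurable[borel X] ρ) (hρp : eLpNorm ρ p μ < ∞)
    (h : ∀ γ : TestCurve X, 0 < γ.variation → γ.symIntegral ρ ≠ ∞ →
      ‖f (γ 1) - f (γ 0)‖ₑ ≤ γ.symIntegral g) :
    gradNorm p μ (IsUpperSGradient f) ≤ eLpNorm g p μ := by
  have key : ∀ ε : ℝ, 0 < ε →
      gradNorm p μ (IsUpperSGradient f) ≤ eLpNorm g p μ + ‖ε‖ₑ * eLpNorm ρ p μ := by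
    intro ε hε
    have hε' : Measurable[borel X] (‖ε‖₊ • ρ) := borel_smul hρ _
    -- The added term has infinite integral on the exceptional curves and contributes only a
    -- multiple of `ε` to the norm.
    refine (iInf₂_le (g + ‖ε‖₊ • ρ) ⟨borel_add hg hε', fun γ hV => ?_⟩).trans
      ((eLpNorm_grad_add_le hp (measurable_of_borel hg) (measurable_of_borel hε')).trans
        (add_le_add le_rfl (eLpNorm_grad_smul_le ε ρ)))
    refine le_trans ?_ (γ.symIntegral_add_le g _)
    rcases eq_or_ne (γ.symIntegral ρ) ∞ with htop | htop
    · rw [γ.symIntegral_smul, htop, ENNReal.mul_top (by simpa using hε.ne')]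
      simp
    · exact (h γ hV htop).trans le_self_add
  have hlim : Tendsto (fun ε : ℝ => eLpNorm g p μ + ‖ε‖ₑ * eLpNorm ρ p μ) (𝓝[>] 0)
      (𝓝 (eLpNorm g p μ)) := by
    have h1 : Tendsto (fun ε : ℝ => ‖ε‖ₑ) (𝓝[>] 0) (𝓝 0) := by
      have := (continuous_enorm (E := ℝ)).tendsto 0
      rw [enorm_zero] at this
      exact this.mono_left nhdsWithin_le_nhds
    have h2 := ENNReal.Tendsto.mul_const h1 (b := eLpNorm ρ p μ) (Or.inr hρp.ne)
    simpa using h2.const_add (eLpNorm g p μ)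
  exact ge_of_tendsto hlim (by filter_upwards [self_mem_nhdsWithin] with ε hε using key ε hε)

/-- Every other kind of curve gradient contains the everywhere valid ones, so this inequality makes
the infima for weak and generalized weak gradients coincide. -/
theorem gradNorm_isUpperSGradient_le_isWeak (hp : 1 ≤ p) :
    gradNorm p μ (IsUpperSGradient f) ≤ gradNorm p μ (IsWeakUpperSGradient p μ f) := by
  refine le_iInf₂ fun g hg => ?_
  obtain ⟨ρ, hρ, hρp, h⟩ := hg.exists_forall_le hp
  exact gradNorm_isUpperSGradient_le hp hg.1 hρ hρp h

theorem exists_isUpperSGradient_of_gradNorm_lt {c : ℝ≥0∞}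
    (h : gradNorm p μ (IsUpperSGradient f) < c) :
    ∃ g, IsUpperSGradient f g ∧ eLpNorm g p μ < c := by
  unfold gradNorm at h
  simpa only [iInf_lt_iff, exists_prop] using h

theorem IsWeakUpperSGradient.exists_isUpperSGradient (hp : 1 ≤ p)
    (h : ∃ g, IsWeakUpperSGradient p μ f g ∧ eLpNorm g p μ < ∞) :
    ∃ g, IsUpperSGradient f g ∧ eLpNorm g p μ < ∞ :=
  exists_isUpperSGradient_of_gradNorm_lt
    ((gradNorm_isUpperSGradient_le_isWeak hp).trans_lt (gradNorm_ne_top h).lt_top)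

/-- A function with a weak upper gradient in `L^p`, which vanishes outside a Borel null set, has
vanishing gradient norm. -/
theorem gradNorm_eq_zero_of_forall_notMem (hp : 1 ≤ p)
    (h : ∃ g, IsWeakUpperSGradient p μ f g ∧ eLpNorm g p μ < ∞) {E : Set X}
    (hE : MeasurableSet[borel X] E) (hE0 : μ E = 0) (hf : ∀ x ∉ E, f x = 0) :
    gradNorm p μ (IsUpperSGradient f) = 0 := by
  obtain ⟨g, hg, hgp⟩ := h
  obtain ⟨ρ, hρ, hρp, hle⟩ := hg.exists_forall_le hp
  have hEm := measurable_indicator_top hE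
  -- Costs nothing in norm, but a curve with finite integral of `J` avoids `E` at `μ_γ`-almost every
  -- time. Hence `f` vanishes at the start of suitable short tails, and so at the endpoint.
  set J : X → ℝ≥0∞ := E.indicator fun _ => ∞
  have hend : ∀ γ : TestCurve X, 0 < γ.variation → γ.symIntegral (ρ + (g + J)) ≠ ∞ →
      f (γ 1) = 0 := by
    intro γ hV hγ
    have hfin := ne_top_of_le_ne_top hγ (γ.symIntegral_add_le ρ (g + J))
    have hγρ := (ENNReal.add_ne_top.1 hfin).1
    have hfin' := ne_top_of_le_ne_top (ENNReal.add_ne_top.1 hfin).2 (γ.symIntegral_add_le g J)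
    have hγg := (ENNReal.add_ne_top.1 hfin').1
    have hae : ∀ᵐ t ∂γ.stieltjesMeasure, γ t ∉ E := by
      filter_upwards [γ.ae_twoSided_lt_top hEm (ENNReal.add_ne_top.1 hfin').2] with t ht htE
      have h1 : J (γ t) = ∞ := indicator_of_mem htE _
      rw [TestCurve.twoSided, h1, top_add] at ht
      exact lt_irrefl _ ht
    rw [← enorm_eq_zero]
    refine le_antisymm (le_of_forall_pos_le_add fun ε hε => ?_) bot_le
    obtain ⟨s, hs, hsε⟩ := γ.exists_symIntegral_stopped_lt hV hg.1 hγg hae hε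
    rw [zero_add]
    -- The gradient inequality is available only for nontrivial curves. If the endpoints of the tail
    -- coincide, the value is zero directly.
    rcases eq_or_ne (γ 1) (γ s) with heq | hne
    · rw [heq, hf _ hs]; simp
    · have hVs : 0 < (γ.stopped s).variation :=
        TestCurve.variation_pos_of_ne _ (s := 1) (t := 0)
          (by rwa [TestCurve.stopped_one, TestCurve.stopped_zero])
      have := hle (γ.stopped s) hVs (ne_top_of_le_ne_top hγρ (γ.symIntegral_stopped_le s hρ))
      rw [TestCurve.stopped_one, TestCurve.stopped_zero, hf _ hs, sub_zero] at this
      exact this.trans hsε.le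
  have hm : Measurable[borel X] (ρ + (g + J)) := borel_add hρ (borel_add hg.1 hEm)
  have hfin : eLpNorm (ρ + (g + J)) p μ < ∞ := by
    refine (eLpNorm_grad_add_le hp (measurable_of_borel hρ)
      (measurable_of_borel (borel_add hg.1 hEm))).trans_lt (ENNReal.add_lt_top.2 ⟨hρp, ?_⟩)
    refine (eLpNorm_grad_add_le hp (measurable_of_borel hg.1)
      (measurable_of_borel hEm)).trans_lt (ENNReal.add_lt_top.2 ⟨hgp, ?_⟩)
    rw [eLpNorm_indicator_top hE0]; exact ENNReal.zero_lt_top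
  have h0 : Measurable[borel X] (0 : X → ℝ≥0∞) := @measurable_const _ _ _ (borel X) _
  refine le_antisymm ((gradNorm_isUpperSGradient_le hp h0 hm hfin fun γ hV hγ => ?_).trans
    (by simp)) bot_le
  have h1 := hend γ.reverse (by rwa [TestCurve.variation_reverse])
    (by rwa [TestCurve.symIntegral_reverse])
  rw [TestCurve.reverse_one] at h1
  rw [hend γ hV hγ, h1]
  simp

/-! ### Hajłasz gradients and Borel representatives -/

/-- Weak upper S-gradients are Hajłasz gradients, by testing with curves that jump once. -/
theorem IsWeakUpperSGradient.isHajlaszGradient (hp : 1 ≤ p)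
    (h : IsWeakUpperSGradient p μ f g) : IsHajlaszGradient μ f g := by
  obtain ⟨ρ, hρ, hρp, hle⟩ := h.exists_forall_le hp
  have hρm := measurable_of_borel hρ
  -- Between points where `ρ` is finite, the jump has finite integral of `ρ` and so is not
  -- exceptional. The set is null because `ρ` lies in `L^p`.
  refine ⟨measurable_of_borel h.1, {x | ρ x = ∞}, hρm (measurableSet_singleton ∞), ?_,
    fun x hx y hy => ?_⟩
  · rw [eLpNorm_lt_top_iff_lintegral hp] at hρp
    have hp0 : (0 : ℝ) < p := lt_of_lt_of_le one_pos (by exact_mod_cast hp)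
    have := ae_lt_top (hρm.pow_const _) hρp.ne
    refine measure_mono_null (fun x hx => ?_) (ae_iff.1 this)
    have hx' : ρ x = ∞ := hx
    simp only [mem_ofPred_eq, hx', ENNReal.top_rpow_of_pos hp0]
    exact lt_irrefl _
  rcases eq_or_ne x y with rfl | hxy
  · simp
  have hV : 0 < (TestCurve.jump x y).variation := by
    rw [TestCurve.variation_jump]; exact edist_pos.2 hxy
  have hfin : (TestCurve.jump x y).symIntegral ρ ≠ ∞ := by
    rw [TestCurve.symIntegral_jump _ _ hρ]
    exact ENNReal.div_ne_top (ENNReal.mul_ne_top (ENNReal.add_ne_top.2 ⟨hx, hy⟩)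
      (edist_ne_top _ _)) (by norm_num)
  have := hle _ hV hfin
  rw [TestCurve.jump_one, TestCurve.jump_zero, TestCurve.symIntegral_jump _ _ h.1] at this
  exact this.trans (ENNReal.div_le_of_le_mul (le_mul_of_one_le_right bot_le (by norm_num)))

/-- For a `σ`-finite Borel regular measure, measurable functions have Borel representatives. -/
theorem exists_borel_ae_eq [SigmaFinite μ] (hμ : IsBorelRegular μ) {β : Type*} [MeasurableSpace β]
    [MeasurableSpace.CountablyGenerated β] {u : X → β} (hu : Measurable u) :
    ∃ u' : X → β, Measurable[borel X] u' ∧ u =ᵐ[μ] u' := by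
  have hle : borel X ≤ ‹MeasurableSpace X› := OpensMeasurableSpace.borel_le
  have hset : ∀ A : Set X, MeasurableSet A → @NullMeasurableSet X (borel X) A (μ.trim hle) := by
    intro A hA
    have hU : A = ⋃ n, A ∩ spanningSets μ n := by
      rw [← inter_iUnion, iUnion_spanningSets, inter_univ]
    rw [hU]
    refine NullMeasurableSet.iUnion fun n => ?_
    -- On a piece of finite measure a Borel hull exceeds the set by a null set. Taking a Borel hull
    -- of this excess shows null measurability for `μ` restricted to the Borel sets.
    obtain ⟨B, hB, hAB, hBA⟩ := hμ (A ∩ spanningSets μ n)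
    obtain ⟨N, hN, hNB, hN0⟩ := hμ (B \ (A ∩ spanningSets μ n))
    have hfin : μ (A ∩ spanningSets μ n) ≠ ∞ :=
      ((measure_mono inter_subset_right).trans_lt (measure_spanningSets_lt_top μ n)).ne
    rw [measure_sdiff hAB (hA.inter (measurableSet_spanningSets μ n)).nullMeasurableSet hfin, hBA,
      tsub_self] at hN0
    have hN0' : (μ.trim hle) N = 0 := by rw [trim_measurableSet_eq hle hN, hN0]
    refine (@MeasurableSet.nullMeasurableSet X (borel X) (μ.trim hle) B hB).congr ?_
    refine (measure_eq_zero_iff_ae_notMem.1 hN0').mono fun x hx => ?_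
    refine propext ⟨fun hxB => ?_, fun hxA => hAB hxA⟩
    by_contra hxA
    exact hx (hNB ⟨hxB, hxA⟩)
  have hnull : @NullMeasurable X β (borel X) _ u (μ.trim hle) := fun s hs => hset _ (hu hs)
  obtain ⟨u', hu', hae⟩ := hnull.aemeasurable
  exact ⟨u', hu', ae_eq_of_ae_eq_trim hae⟩

/-- For a `σ`-finite Borel regular measure, a function with a Hajłasz gradient has a Borel
representative with an upper S-gradient of comparable norm. -/
theorem IsHajlaszGradient.exists_isUpperSGradient [SigmaFinite μ] (hμ : IsBorelRegular μ)
    (hf : Measurable f) (h : IsHajlaszGradient μ f g) (hp : 1 ≤ p) (hgp : eLpNorm g p μ < ∞) :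
    ∃ f' : X → ℝ, Measurable[borel X] f' ∧ f =ᵐ[μ] f' ∧
      ∃ g', IsUpperSGradient f' g' ∧ eLpNorm g' p μ ≤ 8 * eLpNorm g p μ := by
  obtain ⟨f₀, hf₀, hff₀⟩ := exists_borel_ae_eq hμ hf
  obtain ⟨g₀, hg₀, hgg₀⟩ := exists_borel_ae_eq hμ h.1
  obtain ⟨E, hE, hE0, hle⟩ := h.2
  -- One Borel null set collects all exceptions. Setting the gradient to `∞` on it makes the Hajłasz
  -- inequality hold for all pairs.
  obtain ⟨N, hN, hEN, hNE⟩ := hμ (E ∪ ({x | f x ≠ f₀ x} ∪ {x | g x ≠ g₀ x}))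
  have hN0 : μ N = 0 := by
    rw [hNE]
    exact measure_union_null hE0 (measure_union_null hff₀ hgg₀)
  set g₁ : X → ℝ≥0∞ := g₀ + N.indicator fun _ => ∞
  have hg₁ : Measurable[borel X] g₁ := borel_add hg₀ (measurable_indicator_top hN)
  have hgood : ∀ x ∉ N, x ∉ E ∧ f x = f₀ x ∧ g x = g₀ x := by
    intro x hx
    have hx' := fun hxx => hx (hEN hxx)
    simp only [mem_union, mem_ofPred_eq, imp_false, not_or, not_not] at hx'
    exact hx'
  have htop : ∀ x ∈ N, g₁ x = ∞ := by
    intro x hx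
    simp [g₁, indicator_of_mem hx]
  have hle₁ : ∀ x y, ‖f₀ y - f₀ x‖ₑ ≤ (g₁ x + g₁ y) * edist x y := by
    intro x y
    rcases eq_or_ne x y with rfl | hxy
    · simp
    have hd : edist x y ≠ 0 := (edist_pos.2 hxy).ne'
    by_cases hx : x ∈ N
    · rw [htop x hx, top_add, ENNReal.top_mul hd]; exact le_top
    by_cases hy : y ∈ N
    · rw [htop y hy, add_top, ENNReal.top_mul hd]; exact le_top
    obtain ⟨hxE, hxf, hxg⟩ := hgood x hx
    obtain ⟨hyE, hyf, hyg⟩ := hgood y hy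
    rw [← hxf, ← hyf]
    refine (hle x hxE y hyE).trans ?_
    simp only [g₁, Pi.add_apply, ← hxg, ← hyg]
    gcongr <;> exact le_self_add
  have hg₁g : g₁ =ᵐ[μ] g := by
    filter_upwards [measure_eq_zero_iff_ae_notMem.1 hN0] with x hx
    simp [g₁, indicator_of_notMem hx, (hgood x hx).2.2]
  obtain ⟨f', hf', hff', hS⟩ := exists_borel_forall_enorm_sub_le hg₁ hle₁
  have hfin : ∀ᵐ x ∂μ, g₁ x < ∞ := by
    rw [← eLpNorm_congr_ae hg₁g, eLpNorm_lt_top_iff_lintegral hp] at hgp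
    have hp0 : (0 : ℝ) < p := lt_of_lt_of_le one_pos (by exact_mod_cast hp)
    filter_upwards [ae_lt_top ((measurable_of_borel hg₁).pow_const _) hgp.ne] with x hx
    exact (ENNReal.rpow_lt_top_iff_of_pos hp0).1 hx
  refine ⟨f', hf', ?_, ‖(8 : ℝ)‖₊ • g₁, ⟨borel_smul hg₁ _, fun γ hV => ?_⟩, ?_⟩
  · filter_upwards [hff₀, hfin] with x hx hx' using hx.trans (hff' x hx').symm
  · rw [γ.symIntegral_smul]
    simpa using hS γ hV
  · refine (eLpNorm_grad_smul_le _ _).trans (le_of_eq ?_)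
    rw [eLpNorm_congr_ae hg₁g, enorm_eq_nnnorm]
    simp

/-- Under an admissible measure the distributions of both endpoints are dominated by multiples of
`μ`, so `f` vanishes at both ends of almost every curve. -/
theorem isMeasureUpperSGradient_zero_of_ae_eq_zero (hf : Measurable[borel X] f)
    (h0 : f =ᵐ[μ] 0) : IsMeasureUpperSGradient μ f 0 := by
  refine ⟨@measurable_const _ _ _ (borel X) _, fun ν _ hν => ?_⟩
  obtain ⟨-, ⟨C, hC⟩, -⟩ := hν
  have hE : MeasurableSet[borel X] {x | f x ≠ 0} := by
    let _ : MeasurableSpace X := borel X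
    exact (hf (measurableSet_singleton 0)).compl
  have hnull : ∀ t, ∀ᵐ γ ∂ν, f (γ t) = 0 := by
    intro t
    rw [ae_iff]
    refine le_antisymm ((hC t _ hE).trans ?_) bot_le
    rw [show μ {x | f x ≠ 0} = 0 from h0, mul_zero]
  have : ∫⁻ γ, ‖f (γ 1) - f (γ 0)‖ₑ ∂ν = 0 := by
    rw [lintegral_congr_ae (g := fun _ => 0)]
    · simp
    · filter_upwards [hnull 0, hnull 1] with γ h0 h1
      simp [h0, h1]
  rw [this]; exact bot_le

end Gradients

/-! ### From `μ`-upper gradients to Hajłasz gradients -/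

section Doubling

variable {X : Type*} [MetricSpace X] [MeasurableSpace X] [OpensMeasurableSpace X]
  {μ : Measure X} {f : X → ℝ} {g : X → ℝ≥0∞}

theorem IsDoubling.sigmaFinite (h : IsDoubling μ) : SigmaFinite μ := by
  obtain ⟨C, hC⟩ := h
  rcases isEmpty_or_nonempty X with hX | ⟨⟨x₀⟩⟩
  · rw [Measure.eq_zero_of_isEmpty μ]; infer_instance
  refine ⟨⟨⟨fun n : ℕ => Metric.ball x₀ (n + 1), fun n => trivial, fun n => ?_, ?_⟩⟩⟩
  · exact (hC x₀ (n + 1) (by positivity)).2.1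
  · refine eq_univ_of_forall fun x => mem_iUnion.2 ?_
    obtain ⟨n, hn⟩ := exists_nat_gt (dist x x₀)
    exact ⟨n, Metric.mem_ball.2 (hn.trans (lt_add_one _))⟩

/-- The balls of half the radius around a maximal `ε`-separated set are disjoint and of positive
measure, hence countably many by σ-finiteness. Maximality makes the centres `ε`-dense. -/
theorem IsDoubling.secondCountableTopology (h : IsDoubling μ) : SecondCountableTopology X := by
  have := h.sigmaFinite
  obtain ⟨C, hC⟩ := h
  refine Metric.secondCountable_of_almost_dense_set fun ε hε => ?_
  obtain ⟨s, hs⟩ := zorn_subset {s : Set X | s.Pairwise fun x y => ε ≤ dist x y}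
    fun c hc hch => ⟨⋃₀ c, (pairwise_sUnion hch.directedOn).2 fun a ha => hc ha,
      fun a ha => subset_sUnion_of_mem ha⟩
  refine ⟨s, ?_, fun x => ?_⟩
  · have h1 := Measure.countable_meas_pos_of_disjoint_iUnion (μ := μ)
      (As := fun x : s => Metric.ball (x : X) (ε / 2)) (fun x => Metric.isOpen_ball.measurableSet)
      fun x y hxy => Metric.ball_disjoint_ball (by
        rw [add_halves]
        exact hs.prop x.2 y.2 (Subtype.coe_injective.ne hxy))
    have h2 : {x : s | 0 < μ (Metric.ball (x : X) (ε / 2))} = univ :=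
      eq_univ_of_forall fun x => (hC x (ε / 2) (half_pos hε)).1
    rw [h2] at h1
    exact countable_univ_iff.1 h1
  · by_contra! hcon
    have hx : x ∈ s := hs.mem_of_prop_insert (hs.prop.insert fun y hy _ =>
      ⟨(hcon y hy).le, by rw [dist_comm]; exact (hcon y hy).le⟩)
    have := hcon x hx
    rw [dist_self] at this
    exact lt_asymm hε this

/-- A positive mass of points near almost every point has values of `g` not much larger than the
value at the point. -/
theorem ae_forall_measure_ball_inter_ne_zero [SecondCountableTopology X] (μ : Measure X)
    (g : X → ℝ≥0∞) : ∀ᵐ x ∂μ, ∀ a : ℝ≥0∞, g x < a → ∀ r : ℝ, 0 < r →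
      μ (Metric.ball x r ∩ {z | g z < a}) ≠ 0 := by
  have key : ∀ q : ℚ, μ {x | g x < (Real.toNNReal q : ℝ≥0∞) ∧
      ∃ r : ℝ, 0 < r ∧ μ (Metric.ball x r ∩ {z | g z < (Real.toNNReal q : ℝ≥0∞)}) = 0} = 0 := by
    intro q
    -- The null ball that places `x` in this set is itself a neighbourhood in which the set is null,
    -- and second countability globalizes this. Rational levels reduce the statement to countably
    -- many null sets.
    refine measure_null_of_locally_null _ fun x hx => ?_
    obtain ⟨-, r, hr, h0⟩ := hx
    refine ⟨_, ?_, h0⟩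
    exact inter_mem (mem_nhdsWithin_of_mem_nhds (Metric.ball_mem_nhds x hr))
      (mem_of_superset self_mem_nhdsWithin fun z hz => hz.1)
  have hall := ae_all_iff.2 fun q => measure_eq_zero_iff_ae_notMem.1 (key q)
  filter_upwards [hall] with x hx a ha r hr h0
  obtain ⟨q, -, hq, hqa⟩ := ENNReal.lt_iff_exists_rat_btwn.1 ha
  exact hx q ⟨hq, r, hr, measure_mono_null (inter_subset_inter_right _
    fun z (hz : g z < _) => lt_trans hz hqa) h0⟩

/-- `μ`-upper S-gradients satisfy the Hajłasz inequality at almost all pairs of points. -/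
theorem IsMeasureUpperSGradient.ae_prod [SecondCountableTopology X] [SFinite μ]
    (hμ : ∀ (x : X) (r : ℝ), μ (Metric.ball x r) < ∞) (hf : Measurable[borel X] f)
    (h : IsMeasureUpperSGradient μ f g) :
    ∀ᵐ z ∂μ.prod μ, ‖f z.2 - f z.1‖ₑ ≤ (g z.1 + g z.2) * edist z.1 z.2 := by
  have hfm := measurable_of_borel hf
  have hgm := measurable_of_borel h.1
  have hL : Measurable fun z : X × X => ‖f z.2 - f z.1‖ₑ :=
    ((hfm.comp measurable_snd).sub (hfm.comp measurable_fst)).enorm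
  have hR : Measurable fun z : X × X => (g z.1 + g z.2) * edist z.1 z.2 :=
    ((hgm.comp measurable_fst).add (hgm.comp measurable_snd)).mul measurable_edist
  rcases isEmpty_or_nonempty X with hX | ⟨⟨x₀⟩⟩
  · exact Eventually.of_forall fun z => (IsEmpty.false z.1).elim
  -- The bad pairs are cut to a bounded region with bounded increments of `f`. The ball gives finite
  -- mass, dominated marginals and bounded jumps; the bound on `f` gives the finite integral needed
  -- for a strict inequality.
  set D : ℕ → Set (X × X) := fun n =>
    {z | (g z.1 + g z.2) * edist z.1 z.2 < ‖f z.2 - f z.1‖ₑ} ∩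
      ((Metric.ball x₀ n ×ˢ Metric.ball x₀ n) ∩ {z | ‖f z.2 - f z.1‖ₑ ≤ n}) with hD
  have hDm : ∀ n, MeasurableSet (D n) := fun n => (measurableSet_lt hR hL).inter
    ((Metric.isOpen_ball.measurableSet.prod Metric.isOpen_ball.measurableSet).inter
      (measurableSet_le hL measurable_const))
  suffices hnull : ∀ n, (μ.prod μ) (D n) = 0 by
    rw [ae_iff]
    refine measure_mono_null (fun z hz => ?_) (measure_iUnion_null hnull)
    obtain ⟨n₁, hn₁⟩ := exists_nat_gt (dist z.1 x₀)
    obtain ⟨n₂, hn₂⟩ := exists_nat_gt (dist z.2 x₀)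
    obtain ⟨n₃, hn₃⟩ := ENNReal.exists_nat_gt (r := ‖f z.2 - f z.1‖ₑ) enorm_ne_top
    refine mem_iUnion.2 ⟨max n₁ (max n₂ n₃), not_le.1 hz, ⟨?_, ?_⟩, ?_⟩
    · exact Metric.mem_ball.2 (hn₁.trans_le (by exact_mod_cast le_max_left _ _))
    · exact Metric.mem_ball.2 (hn₂.trans_le
        (by exact_mod_cast (le_max_left _ _).trans (le_max_right _ _)))
    · exact hn₃.le.trans (by exact_mod_cast (le_max_right _ _).trans (le_max_right _ _))
  intro n
  by_contra hpos
  set m := (μ.prod μ).restrict (D n) with hm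
  set b := μ (Metric.ball x₀ n) with hb
  have hb' : b ≠ ∞ := (hμ x₀ n).ne
  have hmb : m univ ≤ b * b := by
    rw [hm, Measure.restrict_apply_univ, ← Measure.prod_prod]
    exact measure_mono fun z hz => hz.2.1
  have hm0 : m univ ≠ 0 := by rwa [hm, Measure.restrict_apply_univ]
  have hm1 : m univ ≠ ∞ := ne_top_of_le_ne_top (ENNReal.mul_ne_top hb' hb') hmb
  set c := (m univ)⁻¹ with hc
  have hc0 : c ≠ 0 := ENNReal.inv_ne_zero.2 hm1
  have hc1 : c ≠ ∞ := ENNReal.inv_ne_top.2 hm0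
  have hJ : Measurable fun z : X × X => TestCurve.jump z.1 z.2 :=
    TestCurve.continuous_jump.measurable
  set ν := (c • m).map fun z : X × X => TestCurve.jump z.1 z.2 with hν
  -- The other coordinate is confined to the ball. At each time a jump curve shows one of its two
  -- coordinates, so these marginal bounds give admissibility with constant `c b`.
  have hmarg : ∀ B, MeasurableSet B → m (Prod.fst ⁻¹' B) ≤ b * μ B ∧ m (Prod.snd ⁻¹' B) ≤ b * μ B := by
    intro B hB
    constructor
    · rw [hm, Measure.restrict_apply (measurable_fst hB), mul_comm, hb, ← Measure.prod_prod]
      exact measure_mono fun z hz => ⟨hz.1, hz.2.2.1.2⟩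
    · rw [hm, Measure.restrict_apply (measurable_snd hB), hb, ← Measure.prod_prod]
      exact measure_mono fun z hz => ⟨hz.2.2.1.1, hz.1⟩
  have hmae : ∀ᵐ z ∂m, z ∈ D n := ae_restrict_mem (hDm n)
  have htest : ν ∈ testMeasures X := by
    have hmeas : Measurable fun γ : TestCurve X => edist (γ 0) (γ 1) := by
      let _ : MeasurableSpace X := borel X
      have _ : BorelSpace X := ⟨rfl⟩
      exact (TestCurve.measurable_eval 0).edist (TestCurve.measurable_eval 1)
    refine measure_mono_null (t := {γ : TestCurve X | edist (γ 0) (γ 1) = 0})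
      (fun γ hγ => le_antisymm ((γ.edist_le_variation 0 1).trans (le_of_eq hγ)) bot_le) ?_
    have hset : MeasurableSet {γ : TestCurve X | edist (γ 0) (γ 1) = 0} :=
      hmeas (measurableSet_singleton 0)
    rw [hν, Measure.map_apply hJ hset, Measure.smul_apply, smul_eq_mul]
    refine mul_eq_zero_of_right _ ?_
    rw [measure_eq_zero_iff_ae_notMem]
    filter_upwards [hmae] with z hz hz0
    simp only [mem_preimage, mem_ofPred_eq, TestCurve.jump_zero, TestCurve.jump_one,
      edist_eq_zero] at hz0
    have h1 := hz.1
    simp only [mem_ofPred_eq, hz0, sub_self, enorm_zero] at h1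
    exact not_lt_bot h1
  have hadm : IsAdmissible μ ν := by
    refine ⟨⟨?_⟩, ⟨(c * b).toNNReal, fun t B hB => ?_⟩, ?_⟩
    · rw [hν, Measure.map_apply hJ MeasurableSet.univ, preimage_univ, Measure.smul_apply,
        smul_eq_mul, hc, ENNReal.inv_mul_cancel hm0 hm1]
    · rw [ENNReal.coe_toNNReal (ENNReal.mul_ne_top hc1 hb'), hν]
      have hBm : MeasurableSet B := OpensMeasurableSpace.borel_le B hB
      have hmeas : MeasurableSet {γ : TestCurve X | γ t ∈ B} := by
        let _ : MeasurableSpace X := borel X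
        exact TestCurve.measurable_eval t hB
      rw [Measure.map_apply hJ hmeas, Measure.smul_apply, smul_eq_mul, mul_assoc]
      gcongr
      by_cases ht : t < TestCurve.half
      · have : (fun z : X × X => TestCurve.jump z.1 z.2) ⁻¹' {γ | γ t ∈ B} = Prod.fst ⁻¹' B := by
          ext z; simp [TestCurve.jump_of_lt _ _ ht]
        rw [this]; exact (hmarg B hBm).1
      · have : (fun z : X × X => TestCurve.jump z.1 z.2) ⁻¹' {γ | γ t ∈ B} = Prod.snd ⁻¹' B := by
          ext z; simp [TestCurve.jump_of_le _ _ (not_lt.1 ht)]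
        rw [this]; exact (hmarg B hBm).2
    · refine (lintegral_map_le _ _).trans_lt ?_
      rw [lintegral_smul_measure]
      refine ENNReal.mul_lt_top hc1.lt_top ?_
      refine (lintegral_mono_ae (g := fun _ => ENNReal.ofReal (2 * n)) ?_).trans_lt ?_
      · filter_upwards [hmae] with z hz
        rw [TestCurve.variation_jump, edist_dist]
        refine ENNReal.ofReal_le_ofReal ((dist_triangle_right _ _ x₀).trans ?_)
        have h1 := Metric.mem_ball.1 hz.2.1.1
        have h2 := Metric.mem_ball.1 hz.2.1.2
        linarith
      · rw [lintegral_const]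
        exact ENNReal.mul_lt_top ENNReal.ofReal_lt_top hm1.lt_top
  have h_int := h.2 ν htest hadm
  rw [hν, lintegral_map (measurable_enorm_eval hf) hJ, lintegral_smul_measure] at h_int
  -- Only an upper bound is needed on this side, so measurability of the symmetrized integral as a
  -- function of the curve is not required.
  have h_int' := h_int.trans (lintegral_map_le _ _)
  rw [lintegral_smul_measure] at h_int'
  simp only [smul_eq_mul] at h_int'
  rw [ENNReal.mul_le_mul_iff_right hc0 hc1] at h_int'
  simp only [TestCurve.jump_zero, TestCurve.jump_one, TestCurve.symIntegral_jump _ _ h.1] at h_int'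
  have hlt : ∫⁻ z in D n, (g z.1 + g z.2) * edist z.1 z.2 ∂μ.prod μ <
      ∫⁻ z in D n, ‖f z.2 - f z.1‖ₑ ∂μ.prod μ := by
    refine setLIntegral_strict_mono (hDm n) hpos hL ?_ (Eventually.of_forall fun z hz => hz.1)
    refine ne_top_of_le_ne_top ?_ (setLIntegral_mono' (g := fun _ => (n : ℝ≥0∞)) (hDm n)
      fun z hz => hz.1.le.trans hz.2.2)
    rw [lintegral_const, ← hm]
    exact ENNReal.mul_ne_top (ENNReal.natCast_ne_top n) hm1
  refine absurd (h_int'.trans ?_) (not_le.2 hlt)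
  exact lintegral_mono fun z =>
    ENNReal.div_le_of_le_mul (le_mul_of_one_le_right bot_le (by norm_num))

/-- On a separable space with a measure that is finite on balls, `μ`-upper S-gradients are Hajłasz
gradients. -/
theorem IsMeasureUpperSGradient.isHajlaszGradient [SecondCountableTopology X] [SFinite μ]
    (hμ : ∀ (x : X) (r : ℝ), μ (Metric.ball x r) < ∞) (hf : Measurable[borel X] f)
    (h : IsMeasureUpperSGradient μ f g) : IsHajlaszGradient μ f g := by
  have h1 := (Measure.ae_ae_of_ae_prod (h.ae_prod hμ hf)).and
    (ae_forall_measure_ball_inter_ne_zero μ g)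
  refine ⟨measurable_of_borel h.1, toMeasurable μ _, measurableSet_toMeasurable _ _,
    (measure_toMeasurable _).trans (ae_iff.1 h1), fun x hx y hy => ?_⟩
  have hx' := fun hxx => hx (subset_toMeasurable _ _ hxx)
  have hy' := fun hyy => hy (subset_toMeasurable _ _ hyy)
  simp only [mem_ofPred_eq, imp_false, not_not] at hx' hy'
  rcases eq_or_ne x y with rfl | hxy
  · simp
  have hd : edist x y ≠ 0 := (edist_pos.2 hxy).ne'
  rcases eq_or_ne (g x) ∞ with hgx | hgx
  · rw [hgx, top_add, ENNReal.top_mul hd]; exact le_top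
  rcases eq_or_ne (g y) ∞ with hgy | hgy
  · rw [hgy, add_top, ENNReal.top_mul hd]; exact le_top
  -- The inequality is known from `x` and from `y` to almost every point, but perhaps not for the
  -- pair `(x, y)`. Positive mass near `x` with `g < g x + δ` supplies an intermediate `z` good for
  -- both. The step from `x` to `z` disappears as `δ → 0`, so no constant is lost.
  have key : ∀ δ : ℝ≥0, 0 < δ → ‖f y - f x‖₊ ≤
      ((g x).toNNReal + ((g x).toNNReal + δ)) * δ +
        ((g y).toNNReal + ((g x).toNNReal + δ)) * (nndist x y + δ) := by
    intro δ hδ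
    have hne := hx'.2 (g x + δ) (ENNReal.lt_add_right hgx (by exact_mod_cast hδ.ne')) δ
      (by exact_mod_cast hδ)
    have hz : ∃ z ∈ Metric.ball x δ ∩ {z | g z < g x + δ},
        ‖f z - f x‖ₑ ≤ (g x + g z) * edist x z ∧ ‖f z - f y‖ₑ ≤ (g y + g z) * edist y z := by
      by_contra! hcon
      have hae := measure_eq_zero_iff_ae_notMem.2 ((hx'.1.and hy'.1).mono
        fun z hz' (hz : z ∈ Metric.ball x δ ∩ {z | g z < g x + δ}) =>
          not_le.2 (hcon z hz hz'.1) hz'.2)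
      exact hne hae
    obtain ⟨z, ⟨hzb, hzg⟩, hzx, hzy⟩ := hz
    have hzd : edist x z ≤ δ := by
      rw [edist_comm, edist_dist]
      have := (Metric.mem_ball.1 hzb).le
      exact (ENNReal.ofReal_le_ofReal this).trans (by simp)
    have hzg' : g z ≤ g x + δ := le_of_lt hzg
    have : ‖f y - f x‖ₑ ≤ (g x + (g x + δ)) * δ + (g y + (g x + δ)) * (edist x y + δ) := by
      calc ‖f y - f x‖ₑ = ‖(f z - f x) - (f z - f y)‖ₑ := by congr 1; ring
        _ ≤ ‖f z - f x‖ₑ + ‖f z - f y‖ₑ := enorm_sub_le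
        _ ≤ (g x + g z) * edist x z + (g y + g z) * edist y z := add_le_add hzx hzy
        _ ≤ _ := by
          gcongr
          refine (edist_triangle y x z).trans ?_
          rw [edist_comm y x]
          gcongr
    rw [← ENNReal.coe_le_coe]
    push_cast
    rw [ENNReal.coe_toNNReal hgx, ENNReal.coe_toNNReal hgy, ← enorm_eq_nnnorm]
    exact this
  have hlim : Tendsto (fun δ : ℝ≥0 => ((g x).toNNReal + ((g x).toNNReal + δ)) * δ +
        ((g y).toNNReal + ((g x).toNNReal + δ)) * (nndist x y + δ)) (𝓝[>] 0)
      (𝓝 (((g y).toNNReal + (g x).toNNReal) * nndist x y)) := by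
    have hc : Continuous fun δ : ℝ≥0 => ((g x).toNNReal + ((g x).toNNReal + δ)) * δ +
        ((g y).toNNReal + ((g x).toNNReal + δ)) * (nndist x y + δ) := by fun_prop
    have := hc.tendsto 0
    simp only [mul_zero, add_zero, zero_add] at this
    exact this.mono_left nhdsWithin_le_nhds
  have := ge_of_tendsto hlim (by filter_upwards [self_mem_nhdsWithin] with δ hδ using key δ hδ)
  rw [← ENNReal.coe_le_coe] at this
  push_cast at this
  rw [ENNReal.coe_toNNReal hgx, ENNReal.coe_toNNReal hgy, ← enorm_eq_nnnorm, add_comm (g y)] at this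
  exact this

end Doubling

/-! ### The canonical maps and their norm bounds -/

section SpaceMaps

variable {X : Type*} [MetricSpace X] [MeasurableSpace X] [OpensMeasurableSpace X]
  {p : ℝ≥0} [hp : Fact (1 ≤ p)] {μ : Measure X}

/-- A surjective continuous linear map which is bounded from below is a linear homeomorphism. -/
theorem exists_continuousLinearEquiv_coe_eq {E F : Type*} [NormedAddCommGroup E] [NormedSpace ℝ E]
    [NormedAddCommGroup F] [NormedSpace ℝ F] (T : E →L[ℝ] F) (hT : Function.Surjective T) (C : ℝ)
    (hC : ∀ x, ‖x‖ ≤ C * ‖T x‖) : ∃ e : E ≃L[ℝ] F, ∀ x, e x = T x := by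
  have hinj : Function.Injective T := (injective_iff_map_eq_zero T).2 fun x hx => by
    have := hC x
    rw [hx, norm_zero, mul_zero] at this
    exact norm_le_zero_iff.1 this
  let e : E ≃ₗ[ℝ] F := LinearEquiv.ofBijective T.toLinearMap ⟨hinj, hT⟩
  refine ⟨e.toContinuousLinearEquivOfBounds ‖T‖ C (fun x => T.le_opNorm x) fun y => ?_, fun x => rfl⟩
  have := hC (e.symm y)
  rwa [show T (e.symm y) = y from e.apply_symm_apply y] at this

/-- The map between the separation quotients induced by a continuous linear map. -/
def mapQuotient {E F : Type*} [SeminormedAddCommGroup E] [NormedSpace ℝ E]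
    [SeminormedAddCommGroup F] [NormedSpace ℝ F] (L : E →L[ℝ] F) :
    SeparationQuotient E →L[ℝ] SeparationQuotient F :=
  SeparationQuotient.liftCLM ((SeparationQuotient.mkCLM ℝ F).comp L)
    fun _ _ h => SeparationQuotient.mk_eq_mk.2 (h.map L.continuous)

/-- The inclusion of the hat-`TC`-Newtonian pre-space in the `TC`-Newtonian one. -/
def PreHatNewtonian.toPreNewtonian : PreHatNewtonian p μ →L[ℝ] PreNewtonian p μ :=
  LinearMap.mkContinuous
    { toFun := fun f => ⟨f.fn, measurable_of_borel f.2.1, f.2.2.1,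
        f.2.2.2.imp fun _ hg => ⟨hg.1.isWeak, hg.2⟩⟩
      map_add' := fun _ _ => rfl
      map_smul' := fun _ _ => rfl } 1 fun f => by
    rw [one_mul]
    refine ENNReal.toReal_mono (ENNReal.add_ne_top.2 ⟨f.2.2.1.ne, gradNorm_ne_top f.2.2.2⟩) ?_
    exact add_le_add le_rfl (gradNorm_mono fun _ hg => hg.isWeak)

/-- Everywhere valid upper gradients are generalized weak ones and approximate weak ones in norm, so
the inclusion is isometric. -/
theorem PreHatNewtonian.norm_le_norm_toPreNewtonian (f : PreHatNewtonian p μ) :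
    ‖f‖ ≤ ‖toPreNewtonian f‖ := by
  refine ENNReal.toReal_mono (ENNReal.add_ne_top.2
    ⟨f.2.2.1.ne, gradNorm_ne_top (toPreNewtonian f).2.2.2⟩) (add_le_add le_rfl ?_)
  exact (gradNorm_mono fun _ hg => hg.isGeneralizedWeak hp.out).trans
    (gradNorm_isUpperSGradient_le_isWeak hp.out)

/-- The inclusion of the hat-`TC`-Newtonian pre-space in the Gigli-like one. -/
def PreHatNewtonian.toPreGigli : PreHatNewtonian p μ →L[ℝ] PreGigli p μ :=
  LinearMap.mkContinuous
    { toFun := fun f => ⟨f.fn, f.2.1, f.2.2.1,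
        -- A gradient that is exact on every nontrivial curve integrates against every test measure,
        -- in particular against all admissible ones.
        (IsWeakUpperSGradient.exists_isUpperSGradient hp.out (toPreNewtonian f).2.2.2).imp
          fun _ hg => ⟨hg.1.isMeasure, hg.2⟩⟩
      map_add' := fun _ _ => rfl
      map_smul' := fun _ _ => rfl } 1 fun f => by
    rw [one_mul]
    refine ENNReal.toReal_mono (ENNReal.add_ne_top.2 ⟨f.2.2.1.ne, gradNorm_ne_top f.2.2.2⟩)
      (add_le_add le_rfl ?_)
    exact (gradNorm_mono fun _ hg => hg.isMeasure).trans
      ((gradNorm_isUpperSGradient_le_isWeak hp.out).trans (gradNorm_mono fun _ hg => hg.isWeak))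

theorem PreHatNewtonian.fn_toPreGigli (f : PreHatNewtonian p μ) : (toPreGigli f).fn = f.fn := rfl

theorem PreNewtonian.memLp (f : PreNewtonian p μ) : MemLp f.fn p μ :=
  ⟨f.2.1.aestronglyMeasurable, f.2.2.1⟩

/-- The map sending a function to its almost everywhere equality class. -/
def PreNewtonian.toHajlaszSobolev : PreNewtonian p μ →L[ℝ] HajlaszSobolev p μ :=
  LinearMap.mkContinuous
    { toFun := fun f => ⟨f.memLp.toLp f.fn, f.2.2.2.imp fun _ hg =>
        ⟨(hg.1.isHajlaszGradient hp.out).congr f.memLp.coeFn_toLp.symm, hg.2⟩⟩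
      map_add' := fun _ _ => rfl
      map_smul' := fun _ _ => rfl } 1 fun f => by
    rw [one_mul]
    refine ENNReal.toReal_mono (ENNReal.add_ne_top.2 ⟨f.2.2.1.ne, gradNorm_ne_top f.2.2.2⟩)
      (add_le_add (eLpNorm_congr_ae f.memLp.coeFn_toLp).le ?_)
    exact gradNorm_mono fun _ hg =>
      (hg.isHajlaszGradient hp.out).congr f.memLp.coeFn_toLp.symm

theorem PreNewtonian.toLp_toHajlaszSobolev (f : PreNewtonian p μ) :
    (toHajlaszSobolev f).toLp =ᵐ[μ] f.fn := f.memLp.coeFn_toLp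

theorem HajlaszSobolev.ext_ae {u v : HajlaszSobolev p μ} (h : u.toLp =ᵐ[μ] v.toLp) : u = v :=
  Subtype.ext (Lp.ext h)

variable (p μ) in
/-- The canonical map from the hat-`TC`-Newtonian space to the `TC`-Newtonian space. -/
def hatToNewtonian : HatNewtonian p μ →L[ℝ] Newtonian p μ :=
  mapQuotient PreHatNewtonian.toPreNewtonian

variable (p μ) in
/-- The canonical map from the `TC`-Newtonian space to the Hajłasz-Sobolev space. -/
def newtonianToHajlasz : Newtonian p μ →L[ℝ] HajlaszSobolev p μ :=
  SeparationQuotient.liftCLM PreNewtonian.toHajlaszSobolev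
    fun _ _ h => (h.map PreNewtonian.toHajlaszSobolev.continuous).eq

theorem isCanonicalHatN_hatToNewtonian : IsCanonicalHatN (hatToNewtonian p μ) := fun f =>
  ⟨PreHatNewtonian.toPreNewtonian f, rfl, rfl⟩

theorem isCanonicalNM_newtonianToHajlasz : IsCanonicalNM (newtonianToHajlasz p μ) := fun f =>
  f.toLp_toHajlaszSobolev

theorem norm_le_norm_hatToNewtonian (x : HatNewtonian p μ) : ‖x‖ ≤ ‖hatToNewtonian p μ x‖ := by
  obtain ⟨f, rfl⟩ := SeparationQuotient.surjective_mk x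
  exact f.norm_le_norm_toPreNewtonian

theorem injective_hatToNewtonian : Function.Injective (hatToNewtonian p μ) :=
  (injective_iff_map_eq_zero _).2 fun x hx => by
    have := norm_le_norm_hatToNewtonian x
    rw [hx, norm_zero] at this
    exact norm_le_zero_iff.1 this

theorem newtonianToHajlasz_mk_eq_zero_iff (f : PreNewtonian p μ) :
    newtonianToHajlasz p μ (Newtonian.mk f) = 0 ↔ f.fn =ᵐ[μ] 0 := by
  have h0 : (0 : HajlaszSobolev p μ).toLp =ᵐ[μ] 0 := Lp.coeFn_zero _ _ _
  refine ⟨fun h => ?_, fun h => HajlaszSobolev.ext_ae ?_⟩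
  · have := isCanonicalNM_newtonianToHajlasz f
    rw [h] at this
    exact this.symm.trans h0
  · exact (isCanonicalNM_newtonianToHajlasz f).trans (h.trans h0.symm)

/-- The step from vanishing a.e. to vanishing in the Newtonian space. The Borel null set comes from
Borel measurability of the function, or from Borel regularity of `μ`. -/
theorem Newtonian.mk_eq_zero_of_forall_notMem (f : PreNewtonian p μ) (h0 : f.fn =ᵐ[μ] 0)
    {E : Set X} (hE : MeasurableSet[borel X] E) (hE0 : μ E = 0) (hf : ∀ x ∉ E, f.fn x = 0) :
    Newtonian.mk f = 0 := by
  rw [← norm_eq_zero]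
  have h1 : gradNorm p μ (IsWeakUpperSGradient p μ f.fn) = 0 :=
    le_antisymm ((gradNorm_mono fun _ hg => hg.isWeak hp.out).trans
      (gradNorm_eq_zero_of_forall_notMem hp.out f.2.2.2 hE hE0 hf).le) bot_le
  change (eLpNorm f.fn p μ + gradNorm p μ (IsWeakUpperSGradient p μ f.fn)).toReal = 0
  rw [h1, eLpNorm_congr_ae h0]; simp

theorem injective_newtonianToHajlasz_comp_hatToNewtonian :
    Function.Injective fun u => newtonianToHajlasz p μ (hatToNewtonian p μ u) := by
  refine (injective_iff_map_eq_zero ((newtonianToHajlasz p μ).comp (hatToNewtonian p μ))).2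
    fun x hx => ?_
  obtain ⟨f, rfl⟩ := SeparationQuotient.surjective_mk x
  have h0 : f.fn =ᵐ[μ] 0 :=
    (newtonianToHajlasz_mk_eq_zero_iff (PreHatNewtonian.toPreNewtonian f)).1 hx
  have hE : MeasurableSet[borel X] {x | f.fn x ≠ 0} := by
    let _ : MeasurableSpace X := borel X
    exact (f.2.1 (measurableSet_singleton 0)).compl
  refine injective_hatToNewtonian ?_
  rw [map_zero]
  exact Newtonian.mk_eq_zero_of_forall_notMem (PreHatNewtonian.toPreNewtonian f) h0 hE h0
    fun x hx => not_not.1 hx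

theorem injective_newtonianToHajlasz (hμ : IsBorelRegular μ) :
    Function.Injective (newtonianToHajlasz p μ) := by
  refine (injective_iff_map_eq_zero _).2 fun x hx => ?_
  obtain ⟨f, rfl⟩ := SeparationQuotient.surjective_mk x
  have h0 := (newtonianToHajlasz_mk_eq_zero_iff f).1 hx
  obtain ⟨E, hE, hfE, hE0⟩ := hμ {x | f.fn x ≠ 0}
  refine Newtonian.mk_eq_zero_of_forall_notMem f h0 hE (hE0.trans h0) fun x hx => ?_
  by_contra hne
  exact hx (hfE hne)

theorem HajlaszSobolev.measurable_toLp (u : HajlaszSobolev p μ) : Measurable u.toLp :=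
  (Lp.stronglyMeasurable u.toLp).measurable

/-- Every Hajłasz-Sobolev class contains a Borel function in the hat-`TC`-Newtonian space, whose
upper gradients are controlled by a given Hajłasz gradient. -/
theorem HajlaszSobolev.exists_preHatNewtonian [SigmaFinite μ] (hμ : IsBorelRegular μ)
    (u : HajlaszSobolev p μ) {g : X → ℝ≥0∞} (hg : IsHajlaszGradient μ u.toLp g)
    (hgp : eLpNorm g p μ < ∞) : ∃ f : PreHatNewtonian p μ, u.toLp =ᵐ[μ] f.fn ∧
      gradNorm p μ (IsUpperSGradient f.fn) ≤ 8 * eLpNorm g p μ := by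
  obtain ⟨f, hf, huf, g', hg', hle⟩ := hg.exists_isUpperSGradient hμ u.measurable_toLp hp.out hgp
  have hfp : eLpNorm f p μ < ∞ := by
    rw [← eLpNorm_congr_ae huf]; exact Lp.eLpNorm_lt_top _
  exact ⟨⟨f, hf, hfp, g', hg'.isGeneralizedWeak hp.out,
    hle.trans_lt (ENNReal.mul_lt_top (by norm_num) hgp)⟩, huf, (iInf₂_le g' hg').trans hle⟩

theorem surjective_newtonianToHajlasz_comp_hatToNewtonian [SigmaFinite μ] (hμ : IsBorelRegular μ) :
    Function.Surjective fun u => newtonianToHajlasz p μ (hatToNewtonian p μ u) := by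
  intro u
  obtain ⟨g, hg, hgp⟩ := u.2
  obtain ⟨f, huf, -⟩ := u.exists_preHatNewtonian hμ hg hgp
  exact ⟨HatNewtonian.mk f, HajlaszSobolev.ext_ae
    ((isCanonicalNM_newtonianToHajlasz (PreHatNewtonian.toPreNewtonian f)).trans huf.symm)⟩

/-- Injectivity identifies `x` with the class of a Borel representative built from any given Hajłasz
gradient of its image. The constant is the one of that construction. -/
theorem norm_le_norm_newtonianToHajlasz [SigmaFinite μ] (hμ : IsBorelRegular μ)
    (x : Newtonian p μ) : ‖x‖ ≤ 8 * ‖newtonianToHajlasz p μ x‖ := by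
  set u := newtonianToHajlasz p μ x with hu
  have key : ∀ g, IsHajlaszGradient μ u.toLp g → eLpNorm g p μ < ∞ →
      ENNReal.ofReal ‖x‖ ≤ eLpNorm u.toLp p μ + 8 * eLpNorm g p μ := by
    intro g hg hgp
    obtain ⟨f, huf, hle⟩ := u.exists_preHatNewtonian hμ hg hgp
    have hx : x = Newtonian.mk (PreHatNewtonian.toPreNewtonian f) :=
      injective_newtonianToHajlasz hμ (HajlaszSobolev.ext_ae
        (huf.trans (isCanonicalNM_newtonianToHajlasz (PreHatNewtonian.toPreNewtonian f)).symm))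
    rw [hx, eLpNorm_congr_ae huf]
    change ENNReal.ofReal (ENNReal.toReal _) ≤ _
    refine ENNReal.ofReal_toReal_le.trans (add_le_add le_rfl (le_trans ?_ hle))
    exact gradNorm_mono fun _ hg => hg.isWeak hp.out
  have hle : ENNReal.ofReal ‖x‖ ≤
      eLpNorm u.toLp p μ + 8 * gradNorm p μ (IsHajlaszGradient μ u.toLp) := by
    unfold gradNorm
    rw [ENNReal.mul_iInf_of_ne (by norm_num) (by norm_num), ENNReal.add_iInf]
    refine le_iInf fun g => ?_
    rw [ENNReal.mul_iInf_of_ne (by norm_num) (by norm_num)]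
    by_cases hg : IsHajlaszGradient μ u.toLp g
    · rw [iInf_pos hg]
      rcases eq_or_ne (eLpNorm g p μ) ∞ with htop | htop
      · rw [htop, ENNReal.mul_top (by norm_num), add_top]; exact le_top
      · exact key g hg htop.lt_top
    · rw [iInf_neg hg, add_top]; exact le_top
  have hle' : ENNReal.ofReal ‖x‖ ≤
      8 * (eLpNorm u.toLp p μ + gradNorm p μ (IsHajlaszGradient μ u.toLp)) := by
    rw [mul_add]
    refine hle.trans (add_le_add ?_ le_rfl)
    exact le_mul_of_one_le_left bot_le (by norm_num)
  have := ENNReal.toReal_mono (ENNReal.mul_ne_top (by norm_num) u.enorm_ne_top') hle'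
  rw [ENNReal.toReal_ofReal (norm_nonneg _), ENNReal.toReal_mul] at this
  exact this

/-- A difference that vanishes a.e. has the zero function as `μ`-upper gradient, so the seminorm
sees only a.e. classes. -/
theorem Gigli.mk_eq_mk_iff (f f' : PreGigli p μ) :
    Gigli.mk f = Gigli.mk f' ↔ f.fn =ᵐ[μ] f'.fn := by
  have hp0 : (p : ℝ≥0∞) ≠ 0 := by
    have := lt_of_lt_of_le one_pos hp.out
    exact_mod_cast this.ne'
  have hw : (f - f').fn = fun x => f.fn x - f'.fn x := rfl
  have hbor : Measurable[borel X] (f - f').fn := (f - f').2.1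
  have hfin : eLpNorm (f - f').fn p μ + gradNorm p μ (IsMeasureUpperSGradient μ (f - f').fn) ≠ ∞ :=
    ENNReal.add_ne_top.2 ⟨(f - f').2.2.1.ne, gradNorm_ne_top (f - f').2.2.2⟩
  have hnorm : Gigli.mk f = Gigli.mk f' ↔ ‖f - f'‖ = 0 := by
    rw [Gigli.mk, Gigli.mk, SeparationQuotient.mk_eq_mk, Metric.inseparable_iff, dist_eq_norm]
  rw [hnorm]
  change ENNReal.toReal _ = 0 ↔ _
  rw [ENNReal.toReal_eq_zero_iff, or_iff_left hfin, add_eq_zero,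
    eLpNorm_eq_zero_iff (measurable_of_borel hbor).aestronglyMeasurable hp0]
  constructor
  · rintro ⟨h, -⟩
    filter_upwards [h] with x hx
    rw [hw] at hx
    exact sub_eq_zero.1 hx
  · intro h
    have h0 : (f - f').fn =ᵐ[μ] 0 := by
      filter_upwards [h] with x hx
      rw [hw]
      exact sub_eq_zero.2 hx
    exact ⟨h0, gradNorm_zero (isMeasureUpperSGradient_zero_of_ae_eq_zero hbor h0)⟩

/-- The canonical linear homeomorphisms between the Newtonian spaces and the Hajłasz-Sobolev
space. -/
theorem exists_equiv_hatNewtonian_newtonian_hajlasz [SigmaFinite μ] (hμ : IsBorelRegular μ) :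
    ∃ (S : HatNewtonian p μ ≃L[ℝ] Newtonian p μ) (T : Newtonian p μ ≃L[ℝ] HajlaszSobolev p μ),
      IsCanonicalHatN S ∧ IsCanonicalNM T := by
  have hsurj := surjective_newtonianToHajlasz_comp_hatToNewtonian (p := p) hμ
  have hS : Function.Surjective (hatToNewtonian p μ) := fun v => by
    obtain ⟨x, hx⟩ := hsurj (newtonianToHajlasz p μ v)
    exact ⟨x, injective_newtonianToHajlasz hμ hx⟩
  have hT : Function.Surjective (newtonianToHajlasz p μ) := fun u => by
    obtain ⟨x, hx⟩ := hsurj u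
    exact ⟨_, hx⟩
  obtain ⟨S, hSe⟩ := exists_continuousLinearEquiv_coe_eq (hatToNewtonian p μ) hS 1
    fun x => by rw [one_mul]; exact norm_le_norm_hatToNewtonian x
  obtain ⟨T, hTe⟩ := exists_continuousLinearEquiv_coe_eq (newtonianToHajlasz p μ) hT 8
    (norm_le_norm_newtonianToHajlasz hμ)
  refine ⟨S, T, fun f => ?_, fun f => ?_⟩
  · rw [hSe]; exact isCanonicalHatN_hatToNewtonian f
  · rw [hTe]; exact isCanonicalNM_newtonianToHajlasz f

/-- The canonical map from the Hajłasz-Sobolev space to the Gigli-like space. -/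
theorem exists_canonicalMG (S : HatNewtonian p μ ≃L[ℝ] Newtonian p μ)
    (T : Newtonian p μ ≃L[ℝ] HajlaszSobolev p μ) (hS : IsCanonicalHatN S) (hT : IsCanonicalNM T) :
    ∃ R : HajlaszSobolev p μ →L[ℝ] Gigli p μ, IsCanonicalMG R ∧ Function.Injective R := by
  -- The route back through both homeomorphisms ends at a Borel representative in the hat-Newtonian
  -- space, whose class in `G^{1,p}` is then taken.
  set R : HajlaszSobolev p μ →L[ℝ] Gigli p μ := (mapQuotient PreHatNewtonian.toPreGigli).comp
    ((S.symm : Newtonian p μ →L[ℝ] HatNewtonian p μ).comp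
      (T.symm : HajlaszSobolev p μ →L[ℝ] Newtonian p μ))
  have hR : ∀ u, ∃ h : PreHatNewtonian p μ, u.toLp =ᵐ[μ] h.fn ∧
      R u = Gigli.mk (PreHatNewtonian.toPreGigli h) := by
    intro u
    obtain ⟨h, hh⟩ := SeparationQuotient.surjective_mk (S.symm (T.symm u))
    refine ⟨h, ?_, ?_⟩
    · obtain ⟨f', hf', hSf⟩ := hS h
      have hu : T (Newtonian.mk f') = u := by
        rw [← hSf, show HatNewtonian.mk h = S.symm (T.symm u) from hh, S.apply_symm_apply,
          T.apply_symm_apply]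
      have := hT f'
      rwa [hu, hf'] at this
    · change mapQuotient _ (S.symm (T.symm u)) = _
      rw [← hh]; rfl
  have hcan : IsCanonicalMG R := by
    intro u f
    obtain ⟨h, huh, hRu⟩ := hR u
    rw [hRu, Gigli.mk_eq_mk_iff, PreHatNewtonian.fn_toPreGigli]
    exact ⟨fun hhf => huh.trans hhf, fun huf => huh.symm.trans huf⟩
  refine ⟨R, hcan, fun u v huv => ?_⟩
  obtain ⟨h, hvh, hRv⟩ := hR v
  exact HajlaszSobolev.ext_ae (((hcan u _).1 (huv.trans hRv)).trans hvh.symm)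

/-- Every `μ`-upper gradient of `f` is now a Hajłasz gradient of its a.e. class. This gives
surjectivity, and bounds the inverse with constant one. -/
theorem IsCanonicalMG.exists_equiv (hμ : IsDoubling μ) {R : HajlaszSobolev p μ →L[ℝ] Gigli p μ}
    (hR : IsCanonicalMG R) : ∃ e : HajlaszSobolev p μ ≃L[ℝ] Gigli p μ, IsCanonicalMG e := by
  have := hμ.sigmaFinite
  have := hμ.secondCountableTopology
  have hball : ∀ (x : X) (r : ℝ), μ (Metric.ball x r) < ∞ := by
    intro x r
    rcases le_or_gt r 0 with hr | hr
    · rw [Metric.ball_eq_empty.2 hr, measure_empty]; exact ENNReal.zero_lt_top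
    · obtain ⟨C, hC⟩ := hμ
      exact (hC x r hr).2.1
  have hsurj : ∀ y, ∃ (f : PreGigli p μ) (u : HajlaszSobolev p μ), y = Gigli.mk f ∧ R u = y ∧
      u.toLp =ᵐ[μ] f.fn := by
    intro y
    obtain ⟨f, rfl⟩ := SeparationQuotient.surjective_mk y
    have hmem : MemLp f.fn p μ := ⟨(measurable_of_borel f.2.1).aestronglyMeasurable, f.2.2.1⟩
    obtain ⟨g, hg, hgp⟩ := f.2.2.2
    set u : HajlaszSobolev p μ := ⟨hmem.toLp f.fn, g,
      (hg.isHajlaszGradient hball f.2.1).congr hmem.coeFn_toLp.symm, hgp⟩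
    have hu : u.toLp =ᵐ[μ] f.fn := hmem.coeFn_toLp
    exact ⟨f, u, rfl, (hR u f).2 hu, hu⟩
  have hinj : Function.Injective R := by
    intro u v huv
    obtain ⟨f, -, hf, -, -⟩ := hsurj (R v)
    exact HajlaszSobolev.ext_ae (((hR u f).1 (huv.trans hf)).trans ((hR v f).1 hf).symm)
  obtain ⟨e, he⟩ := exists_continuousLinearEquiv_coe_eq R
    (fun y => let ⟨_, u, _, h, _⟩ := hsurj y; ⟨u, h⟩) 1 fun u => by
      obtain ⟨f, v, hf, hv, hvf⟩ := hsurj (R u)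
      obtain rfl := hinj hv
      rw [one_mul, hf]
      refine ENNReal.toReal_mono
        (ENNReal.add_ne_top.2 ⟨f.2.2.1.ne, gradNorm_ne_top f.2.2.2⟩) ?_
      refine add_le_add (eLpNorm_congr_ae hvf).le (gradNorm_mono fun g hg => ?_)
      exact (hg.isHajlaszGradient hball f.2.1).congr hvf.symm
  exact ⟨e, fun u f => by rw [he]; exact hR u f⟩

end SpaceMaps

end TCSobolev

end

/-! ### Assembly of the four statements -/

open TCSobolev
theorem mainTheorem1 {X : Type*} [MetricSpace X] [MeasurableSpace X] [OpensMeasurableSpace X]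
    (μ : Measure X) (p : ℝ≥0) [Fact (1 ≤ p)] :
    (∃ (S : HatNewtonian p μ →L[ℝ] Newtonian p μ) (T : Newtonian p μ →L[ℝ] HajlaszSobolev p μ),
      IsCanonicalHatN S ∧ IsCanonicalNM T ∧ Function.Injective S ∧
      (∀ f : PreNewtonian p μ, T (Newtonian.mk f) = 0 ↔ f.fn =ᵐ[μ] 0) ∧
      Function.Injective (fun u => T (S u))) ∧
    (IsBorelRegular μ →
      ∃ (S : HatNewtonian p μ →L[ℝ] Newtonian p μ) (T : Newtonian p μ →L[ℝ] HajlaszSobolev p μ),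
        IsCanonicalHatN S ∧ IsCanonicalNM T ∧ Function.Injective S ∧ Function.Injective T) ∧
    (SigmaFinite μ → IsBorelRegular μ →
      ∃ (S : HatNewtonian p μ ≃L[ℝ] Newtonian p μ) (T : Newtonian p μ ≃L[ℝ] HajlaszSobolev p μ)
        (R : HajlaszSobolev p μ →L[ℝ] Gigli p μ),
        IsCanonicalHatN S ∧ IsCanonicalNM T ∧ IsCanonicalMG R ∧ Function.Injective R) ∧
    (IsDoubling μ → IsBorelRegular μ →
      ∃ (S : HatNewtonian p μ ≃L[ℝ] Newtonian p μ) (T : Newtonian p μ ≃L[ℝ] HajlaszSobolev p μ)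
        (R : HajlaszSobolev p μ ≃L[ℝ] Gigli p μ),
        IsCanonicalHatN S ∧ IsCanonicalNM T ∧ IsCanonicalMG R) := by
  refine ⟨⟨hatToNewtonian p μ, newtonianToHajlasz p μ, isCanonicalHatN_hatToNewtonian,
    isCanonicalNM_newtonianToHajlasz, injective_hatToNewtonian, newtonianToHajlasz_mk_eq_zero_iff,
    injective_newtonianToHajlasz_comp_hatToNewtonian⟩, fun hμ => ⟨hatToNewtonian p μ,
    newtonianToHajlasz p μ, isCanonicalHatN_hatToNewtonian, isCanonicalNM_newtonianToHajlasz,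
    injective_hatToNewtonian, injective_newtonianToHajlasz hμ⟩, fun hσ hμ => ?_, fun hd hμ => ?_⟩
  · obtain ⟨S, T, hS, hT⟩ := exists_equiv_hatNewtonian_newtonian_hajlasz (p := p) hμ
    obtain ⟨R, hR, hRi⟩ := exists_canonicalMG S T hS hT
    exact ⟨S, T, R, hS, hT, hR, hRi⟩
  · have := hd.sigmaFinite
    obtain ⟨S, T, hS, hT⟩ := exists_equiv_hatNewtonian_newtonian_hajlasz (p := p) hμ
    obtain ⟨R, hR, -⟩ := exists_canonicalMG S T hS hT
    obtain ⟨e, he⟩ := hR.exists_equiv hd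
    exact ⟨S, T, e, hS, hT, he⟩
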